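/- Let $L,\alpha,\nu,T>0$ and $N\in\mathbb N=\{0,1,2,\dots\}$. Let $\mathbb T=(\mathbb R/L\mathbb Z)^3$, and for $\mathbf k\in\mathcal T:=\frac{2\pi}{L}\mathbb Z^3$ write $\widehat u_{\mathbf k}=L^{-3}\int_{\mathbb T}u(x)e^{-i\mathbf k\cdot x}\,dx$. For $s\in\mathbb R$ let $\mathbf H_s$ be the space of real, divergence-free, zero-mean periodic vector fields (distributions if $s<0$) with $\|\mathbf w\|_s^2=\sum_{\mathbf k\ne 0}|\mathbf k|^{2s}|\widehat{\mathbf w}_{\mathbf k}|^2<\infty$. Let $G=(I-\alpha^2\Delta)^{-1}$ be the Helmholtz filter on $\mathbb T$, i.e. the Fourier multiplier with symbol $(1+\alpha^2|\mathbf k|^2)^{-1}$, applied componentwise to vectors and tensors, and let $D_N=\sum_{n=0}^N(I-G)^n$ be the Van Cittert deconvolution operator. Let $\mathbf u_0\in\mathbf H_0$ and $\mathbf f\in L^2([0,T];\mathbf H_{-1})$. A *regular weak solution* of the approximate deconvolution model $$\partial_t\mathbf w+\nabla\cdot G\big(D_N\mathbf w\otimes D_N\mathbf w\big)-\nu\Delta\mathbf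 w+\nabla q=G\mathbf f,\qquad \nabla\cdot\mathbf w=0,\qquad \mathbf w(0)=G\mathbf u_0$$ on $[0,T]\times\mathbb T$ is a pair $(\mathbf w,q)$ such that 1. $\mathbf w\in L^2([0,T];\mathbf H_2)\cap C([0,T];\mathbf H_1)$, $\partial_t\mathbf w\in L^2([0,T];\mathbf H_0)$, $q\in L^2([0,T];H^1(\mathbb T))$, and $\int_{\mathbb T}q(t,x)\,dx=0$ for almost every $t$; 2. $\lim_{t\to0^+}\|\mathbf w(t)-G\mathbf u_0\|_{\mathbf H_1}=0$; 3. for all $\mathbf v\in L^2([0,T];H^1(\mathbb T)^3)$, $$\int_0^T\!\!\int_{\mathbb T}\partial_t\mathbf w\cdot\mathbf v-\int_0^T\!\!\int_{\mathbb T}G\big(D_N\mathbf w\otimes D_N\mathbf w\big):\nabla\mathbf v+\nu\int_0^T\!\!\int_{\mathbb T}\nabla\mathbf w:\nabla\mathbf v+\int_0^T\!\!\int_{\mathbb T}\nabla q\cdot\mathbf v=\int_0^T\!\!\int_{\mathbb T}G\mathbf f\cdot\mathbf v .$$ Then the model has exactly one regular weak solution: one exists, and any two of them, $(\mathbf w_1,q_1)$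 and $(\mathbf w_2,q_2)$, satisfy $\mathbf w_1(t)=\mathbf w_2(t)$ for all $t\in[0,T]$ and $q_1(t)=q_2(t)$ for almost every $t\in[0,T]$. -/

import Mathlib

open MeasureTheory Filter Topology
open scoped ENNReal ContDiff

noncomputable section

namespace ADM

/-- The torus `(ℝ / L ℤ)³`; its `volume` is the Lebesgue measure, of total mass `L ^ 3`. -/
abbrev Torus (L : ℝ) : Type := Fin 3 → AddCircle L

/-- Indices of Fourier modes; the mode `k` has the wave vector `2 π k / L`. -/
abbrev Mode : Type := Fin 3 → ℤ

/-- Components of the wave vector `2 π k / L`. -/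
def wave (L : ℝ) (k : Mode) (j : Fin 3) : ℝ := 2 * Real.pi * (k j : ℝ) / L

/-- Squared Euclidean length of the wave vector. -/
def waveSq (L : ℝ) (k : Mode) : ℝ := ∑ j, wave L k j ^ 2

section Spaces

variable (L : ℝ) [Fact (0 < L)]

/-- Real-valued square integrable functions on the torus. -/
abbrev L2 : Type := Lp ℝ 2 (volume : Measure (Torus L))

/-- Square integrable vector fields on the torus. -/
abbrev VField : Type := Fin 3 → L2 L

end Spaces

variable {L : ℝ} [Fact (0 < L)]

/-- Fourier coefficient `L⁻³ ∫ u(x) exp(- i (2 π k / L) · x) dx` of a function on the torus. -/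
def fc (u : Torus L → ℝ) (k : Mode) : ℂ :=
  (1 / (L : ℂ) ^ 3) * ∫ x : Torus L, (u x : ℂ) * ∏ j, fourier (-(k j)) (x j)

open Classical in
/-- The function in `L²` whose Fourier coefficients are `c`
(zero if there is no such function). -/
def ofCoeff (c : Mode → ℂ) : L2 L :=
  if h : ∃ v : L2 L, ∀ k, fc (⇑v) k = c k then h.choose else 0

/-- The (weak) partial derivative `∂ⱼ`, which has the symbol `i (2 π kⱼ / L)`. -/
def pd (j : Fin 3) (u : L2 L) : L2 L :=
  ofCoeff fun k => Complex.I * (wave L k j : ℂ) * fc (⇑u) k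

/-- The symbol of the Helmholtz filter `G = (I - α² Δ)⁻¹`. -/
def filterSymbol (L α : ℝ) (k : Mode) : ℝ := 1 / (1 + α ^ 2 * waveSq L k)

/-- The Helmholtz filter `G = (I - α² Δ)⁻¹` on scalar functions. It is defined on functions
that need not be square integrable because it is applied to products. -/
def filter (α : ℝ) (u : Torus L → ℝ) : L2 L :=
  ofCoeff fun k => (filterSymbol L α k : ℂ) * fc u k

/-- The Van Cittert deconvolution operator `D_N = ∑_{n = 0}^{N} (I - G)ⁿ`. -/
def deconv (α : ℝ) (N : ℕ) (u : L2 L) : L2 L :=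
  ∑ n ∈ Finset.range (N + 1), (fun v : L2 L => v - filter α ⇑v)^[n] u

/-- A periodic vector-valued distribution, given through its Fourier coefficients. -/
abbrev Coeffs : Type := Mode → Fin 3 → ℂ

/-- The Fourier coefficients of a square integrable vector field. -/
def coeffs (u : VField L) : Coeffs := fun k i => fc (⇑(u i)) k

/-- The Helmholtz filter on vector-valued distributions, component by component. -/
def filterDist (α : ℝ) (c : Coeffs) : VField L :=
  fun i => ofCoeff fun k => (filterSymbol L α k : ℂ) * c k i

/-- `‖c‖ₛ² = ∑_k |2 π k / L|^(2 s) |c_k|²`, possibly infinite. -/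
def hNormSq (L s : ℝ) (c : Coeffs) : ℝ≥0∞ :=
  ∑' k : Mode, ENNReal.ofReal (waveSq L k ^ s * ∑ i, ‖c k i‖ ^ 2)

/-- The space `𝐇ₛ`, for every real `s`: real, divergence-free, zero mean, and of finite norm. -/
structure MemH (L s : ℝ) (c : Coeffs) : Prop where
  isReal : ∀ k i, c (-k) i = (starRingEnd ℂ) (c k i)
  divFree : ∀ k, ∑ i, (wave L k i : ℂ) * c k i = 0
  zeroMean : ∀ i, c 0 i = 0
  finite : hNormSq L s c < ⊤

/-- `f ∈ L²([0,T]; 𝐇ₛ)` for distributions (measurability in the separable Hilbert space `𝐇ₛ`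
is measurability of all Fourier coefficients). -/
structure MemL2HDist (L T s : ℝ) (f : ℝ → Coeffs) : Prop where
  measurable : ∀ k i, AEMeasurable (fun t => f t k i) (volume.restrict (Set.Icc 0 T))
  mem : ∀ᵐ t ∂(volume.restrict (Set.Icc 0 T)), MemH L s (f t)
  finite : ∫⁻ t in Set.Icc 0 T, hNormSq L s (f t) < ⊤

/-- `w ∈ L²([0,T]; 𝐇ₛ)`, `s ≥ 0`, for vector fields. -/
structure MemL2H (T s : ℝ) (w : ℝ → VField L) : Prop where
  measurable : AEStronglyMeasurable w (volume.restrict (Set.Icc 0 T))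
  mem : ∀ᵐ t ∂(volume.restrict (Set.Icc 0 T)), MemH L s (coeffs (w t))
  finite : ∫⁻ t in Set.Icc 0 T, hNormSq L s (coeffs (w t)) < ⊤

/-- `w ∈ C([0,T]; 𝐇ₛ)`, `s ≥ 0`. -/
structure MemCH (T s : ℝ) (w : ℝ → VField L) : Prop where
  mem : ∀ t ∈ Set.Icc 0 T, MemH L s (coeffs (w t))
  continuous : ∀ t ∈ Set.Icc 0 T,
    Tendsto (fun τ => hNormSq L s (coeffs (w τ - w t))) (𝓝[Set.Icc 0 T] t) (𝓝 0)

/-- The squared norm of `H¹` of the torus (without any condition on mean or divergence). -/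
def h1NormSq (u : L2 L) : ℝ≥0∞ :=
  ∑' k : Mode, ENNReal.ofReal ((1 + waveSq L k) * ‖fc (⇑u) k‖ ^ 2)

/-- `q ∈ L²([0,T]; H¹)` for scalar functions. -/
structure MemL2H1 (T : ℝ) (q : ℝ → L2 L) : Prop where
  measurable : AEStronglyMeasurable q (volume.restrict (Set.Icc 0 T))
  finite : ∫⁻ t in Set.Icc 0 T, h1NormSq (q t) < ⊤

/-- `w'` is the weak time derivative of `w` on `(0,T)`. -/
def IsWeakTimeDeriv (T : ℝ) (w w' : ℝ → VField L) : Prop :=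
  ∀ φ : ℝ → ℝ, ContDiff ℝ ∞ φ → HasCompactSupport φ → tsupport φ ⊆ Set.Ioo 0 T →
    ∫ t in Set.Icc 0 T, deriv φ t • w t = - ∫ t in Set.Icc 0 T, φ t • w' t

/-- The weak formulation of
`∂ₜ w + ∇ · G (D_N w ⊗ D_N w) - ν Δ w + ∇ q = G f`, where `w'` stands for `∂ₜ w`. -/
def WeakForm (α ν T : ℝ) (N : ℕ) (f : ℝ → Coeffs)
    (w w' : ℝ → VField L) (q : ℝ → L2 L) : Prop :=
  ∀ v : ℝ → VField L, (∀ i, MemL2H1 T fun t => v t i) →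
    (∫ t in Set.Icc 0 T, ∫ x : Torus L, ∑ i, w' t i x * v t i x)
      - (∫ t in Set.Icc 0 T, ∫ x : Torus L, ∑ i, ∑ j,
          filter α (fun y => deconv α N (w t i) y * deconv α N (w t j) y) x
            * pd j (v t i) x)
      + ν * (∫ t in Set.Icc 0 T, ∫ x : Torus L, ∑ i, ∑ j,
          pd j (w t i) x * pd j (v t i) x)
      + (∫ t in Set.Icc 0 T, ∫ x : Torus L, ∑ i, pd i (q t) x * v t i x)
    = ∫ t in Set.Icc 0 T, ∫ x : Torus L, ∑ i,
        (filterDist α (f t) : VField L) i x * v t i x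

/-- `(w, q)` is a regular weak solution on `[0,T]` of the approximate deconvolution model of
order `N` with data `u₀` and `f`. -/
structure IsRegularWeakSolution (α ν T : ℝ) (N : ℕ) (u₀ : VField L) (f : ℝ → Coeffs)
    (w : ℝ → VField L) (q : ℝ → L2 L) : Prop where
  memL2H2 : MemL2H T 2 w
  memCH1 : MemCH T 1 w
  pressure : MemL2H1 T q
  pressure_zeroMean : ∀ᵐ t ∂(volume.restrict (Set.Icc 0 T)), ∫ x : Torus L, q t x = 0
  initial : Tendsto (fun t => hNormSq L 1 (coeffs (w t - fun i => filter α ⇑(u₀ i))))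
    (𝓝[>] 0) (𝓝 0)
  equation : ∃ w' : ℝ → VField L, MemL2H T 0 w' ∧ IsWeakTimeDeriv T w w' ∧
    WeakForm α ν T N f w w' q

end ADM

end

/-! The model is solved on Fourier coefficients, with the weighted unknown `a k = |k| w_k`, whose ℓ²
norm is the `H₁` norm of `w`. Two facts make the problem semilinear with a harmless nonlinearity.
The filter symbol is square summable over the modes in dimension three (`summable_filterSymbol_sq`),
and the kernel `|k| / (|l| |k - l|)` of the weighted convolution is bounded (`abs_convWeight_le`).
Hence mode `k` of the Leray projected nonlinear term is bounded by a constant times `G(k) ‖a‖²`.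

Truncating `a` radially at radius `R` makes this term globally Lipschitz, with square summable
constants. For the diagonal equation `y' = -ν |k|² y + F - Q y`, maximal regularity mode by mode
(`duhamel_energy_le`) turns Duhamel's formula into a Volterra map on `C([0,T]; ℓ²)`. Some iterate of
it is a contraction, so the truncated problem has exactly one solution on all of `[0,T]`, and this
solution is in `H₂` for almost every time.

The truncation is removed by the energy identity of the model. Testing with `(1 + α²|k|²) D_N(k)
w_k` cancels `G` and puts `D_N` on the test factor. What remains is the trilinear form of `v = D_N
w`, which vanishes for real divergence-free `v` (`im_trilinear_eq_zero`,
`tsum_energy_nonlin_eq_zero`). The truncation only multiplies the nonlinear term by a real scalar,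
so the cancellation survives it and the `H₁` bound does not involve `R`. A larger `R` is then never
felt. Conversely, two solutions continuous in `H₁` are bounded, so both solve one truncated problem
and coincide.

It remains to identify regular weak solutions with solutions of the mode equations. Testing with the
filtered residual shows that the weak form holds iff every Fourier coefficient of the momentum
balance vanishes almost everywhere (`weakForm_iff`). The gradient part of the balance determines the
pressure, and the lemma of du Bois-Reymond turns the weak time derivative into a primitive in each
mode (`isWeakTimeDeriv_iff`). -/

noncomputable section

namespace ADM

open scoped ComplexConjugate

/-! ### Fourier analysis on the torus: Hilbert basis, Parseval, Riesz–Fischer, convolution. -/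

section Fourier

variable {L : ℝ}

/-- The exponential monomial `exp (i (2 π k / L) · x)`. -/
def expMode (L : ℝ) (k : Mode) : C(Torus L, ℂ) where
  toFun x := ∏ i, fourier (k i) (x i)
  continuous_toFun := by fun_prop

lemma expMode_apply (k : Mode) (x : Torus L) : expMode L k x = ∏ i, fourier (k i) (x i) := rfl

lemma expMode_neg (k : Mode) (x : Torus L) : expMode L (-k) x = conj (expMode L k x) := by
  simp only [expMode_apply, Pi.neg_apply, fourier_neg, map_prod]

lemma expMode_add (k l : Mode) (x : Torus L) :
    expMode L (k + l) x = expMode L k x * expMode L l x := by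
  simp only [expMode_apply, Pi.add_apply, fourier_add, ← Finset.prod_mul_distrib]

lemma expMode_zero (x : Torus L) : expMode L 0 x = 1 := by
  simp [expMode_apply]

lemma norm_expMode_apply (k : Mode) (x : Torus L) : ‖expMode L k x‖ = 1 := by
  simp only [expMode_apply, fourier_apply, norm_prod, Circle.norm_coe, Finset.prod_const_one]

lemma expMode_single (z : Torus L) (i : Fin 3) :
    expMode L (Pi.single i 1) z = fourier 1 (z i) := by
  rw [expMode_apply, Finset.prod_eq_single i]
  · simp
  · intro j _ hj
    simp [Pi.single_eq_of_ne hj]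
  · simp

/-- The star subalgebra generated by the exponential monomials. -/
def expSubalgebra (L : ℝ) : StarSubalgebra ℂ C(Torus L, ℂ) where
  toSubalgebra := Algebra.adjoin ℂ (Set.range (expMode L))
  star_mem' := by
    change Algebra.adjoin ℂ (Set.range (expMode L)) ≤
      star (Algebra.adjoin ℂ (Set.range (expMode L)))
    refine Algebra.adjoin_le ?_
    rintro _ ⟨n, rfl⟩
    refine Algebra.subset_adjoin ⟨-n, ?_⟩
    ext1 x
    simp only [expMode_neg, starRingEnd_apply, ContinuousMap.star_apply]

lemma expSubalgebra_coe :
    (expSubalgebra L).toSubalgebra.toSubmodule = Submodule.span ℂ (Set.range (expMode L)) := by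
  apply Algebra.adjoin_eq_span_of_subset
  refine .trans (fun x ↦ Submonoid.closure_induction (fun _ ↦ id) ⟨0, ?_⟩ ?_)
    Submodule.subset_span
  · ext z
    exact expMode_zero z
  · rintro _ _ _ _ ⟨m, rfl⟩ ⟨n, rfl⟩
    refine ⟨m + n, ?_⟩
    ext z
    exact expMode_add m n z

variable [hL : Fact (0 < L)]

/-- Points differing in coordinate `i` are told apart by the first harmonic in that coordinate,
since the map of a circle to the unit circle is injective. -/
lemma expSubalgebra_separatesPoints : (expSubalgebra L).SeparatesPoints := by
  classical
  intro x y hxy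
  rw [Ne, funext_iff, not_forall] at hxy
  obtain ⟨i, hi⟩ := hxy
  refine ⟨_, ⟨expMode L (Pi.single i 1), Algebra.subset_adjoin ⟨Pi.single i 1, rfl⟩, rfl⟩, ?_⟩
  dsimp only
  rw [expMode_single, expMode_single, fourier_one, fourier_one]
  exact fun h => hi (AddCircle.injective_toCircle hL.out.ne' (Circle.ext h))

/-- Stone–Weierstrass; products of monomials are monomials, so the generated algebra is their linear
span. -/
lemma span_expMode_closure_eq_top :
    (Submodule.span ℂ (Set.range (expMode L))).topologicalClosure = ⊤ := by
  rw [← expSubalgebra_coe]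
  exact congr_arg (Subalgebra.toSubmodule <| StarSubalgebra.toSubalgebra ·)
    (ContinuousMap.starSubalgebra_topologicalClosure_eq_top_of_separatesPoints _
      expSubalgebra_separatesPoints)

/-- Complex-valued square integrable functions on the torus. -/
abbrev L2C (L : ℝ) [Fact (0 < L)] : Type := Lp ℂ 2 (volume : Measure (Torus L))

lemma integral_fourier (n : ℤ) :
    ∫ x : AddCircle L, fourier n x = if n = 0 then (L : ℂ) else 0 := by
  rw [AddCircle.volume_eq_smul_haarAddCircle, integral_smul_measure,
    ENNReal.toReal_ofReal hL.out.le]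
  have := (orthonormal_iff_ite.mp (orthonormal_fourier (T := L))) 0 n
  rw [ContinuousMap.inner_toLp] at this
  simp only [fourier_zero, map_one, mul_one] at this
  rw [this]
  by_cases h : n = 0
  · simp [h]
  · simp [h, Ne.symm h]

lemma integral_expMode (k : Mode) :
    ∫ x : Torus L, expMode L k x = if k = 0 then (L : ℂ) ^ 3 else 0 := by
  simp only [expMode_apply]
  rw [MeasureTheory.integral_fintype_prod_volume_eq_prod (fun (i : Fin 3) (x : AddCircle L) =>
    (fourier (k i) x : ℂ))]
  simp only [integral_fourier]
  split_ifs with h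
  · simp [h]
  · obtain ⟨i, hi⟩ := Function.ne_iff.mp h
    exact Finset.prod_eq_zero (Finset.mem_univ i) (if_neg hi)

/-- The normalization constant `L ^ (-3/2)`. -/
def normConst (L : ℝ) : ℝ := (√(L ^ 3))⁻¹

lemma normConst_pos : 0 < normConst L := by
  have := hL.out
  unfold normConst; positivity

lemma normConst_sq : normConst L ^ 2 = 1 / L ^ 3 := by
  have := hL.out
  rw [normConst, inv_pow, Real.sq_sqrt (by positivity), one_div]

/-- The normalized exponential monomials in `L²`. -/
def expLp (L : ℝ) [Fact (0 < L)] (k : Mode) : L2C L :=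
  (normConst L : ℂ) • ContinuousMap.toLp (E := ℂ) 2 volume ℂ (expMode L k)

lemma orthonormal_expLp : Orthonormal ℂ (expLp L) := by
  rw [orthonormal_iff_ite]
  intro m n
  have hLp := hL.out
  rw [expLp, expLp, inner_smul_left, inner_smul_right, ContinuousMap.inner_toLp]
  simp only [← expMode_neg, ← expMode_add, integral_expMode]
  have h1 : (normConst L : ℂ) * ((normConst L : ℂ) * (L : ℂ) ^ 3) = 1 := by
    have h := normConst_sq (L := L)
    have : (normConst L * (normConst L * L ^ 3) : ℝ) = 1 := by
      rw [← mul_assoc, ← sq, h]; field_simp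
    exact_mod_cast this
  by_cases h : m = n
  · simp only [h, add_neg_cancel, if_true, Complex.conj_ofReal]
    exact h1
  · have : ¬ (n + -m = 0) := fun h' => h (add_neg_eq_zero.mp h').symm
    simp [this, h]

lemma span_expLp_closure_eq_top :
    (Submodule.span ℂ (Set.range (expLp L))).topologicalClosure = ⊤ := by
  have h1 : (Submodule.span ℂ (Set.range fun k =>
      ContinuousMap.toLp (E := ℂ) 2 (volume : Measure (Torus L)) ℂ
        (expMode L k))).topologicalClosure = ⊤ := by
    simpa only [Submodule.map_span, ContinuousLinearMap.coe_coe, ← Set.range_comp,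
      Function.comp_def] using
      (ContinuousMap.toLp_denseRange ℂ (volume : Measure (Torus L)) ℂ
        (p := 2) (by simp)).topologicalClosure_map_submodule
        span_expMode_closure_eq_top
  refine top_unique (h1.ge.trans (Submodule.topologicalClosure_mono ?_))
  rw [Submodule.span_le]
  rintro _ ⟨k, rfl⟩
  have hc : (normConst L : ℂ) ≠ 0 := by exact_mod_cast (normConst_pos (L := L)).ne'
  have := Submodule.smul_mem (Submodule.span ℂ (Set.range (expLp L))) (normConst L : ℂ)⁻¹
    (Submodule.subset_span ⟨k, rfl⟩)
  rw [expLp, smul_smul, inv_mul_cancel₀ hc, one_smul] at this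
  exact this

/-- The Hilbert basis of normalized exponential monomials. -/
def expBasis (L : ℝ) [Fact (0 < L)] : HilbertBasis Mode ℂ (L2C L) :=
  HilbertBasis.mk orthonormal_expLp span_expLp_closure_eq_top.ge

lemma coe_expBasis : ⇑(expBasis L) = expLp L := HilbertBasis.coe_mk _ _

/-- Fourier coefficients of complex-valued functions. -/
def fcC (u : Torus L → ℂ) (k : Mode) : ℂ :=
  (1 / (L : ℂ) ^ 3) * ∫ x : Torus L, u x * expMode L (-k) x

lemma fc_eq_fcC (u : Torus L → ℝ) (k : Mode) : fc u k = fcC (fun x => (u x : ℂ)) k := rfl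

lemma expBasis_repr (U : L2C L) (k : Mode) :
    (expBasis L).repr U k = (normConst L : ℂ)⁻¹ * fcC (⇑U) k := by
  have hLp := hL.out
  rw [(expBasis L).repr_apply_apply, coe_expBasis, expLp, inner_smul_left, Complex.conj_ofReal,
    MeasureTheory.L2.inner_def, fcC, ← mul_assoc]
  congr 1
  · have h := normConst_sq (L := L)
    have h0 := (normConst_pos (L := L)).ne'
    have : normConst L = (normConst L)⁻¹ * (1 / L ^ 3) := by
      rw [← h]; field_simp
    exact_mod_cast congrArg Complex.ofReal this
  · apply integral_congr_ae
    filter_upwards [ContinuousMap.coeFn_toLp (𝕜 := ℂ) (p := 2) (volume : Measure (Torus L))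
      (expMode L k)] with x hx
    rw [hx, RCLike.inner_apply, expMode_neg]

/-- Complexification of a real square integrable function. -/
def cplx (L : ℝ) [Fact (0 < L)] : L2 L →L[ℝ] L2C L := Complex.ofRealCLM.compLpL 2 volume

lemma coeFn_cplx (u : L2 L) : cplx L u =ᵐ[volume] fun x => (u x : ℂ) :=
  Complex.ofRealCLM.coeFn_compLpL u

lemma fc_eq_fcC_cplx (u : L2 L) (k : Mode) : fc (⇑u) k = fcC (⇑(cplx L u)) k := by
  rw [fc_eq_fcC, fcC, fcC]
  congr 1
  apply integral_congr_ae
  filter_upwards [coeFn_cplx u] with x hx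
  rw [hx]

/-- The `k`-th Fourier coefficient as a continuous linear functional. -/
def fcL (L : ℝ) [Fact (0 < L)] (k : Mode) : L2 L →L[ℝ] ℂ :=
  ((normConst L : ℂ) • (innerSL ℂ (expBasis L k))).restrictScalars ℝ ∘L cplx L

/-- Reduces linearity, measurability and commutation with Bochner integrals of `fc` to those of a
continuous linear map. -/
lemma fcL_apply (u : L2 L) (k : Mode) : fcL L k u = fc (⇑u) k := by
  have h0 : (normConst L : ℂ) ≠ 0 := by exact_mod_cast (normConst_pos (L := L)).ne'
  rw [fc_eq_fcC_cplx]
  change (normConst L : ℂ) * inner ℂ (expBasis L k) (cplx L u) = _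
  rw [← (expBasis L).repr_apply_apply, expBasis_repr, ← mul_assoc, mul_inv_cancel₀ h0, one_mul]

lemma fc_add (u v : L2 L) (k : Mode) : fc (⇑(u + v)) k = fc (⇑u) k + fc (⇑v) k := by
  simp only [← fcL_apply, map_add]

lemma fc_sub (u v : L2 L) (k : Mode) : fc (⇑(u - v)) k = fc (⇑u) k - fc (⇑v) k := by
  simp only [← fcL_apply, map_sub]

lemma fc_smul (c : ℝ) (u : L2 L) (k : Mode) : fc (⇑(c • u)) k = c * fc (⇑u) k := by
  simp only [← fcL_apply, map_smul, Complex.real_smul]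

lemma fc_zero (k : Mode) : fc (⇑(0 : L2 L)) k = 0 := by
  simp only [← fcL_apply, map_zero]

lemma fc_sum {ι : Type*} (s : Finset ι) (u : ι → L2 L) (k : Mode) :
    fc (⇑(∑ i ∈ s, u i)) k = ∑ i ∈ s, fc (⇑(u i)) k := by
  simp only [← fcL_apply, map_sum]

lemma fc_neg_mode (u : Torus L → ℝ) (k : Mode) : fc u (-k) = conj (fc u k) := by
  rw [fc_eq_fcC, fc_eq_fcC, fcC, fcC, map_mul, ← integral_conj]
  congr 1
  · simp
  · congr 1
    ext x
    rw [map_mul, Complex.conj_ofReal, expMode_neg (-k)]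

lemma inv_normConst_sq : (normConst L : ℂ)⁻¹ * (normConst L : ℂ)⁻¹ = (L : ℂ) ^ 3 := by
  have h := normConst_sq (L := L)
  have : (normConst L)⁻¹ * (normConst L)⁻¹ = L ^ 3 := by
    rw [← mul_inv, ← sq, h, one_div, inv_inv]
  exact_mod_cast this

/-- **Parseval's identity** for complex-valued functions. -/
lemma hasSum_fcC (U V : L2C L) :
    HasSum (fun k => (L : ℂ) ^ 3 * (conj (fcC (⇑U) k) * fcC (⇑V) k)) (inner ℂ U V) := by
  refine ((expBasis L).hasSum_inner_mul_inner U V).congr_fun fun k => ?_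
  rw [← inner_conj_symm, ← (expBasis L).repr_apply_apply, ← (expBasis L).repr_apply_apply,
    expBasis_repr, expBasis_repr, map_mul, map_inv₀, Complex.conj_ofReal, ← inv_normConst_sq]
  ring

lemma inner_cplx (u v : L2 L) : inner ℂ (cplx L u) (cplx L v) = (inner ℝ u v : ℝ) := by
  rw [MeasureTheory.L2.inner_def, MeasureTheory.L2.inner_def]
  refine Eq.trans ?_ (integral_ofReal (𝕜 := ℂ))
  apply integral_congr_ae
  filter_upwards [coeFn_cplx u, coeFn_cplx v] with x hu hv
  simp [hu, hv]

/-- **Parseval's identity** for real-valued functions. -/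
lemma hasSum_fc_inner (u v : L2 L) :
    HasSum (fun k => L ^ 3 * (conj (fc (⇑u) k) * fc (⇑v) k).re) (inner ℝ u v) := by
  have h := Complex.hasSum_re (hasSum_fcC (cplx L u) (cplx L v))
  rw [inner_cplx, Complex.ofReal_re] at h
  refine h.congr_fun fun k => ?_
  rw [← fc_eq_fcC_cplx, ← fc_eq_fcC_cplx, ← Complex.ofReal_pow, Complex.re_ofReal_mul]

lemma hasSum_fc_norm_sq (u : L2 L) :
    HasSum (fun k => L ^ 3 * ‖fc (⇑u) k‖ ^ 2) (‖u‖ ^ 2) := by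
  rw [← real_inner_self_eq_norm_sq]
  refine (hasSum_fc_inner u u).congr_fun fun k => ?_
  rw [← Complex.normSq_eq_conj_mul_self, Complex.ofReal_re, Complex.normSq_eq_norm_sq]

lemma summable_fc_norm_sq (u : L2 L) : Summable fun k => ‖fc (⇑u) k‖ ^ 2 := by
  have hLp := hL.out
  exact (summable_mul_left_iff (by positivity)).mp (hasSum_fc_norm_sq u).summable

lemma L2_ext {u v : L2 L} (h : ∀ k, fc (⇑u) k = fc (⇑v) k) : u = v := by
  have h1 := hasSum_fc_norm_sq (u - v)
  simp only [fc_sub, h, sub_self, norm_zero, ne_eq, OfNat.ofNat_ne_zero, not_false_eq_true,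
    zero_pow, mul_zero] at h1
  have := h1.unique hasSum_zero
  exact sub_eq_zero.mp (norm_eq_zero.mp (pow_eq_zero_iff (two_ne_zero) |>.mp this))

/-- Riesz–Fischer, through the isometry of the Hilbert basis. -/
lemma exists_fcC {c : Mode → ℂ} (hc : Summable fun k => ‖c k‖ ^ 2) :
    ∃ U : L2C L, ∀ k, fcC (⇑U) k = c k := by
  have h0 : (normConst L : ℂ) ≠ 0 := by exact_mod_cast (normConst_pos (L := L)).ne'
  have hm : Memℓp (fun k => (normConst L : ℂ)⁻¹ * c k) 2 := by
    refine memℓp_gen ?_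
    simp only [norm_mul, mul_pow, ENNReal.toReal_ofNat, Real.rpow_ofNat]
    exact hc.mul_left _
  refine ⟨(expBasis L).repr.symm ⟨_, hm⟩, fun k => ?_⟩
  have := expBasis_repr ((expBasis L).repr.symm ⟨_, hm⟩) k
  rw [LinearIsometryEquiv.apply_symm_apply] at this
  exact (mul_left_cancel₀ (inv_ne_zero h0) this).symm

lemma integrable_L2C_mul_exp (U : L2C L) (k : Mode) :
    Integrable (fun x => U x * expMode L k x) (volume : Measure (Torus L)) := by
  have h1 : Integrable (⇑U) (volume : Measure (Torus L)) :=
    (Lp.memLp U).integrable (by norm_num)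
  refine h1.mul_bdd (c := 1) (expMode L k).continuous.aestronglyMeasurable ?_
  exact Eventually.of_forall fun x => (norm_expMode_apply k x).le

/-- Take the real part of the complex function given by Riesz–Fischer. Under Hermitian symmetry its
conjugate has the same coefficients, so the average of the two does too. -/
lemma exists_fc {c : Mode → ℂ} (hc : Summable fun k => ‖c k‖ ^ 2)
    (hr : ∀ k, c (-k) = conj (c k)) : ∃ u : L2 L, ∀ k, fc (⇑u) k = c k := by
  obtain ⟨U, hU⟩ := exists_fcC (L := L) hc
  refine ⟨Complex.reCLM.compLpL 2 volume U, fun k => ?_⟩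
  have h1 : conj (∫ x, U x * expMode L k x) = ∫ x, conj (U x) * expMode L (-k) x := by
    rw [← integral_conj]
    congr 1
    ext x
    rw [map_mul, expMode_neg]
  have h2 : fcC (⇑U) (-k) = (1 / (L : ℂ) ^ 3) * ∫ x, U x * expMode L k x := by
    rw [fcC, neg_neg]
  have h3 : (1 / (L : ℂ) ^ 3) * ∫ x, conj (U x) * expMode L (-k) x = c k := by
    have h4 := congrArg conj h2
    rw [hU, hr, Complex.conj_conj, map_mul, h1] at h4
    rw [h4]
    simp
  have h5 : Integrable (fun x => conj (U x) * expMode L (-k) x)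
      (volume : Measure (Torus L)) := by
    have := (Complex.conjCLE : ℂ →L[ℝ] ℂ).integrable_comp (integrable_L2C_mul_exp U k)
    refine this.congr (Eventually.of_forall fun x => ?_)
    simp [expMode_neg]
  have h6 : ∫ x, ((Complex.reCLM.compLpL 2 volume U : L2 L) x : ℂ) * expMode L (-k) x
      = ∫ x, (1 / 2 : ℂ) * (U x * expMode L (-k) x + conj (U x) * expMode L (-k) x) := by
    apply integral_congr_ae
    filter_upwards [Complex.reCLM.coeFn_compLpL (p := 2) U] with x hx
    rw [hx, Complex.reCLM_apply, Complex.re_eq_add_conj]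
    ring
  rw [fc_eq_fcC, fcC, h6, integral_const_mul, integral_add (integrable_L2C_mul_exp U (-k)) h5]
  have h7 := hU k
  rw [fcC] at h7
  linear_combination (1 / 2 : ℂ) * h7 + (1 / 2 : ℂ) * h3

lemma fc_ofCoeff {c : Mode → ℂ} (hc : Summable fun k => ‖c k‖ ^ 2)
    (hr : ∀ k, c (-k) = conj (c k)) (k : Mode) : fc (⇑(ofCoeff c : L2 L)) k = c k := by
  have h := exists_fc (L := L) hc hr
  rw [ofCoeff, dif_pos h]
  exact h.choose_spec k

/-- Fourier coefficients of a product are the convolution of the Fourier coefficients. -/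
lemma hasSum_fc_mul (u v : L2 L) (k : Mode) :
    HasSum (fun l => fc (⇑u) l * fc (⇑v) (k - l)) (fc (fun x => u x * v x) k) := by
  have hLp := hL.out
  have hL0 : (L : ℂ) ≠ 0 := by exact_mod_cast hLp.ne'
  have hmem : MemLp (fun x => (v x : ℂ) * expMode L (-k) x) 2
      (volume : Measure (Torus L)) := by
    refine MemLp.of_le (Lp.memLp (cplx L v)) ?_ ?_
    · exact ((Lp.aestronglyMeasurable (cplx L v)).congr (coeFn_cplx v)).mul
        (expMode L (-k)).continuous.aestronglyMeasurable
    · filter_upwards [coeFn_cplx v] with x hx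
      rw [norm_mul, norm_expMode_apply, mul_one, hx]
  -- Parseval for `u` and `v` times the monomial of mode `-k`, whose `l`-th coefficient is that of
  -- `v` at `k + l`. Reflecting `l` and using the Hermitian symmetry of `u` gives the convolution.
  have h := hasSum_fcC (cplx L u) hmem.toLp
  have h1 : inner ℂ (cplx L u) hmem.toLp = (L : ℂ) ^ 3 * fc (fun x => u x * v x) k := by
    rw [MeasureTheory.L2.inner_def, fc_eq_fcC, fcC, ← mul_assoc,
      mul_one_div_cancel (pow_ne_zero 3 hL0), one_mul]
    apply integral_congr_ae
    filter_upwards [coeFn_cplx u, hmem.coeFn_toLp] with x hx hy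
    rw [hx, hy, RCLike.inner_apply, Complex.conj_ofReal]
    push_cast
    ring
  have h2 (l : Mode) : fcC (⇑hmem.toLp) l = fc (⇑v) (k + l) := by
    rw [fc_eq_fcC, fcC, fcC]
    congr 1
    apply integral_congr_ae
    filter_upwards [hmem.coeFn_toLp] with x hx
    rw [hx, mul_assoc, ← expMode_add, neg_add]
  rw [h1] at h
  have h3 := h.mul_left (1 / (L : ℂ) ^ 3)
  rw [← mul_assoc, one_div_mul_cancel (pow_ne_zero 3 hL0), one_mul] at h3
  rw [← (Equiv.neg Mode).hasSum_iff]
  refine h3.congr_fun fun l => ?_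
  simp only [Function.comp_apply, Equiv.neg_apply, sub_neg_eq_add]
  rw [fc_neg_mode, h2, ← fc_eq_fcC_cplx]
  field_simp

lemma fc_zero_mode (u : L2 L) : fc (⇑u) 0 = (1 / (L : ℂ) ^ 3) * ((∫ x, u x : ℝ) : ℂ) := by
  rw [fc_eq_fcC, fcC]
  congr 1
  rw [← integral_complex_ofReal]
  simp [expMode_zero]

end Fourier

/-! ### Fourier symbols of the filter and of the deconvolution operator. -/

section Symbols

variable {L α : ℝ}

lemma wave_neg (k : Mode) (j : Fin 3) : wave L (-k) j = -wave L k j := by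
  simp [wave, neg_div]

lemma wave_zero (j : Fin 3) : wave L 0 j = 0 := by simp [wave]

lemma wave_add (k l : Mode) (j : Fin 3) : wave L (k + l) j = wave L k j + wave L l j := by
  simp [wave]; ring

lemma waveSq_neg (k : Mode) : waveSq L (-k) = waveSq L k := by
  simp [waveSq, wave_neg]

lemma waveSq_zero : waveSq L 0 = 0 := by simp [waveSq, wave_zero]

lemma waveSq_nonneg (k : Mode) : 0 ≤ waveSq L k := Finset.sum_nonneg fun _ _ => sq_nonneg _

lemma wave_sq_le (k : Mode) (j : Fin 3) : wave L k j ^ 2 ≤ waveSq L k :=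
  Finset.single_le_sum (f := fun j => wave L k j ^ 2) (fun _ _ => sq_nonneg _) (Finset.mem_univ j)

lemma abs_wave_le (k : Mode) (j : Fin 3) : |wave L k j| ≤ √(waveSq L k) :=
  Real.abs_le_sqrt (wave_sq_le k j)

lemma waveSq_eq (k : Mode) : waveSq L k = (2 * Real.pi / L) ^ 2 * ∑ j, (k j : ℝ) ^ 2 := by
  rw [waveSq, Finset.mul_sum]
  exact Finset.sum_congr rfl fun j _ => by rw [wave]; ring

lemma filterSymbol_neg (k : Mode) : filterSymbol L α (-k) = filterSymbol L α k := by
  simp [filterSymbol, waveSq_neg]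

lemma one_le_filter_denom (k : Mode) : 1 ≤ 1 + α ^ 2 * waveSq L k :=
  le_add_of_nonneg_right (mul_nonneg (sq_nonneg α) (waveSq_nonneg k))

lemma filterSymbol_pos (k : Mode) : 0 < filterSymbol L α k :=
  one_div_pos.mpr (lt_of_lt_of_le one_pos (one_le_filter_denom k))

lemma filterSymbol_le_one (k : Mode) : filterSymbol L α k ≤ 1 :=
  (div_le_one (lt_of_lt_of_le one_pos (one_le_filter_denom k))).mpr (one_le_filter_denom k)

lemma denom_mul_filterSymbol (k : Mode) : (1 + α ^ 2 * waveSq L k) * filterSymbol L α k = 1 :=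
  mul_one_div_cancel (lt_of_lt_of_le one_pos (one_le_filter_denom k)).ne'

/-- The symbol of the Van Cittert operator. -/
def deconvSymbol (L α : ℝ) (N : ℕ) (k : Mode) : ℝ :=
  ∑ n ∈ Finset.range (N + 1), (1 - filterSymbol L α k) ^ n

lemma deconvSymbol_neg (N : ℕ) (k : Mode) :
    deconvSymbol L α N (-k) = deconvSymbol L α N k := by
  simp [deconvSymbol, filterSymbol_neg]

lemma one_le_deconvSymbol (N : ℕ) (k : Mode) : 1 ≤ deconvSymbol L α N k := by
  have h := Finset.single_le_sum (f := fun n => (1 - filterSymbol L α k) ^ n)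
    (fun n _ => pow_nonneg (sub_nonneg.mpr (filterSymbol_le_one k)) n)
    (Finset.mem_range.mpr (Nat.succ_pos N))
  simpa [deconvSymbol] using h

lemma deconvSymbol_le (N : ℕ) (k : Mode) : deconvSymbol L α N k ≤ N + 1 := by
  have h := Finset.sum_le_card_nsmul (Finset.range (N + 1))
    (fun n => (1 - filterSymbol L α k) ^ n) 1 (fun n _ =>
      pow_le_one₀ (sub_nonneg.mpr (filterSymbol_le_one k))
        (by linarith [filterSymbol_pos (L := L) (α := α) k]))
  simpa [deconvSymbol] using h

/-- A finite set of modes lies in the box spanned by its projections, over which the sum factorizes.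
-/
lemma summable_prod_modes {f : ℤ → ℝ} (h0 : ∀ n, 0 ≤ f n) (hf : Summable f) :
    Summable fun k : Mode => ∏ i, f (k i) := by
  classical
  refine summable_of_sum_le (c := ∏ _i : Fin 3, ∑' n, f n)
    (fun k => Finset.prod_nonneg fun i _ => h0 _) fun s => ?_
  calc ∑ k ∈ s, ∏ i, f (k i)
      ≤ ∑ k ∈ Fintype.piFinset (fun i => s.image fun k => k i), ∏ i, f (k i) :=
        Finset.sum_le_sum_of_subset_of_nonneg
          (fun k hk => Fintype.mem_piFinset.mpr fun i => Finset.mem_image_of_mem (fun k => k i) hk)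
          (fun _ _ _ => Finset.prod_nonneg fun i _ => h0 _)
    _ = ∏ i : Fin 3, ∑ n ∈ s.image (fun k => k i), f n := (Finset.prod_univ_sum _ _).symm
    _ ≤ ∏ _i : Fin 3, ∑' n, f n := Finset.prod_le_prod
        (fun i _ => Finset.sum_nonneg fun _ _ => h0 _)
        (fun i _ => hf.sum_le_tsum _ fun _ _ => h0 _)

lemma summable_int_rpow {b : ℝ} (hb : 0 < b) :
    Summable fun n : ℤ => (1 + b * (n : ℝ) ^ 2) ^ (-(2 / 3) : ℝ) := by
  have h := (Real.summable_abs_int_rpow (b := 4 / 3) (by norm_num)).mul_left (b ^ (-(2 / 3) : ℝ))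
  refine Summable.of_norm_bounded_eventually h ?_
  -- Zero is excluded because there the majorant is `0` by the convention for `rpow`, while the left
  -- side is `1`.
  filter_upwards [(Set.finite_singleton (0 : ℤ)).compl_mem_cofinite] with n hn
  have hn0 : (n : ℝ) ≠ 0 := by exact_mod_cast hn
  have hn1 : 0 < |(n : ℝ)| := abs_pos.mpr hn0
  rw [Real.norm_of_nonneg (by positivity)]
  have h1 : |(n : ℝ)| ^ (-(4 / 3) : ℝ) = ((n : ℝ) ^ 2) ^ (-(2 / 3) : ℝ) := by
    rw [← sq_abs, ← Real.rpow_natCast, ← Real.rpow_mul hn1.le]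
    norm_num
  rw [h1, ← Real.mul_rpow hb.le (by positivity)]
  exact Real.rpow_le_rpow_of_nonpos (by positivity) (by linarith) (by norm_num)

variable [hL : Fact (0 < L)]

lemma waveSq_ge {k : Mode} (hk : k ≠ 0) : (2 * Real.pi / L) ^ 2 ≤ waveSq L k := by
  obtain ⟨i, hi⟩ := Function.ne_iff.mp hk
  rw [waveSq_eq]
  refine le_mul_of_one_le_right (by positivity) ?_
  have h1 : (1 : ℝ) ≤ (k i : ℝ) ^ 2 := by
    have : (1 : ℤ) ≤ k i ^ 2 := by
      have : 0 < k i ^ 2 := (sq_pos_iff).mpr hi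
      omega
    exact_mod_cast this
  exact h1.trans (Finset.single_le_sum (f := fun j => (k j : ℝ) ^ 2) (fun _ _ => sq_nonneg _)
    (Finset.mem_univ i))

lemma waveSq_pos {k : Mode} (hk : k ≠ 0) : 0 < waveSq L k := by
  have := hL.out
  exact lt_of_lt_of_le (by positivity) (waveSq_ge hk)

/-- This is where dimension three enters: the square of the symbol decays like `|k|⁻⁴`. With `S = 1
+ α²|k|²`, each of the three factors `1 + b kᵢ²` is at most `S`, so `S⁻² = (S³)^(-2/3)` is bounded
by a product of one-dimensional terms of decay `|n|^(-4/3)`. -/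
lemma summable_filterSymbol_sq (hα : 0 < α) : Summable fun k => filterSymbol L α k ^ 2 := by
  have hLp := hL.out
  set b : ℝ := α ^ 2 * (2 * Real.pi / L) ^ 2 with hb
  have hb0 : 0 < b := by positivity
  refine Summable.of_nonneg_of_le (fun _ => sq_nonneg _) (fun k => ?_)
    (summable_prod_modes (fun n => by positivity) (summable_int_rpow hb0))
  have hd : 1 + α ^ 2 * waveSq L k = 1 + ∑ i, b * (k i : ℝ) ^ 2 := by
    rw [waveSq_eq, ← Finset.mul_sum, hb]; ring
  set S := 1 + ∑ i, b * (k i : ℝ) ^ 2 with hS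
  have hSpos : 0 < S := by positivity
  have h1 : ∏ i, (1 + b * (k i : ℝ) ^ 2) ≤ S ^ 3 := by
    have := Finset.prod_le_prod (s := Finset.univ) (f := fun i => 1 + b * (k i : ℝ) ^ 2)
      (g := fun _ => S) (fun i _ => by positivity) (fun i _ => by
        have := Finset.single_le_sum (f := fun j => b * (k j : ℝ) ^ 2)
          (fun _ _ => by positivity) (Finset.mem_univ i)
        simp only [hS]; linarith)
    simpa using this
  calc filterSymbol L α k ^ 2 = (S ^ 3) ^ (-(2 / 3) : ℝ) := by
        rw [filterSymbol, hd, ← Real.rpow_natCast S 3, ← Real.rpow_mul hSpos.le]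
        norm_num
    _ ≤ (∏ i, (1 + b * (k i : ℝ) ^ 2)) ^ (-(2 / 3) : ℝ) :=
        Real.rpow_le_rpow_of_nonpos (Finset.prod_pos fun i _ => by positivity) h1 (by norm_num)
    _ = ∏ i, (1 + b * (k i : ℝ) ^ 2) ^ (-(2 / 3) : ℝ) :=
        (Real.finsetProd_rpow _ _ (fun i _ => by positivity) _).symm

end Symbols

/-! ### The operators as Fourier multipliers, and measurability through coefficients. -/

section Operators

variable {L : ℝ} [hL : Fact (0 < L)] {α : ℝ}

lemma exists_fc_bound (u : Torus L → ℝ) : ∃ C, ∀ k, ‖fc u k‖ ≤ C := by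
  refine ⟨‖(1 / (L : ℂ) ^ 3)‖ * ∫ x, ‖(u x : ℂ)‖, fun k => ?_⟩
  rw [fc_eq_fcC, fcC, norm_mul]
  gcongr
  refine (norm_integral_le_integral_norm _).trans_eq ?_
  congr 1
  ext x
  rw [norm_mul, norm_expMode_apply, mul_one]

/-- No integrability of `u` is needed: coefficients are always bounded, and the square summable
symbol makes the product a legitimate `L²` sequence. This is what allows filtering products of `L²`
functions. -/
lemma fc_filter (hα : 0 < α) (u : Torus L → ℝ) (k : Mode) :
    fc (⇑(filter α u)) k = filterSymbol L α k * fc u k := by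
  obtain ⟨C, hC⟩ := exists_fc_bound u
  refine fc_ofCoeff ?_ ?_ k
  · refine Summable.of_nonneg_of_le (fun _ => sq_nonneg _) (fun k => ?_)
      ((summable_filterSymbol_sq (L := L) hα).mul_right (C ^ 2))
    rw [norm_mul, mul_pow, Complex.norm_real, Real.norm_of_nonneg (filterSymbol_pos k).le]
    gcongr
    exact hC k
  · intro k
    rw [filterSymbol_neg, fc_neg_mode, map_mul, Complex.conj_ofReal]

lemma fc_deconv (hα : 0 < α) (N : ℕ) (u : L2 L) (k : Mode) :
    fc (⇑(deconv α N u)) k = deconvSymbol L α N k * fc (⇑u) k := by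
  have h (n : ℕ) : fc (⇑((fun v : L2 L => v - filter α ⇑v)^[n] u)) k
      = ((1 - filterSymbol L α k : ℝ) : ℂ) ^ n * fc (⇑u) k := by
    induction n with
    | zero => simp
    | succ n ih =>
      rw [Function.iterate_succ_apply', fc_sub, fc_filter hα, ih, pow_succ]
      push_cast
      ring
  rw [deconv, fc_sum, Finset.sum_congr rfl fun n _ => h n, ← Finset.sum_mul, deconvSymbol]
  push_cast
  rfl

lemma fc_pd {u : L2 L} (hu : Summable fun k => waveSq L k * ‖fc (⇑u) k‖ ^ 2) (j : Fin 3)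
    (k : Mode) : fc (⇑(pd j u)) k = Complex.I * (wave L k j : ℂ) * fc (⇑u) k := by
  refine fc_ofCoeff ?_ ?_ k
  · refine Summable.of_nonneg_of_le (fun _ => sq_nonneg _) (fun k => ?_) hu
    rw [norm_mul, norm_mul, Complex.norm_I, one_mul, mul_pow, Complex.norm_real, Real.norm_eq_abs,
      sq_abs]
    gcongr
    exact wave_sq_le k j
  · intro k
    rw [wave_neg, fc_neg_mode, map_mul, map_mul, Complex.conj_I, Complex.conj_ofReal]
    push_cast
    ring

/-- The real function with the single complex coefficient `c` in mode `k`. -/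
def modeFun (L : ℝ) [Fact (0 < L)] (k : Mode) : ℂ →L[ℝ] L2 L :=
  (Complex.reCLM.compLpL 2 volume ∘L
    (((normConst L : ℂ)⁻¹ • ContinuousLinearMap.toSpanSingleton ℂ (expBasis L k)
      : ℂ →L[ℂ] L2C L).restrictScalars ℝ))

lemma re_cplx (u : L2 L) : Complex.reCLM.compLpL 2 volume (cplx L u) = u := by
  apply Lp.ext
  filter_upwards [Complex.reCLM.coeFn_compLpL (p := 2) (cplx L u), coeFn_cplx u] with x hx hy
  rw [hx, hy]
  simp

lemma hasSum_modeFun (u : L2 L) : HasSum (fun k => modeFun L k (fc (⇑u) k)) u := by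
  have h := ((expBasis L).hasSum_repr (cplx L u)).mapL
    ((Complex.reCLM.compLpL 2 (volume : Measure (Torus L)) : L2C L →L[ℝ] L2 L))
  rw [re_cplx] at h
  refine h.congr_fun fun k => ?_
  rw [expBasis_repr, ← fc_eq_fcC_cplx]
  simp [modeFun, ContinuousLinearMap.toSpanSingleton_apply, smul_smul]

/-- The function is the pointwise limit of its finite Fourier sums, which are measurable when the
coefficients are. -/
lemma aestronglyMeasurable_of_fc {X : Type*} [MeasurableSpace X] {μ : Measure X} {u : X → L2 L}
    (h : ∀ k, AEMeasurable (fun t => fc (⇑(u t)) k) μ) : AEStronglyMeasurable u μ := by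
  refine aestronglyMeasurable_of_tendsto_ae (atTop : Filter (Finset Mode))
    (f := fun s t => ∑ k ∈ s, modeFun L k (fc (⇑(u t)) k)) (fun s => ?_)
    (Eventually.of_forall fun t => hasSum_modeFun (u t))
  have : (fun t => ∑ k ∈ s, modeFun L k (fc (⇑(u t)) k))
      = ∑ k ∈ s, fun t => modeFun L k (fc (⇑(u t)) k) := by
    ext1 t; simp
  rw [this]
  exact Finset.aestronglyMeasurable_sum s fun k _ =>
    (modeFun L k).continuous.comp_aestronglyMeasurable (h k).aestronglyMeasurable

lemma aemeasurable_fc {X : Type*} [MeasurableSpace X] {μ : Measure X} {u : X → L2 L}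
    (h : AEStronglyMeasurable u μ) (k : Mode) : AEMeasurable (fun t => fc (⇑(u t)) k) μ := by
  simp only [← fcL_apply]
  exact ((fcL L k).continuous.comp_aestronglyMeasurable h).aemeasurable

end Operators

/-! ### Scalar linear equations: primitives of integrable functions, Duhamel, maximal regularity. -/

section Primitives

/-- `y` is a primitive of the integrable function `h` on `[0,T]`. -/
structure IsPrim (T : ℝ) (y h : ℝ → ℂ) : Prop where
  integrable : IntervalIntegrable h volume 0 T
  eq : ∀ t ∈ Set.Icc 0 T, y t = y 0 + ∫ s in (0 : ℝ)..t, h s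

lemma absolutelyContinuousOnInterval_const {X : Type*} [NormedAddCommGroup X] (c : X) (a b : ℝ) :
    AbsolutelyContinuousOnInterval (fun _ : ℝ => c) a b :=
  ((LipschitzWith.const c).lipschitzOnWith (s := Set.uIcc a b)).absolutelyContinuousOnInterval

lemma absolutelyContinuousOnInterval_congr {X : Type*} [PseudoMetricSpace X] {f g : ℝ → X}
    {a b : ℝ} (hf : AbsolutelyContinuousOnInterval f a b) (h : ∀ x ∈ Set.uIcc a b, f x = g x) :
    AbsolutelyContinuousOnInterval g a b := by
  refine hf.congr' ?_
  filter_upwards [mem_inf_of_right (mem_principal_self _)] with E hE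
  refine Finset.sum_congr rfl fun i hi => ?_
  rw [h _ (hE.1 i hi).1, h _ (hE.1 i hi).2]

lemma absolutelyContinuousOnInterval_integral_complex {h : ℝ → ℂ} {a b : ℝ}
    (hh : IntervalIntegrable h volume a b) :
    AbsolutelyContinuousOnInterval (fun t => ∫ s in a..t, h s) a b := by
  have hre : IntervalIntegrable (fun s => (h s).re) volume a b := ⟨hh.1.re, hh.2.re⟩
  have him : IntervalIntegrable (fun s => (h s).im) volume a b := ⟨hh.1.im, hh.2.im⟩
  have h1 := (hre.absolutelyContinuousOnInterval_intervalIntegral (c := a) (by simp)).smul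
    (absolutelyContinuousOnInterval_const (1 : ℂ) a b)
  have h2 := (him.absolutelyContinuousOnInterval_intervalIntegral (c := a) (by simp)).smul
    (absolutelyContinuousOnInterval_const Complex.I a b)
  refine absolutelyContinuousOnInterval_congr (h1.add h2) fun x hx => ?_
  have hx' : IntervalIntegrable h volume a x :=
    hh.mono_set (Set.uIcc_subset_uIcc_left hx)
  simp only [Pi.add_apply, Pi.smul_apply', Complex.real_smul, mul_one]
  have e1 : ∫ s in a..x, (h s).re = (∫ s in a..x, h s).re :=
    Complex.reCLM.intervalIntegral_comp_comm hx'
  have e2 : ∫ s in a..x, (h s).im = (∫ s in a..x, h s).im :=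
    Complex.imCLM.intervalIntegral_comp_comm hx'
  rw [e1, e2, Complex.re_add_im]

namespace IsPrim

variable {T : ℝ} {y z h g : ℝ → ℂ}

lemma intervalIntegrable (hy : IsPrim T y h) {t : ℝ} (ht : t ∈ Set.Icc 0 T) :
    IntervalIntegrable h volume 0 t :=
  hy.integrable.mono_set (Set.uIcc_subset_uIcc_left (Set.Icc_subset_uIcc ht))

lemma absolutelyContinuous (hT : 0 ≤ T) (hy : IsPrim T y h) :
    AbsolutelyContinuousOnInterval y 0 T := by
  refine absolutelyContinuousOnInterval_congr ((absolutelyContinuousOnInterval_const (y 0) 0 T).add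
    (absolutelyContinuousOnInterval_integral_complex hy.integrable)) fun t ht => ?_
  rw [Set.uIcc_of_le hT] at ht
  rw [hy.eq t ht, Pi.add_apply]

lemma continuousOn (hT : 0 ≤ T) (hy : IsPrim T y h) : ContinuousOn y (Set.Icc 0 T) := by
  have := (hy.absolutelyContinuous hT).continuousOn
  rwa [Set.uIcc_of_le hT] at this

/-- Lebesgue differentiation. The endpoints are discarded because `y` is prescribed only on `[0,T]`,
which gives no two-sided derivative there. -/
lemma ae_hasDerivAt (hT : 0 ≤ T) (hy : IsPrim T y h) :
    ∀ᵐ t, t ∈ Set.Icc 0 T → HasDerivAt y (h t) t := by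
  have h0 : ∀ᵐ t : ℝ, t ≠ 0 := by simp [ae_iff, measure_singleton]
  have h1 : ∀ᵐ t : ℝ, t ≠ T := by simp [ae_iff, measure_singleton]
  filter_upwards [hy.integrable.ae_hasDerivAt_integral, h0, h1] with t ht ht0 htT htm
  have := (ht (Set.Icc_subset_uIcc htm) 0 (by simp)).const_add (y 0)
  refine this.congr_of_eventuallyEq ?_
  filter_upwards [Ioo_mem_nhds (lt_of_le_of_ne htm.1 ht0.symm) (lt_of_le_of_ne htm.2 htT)]
    with s hs
  exact hy.eq s ⟨hs.1.le, hs.2.le⟩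

/-- The difference of `y` and the integral of `h` is absolutely continuous with derivative zero
almost everywhere, hence constant. -/
lemma of_absolutelyContinuous (hT : 0 ≤ T) (hy : AbsolutelyContinuousOnInterval y 0 T)
    (hh : IntervalIntegrable h volume 0 T)
    (hd : ∀ᵐ t, t ∈ Set.Icc 0 T → HasDerivAt y (h t) t) : IsPrim T y h := by
  refine ⟨hh, ?_⟩
  have h1 : AbsolutelyContinuousOnInterval (fun t => y t - ∫ s in (0 : ℝ)..t, h s) 0 T :=
    hy.sub (absolutelyContinuousOnInterval_integral_complex hh)
  obtain ⟨C, hC⟩ := h1.const_of_ae_hasDerivAt_zero (by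
    filter_upwards [hd, hh.ae_hasDerivAt_integral] with t ht1 ht2 ht
    have h2 := (ht1 (by rwa [Set.uIcc_of_le hT] at ht)).sub (ht2 ht 0 (by simp))
    rwa [sub_self] at h2)
  intro t ht
  have e1 := hC t (Set.Icc_subset_uIcc ht)
  have e2 := hC 0 (by simp)
  simp only [intervalIntegral.integral_same, sub_zero] at e2
  rw [e2, ← e1]; ring

lemma mul (hT : 0 ≤ T) (hy : IsPrim T y h) (hz : IsPrim T z g) :
    IsPrim T (fun t => y t * z t) (fun t => h t * z t + y t * g t) := by
  have hyc := (hy.absolutelyContinuous hT).continuousOn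
  have hzc := (hz.absolutelyContinuous hT).continuousOn
  refine of_absolutelyContinuous hT
    ((hy.absolutelyContinuous hT).smul (hz.absolutelyContinuous hT))
    ((hy.integrable.mul_continuousOn hzc).add (hz.integrable.continuousOn_mul hyc)) ?_
  filter_upwards [hy.ae_hasDerivAt hT, hz.ae_hasDerivAt hT] with t h1 h2 ht
  exact (h1 ht).mul (h2 ht)

lemma conjugate (hy : IsPrim T y h) : IsPrim T (fun t => conj (y t)) (fun t => conj (h t)) := by
  have hi (t : ℝ) (ht : IntervalIntegrable h volume 0 t) :
      IntervalIntegrable (fun s => (starRingEnd ℂ) (h s)) volume 0 t :=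
    ⟨(Complex.conjCLE : ℂ →L[ℝ] ℂ).integrable_comp ht.1,
      (Complex.conjCLE : ℂ →L[ℝ] ℂ).integrable_comp ht.2⟩
  refine ⟨hi T hy.integrable, fun t ht => ?_⟩
  rw [hy.eq t ht, map_add]
  congr 1
  exact ((Complex.conjCLE : ℂ →L[ℝ] ℂ).intervalIntegral_comp_comm
    (hy.intervalIntegrable ht)).symm

lemma of_hasDerivAt (hT : 0 ≤ T) (hd : ∀ t, HasDerivAt y (h t) t) (hc : Continuous h) :
    IsPrim T y h := by
  refine ⟨hc.intervalIntegrable _ _, fun t _ => ?_⟩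
  rw [intervalIntegral.integral_eq_sub_of_hasDerivAt (fun s _ => hd s)
    (hc.intervalIntegrable _ _)]
  ring

lemma congr_left (hy : IsPrim T y h) (hT : 0 ≤ T) (hyz : ∀ t ∈ Set.Icc 0 T, y t = z t) :
    IsPrim T z h :=
  ⟨hy.integrable, fun t ht => by
    rw [← hyz t ht, ← hyz 0 ⟨le_rfl, hT⟩, hy.eq t ht]⟩

lemma congr_right (hT : 0 ≤ T) (hy : IsPrim T y h)
    (hhg : ∀ᵐ t ∂(volume.restrict (Set.Icc 0 T)), h t = g t) : IsPrim T y g := by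
  rw [ae_restrict_iff' measurableSet_Icc] at hhg
  have key (t : ℝ) (ht : t ∈ Set.Icc 0 T) :
      ∀ᵐ s, s ∈ Set.uIoc 0 t → h s = g s := by
    filter_upwards [hhg] with s hs hs'
    rw [Set.uIoc_of_le ht.1] at hs'
    exact hs ⟨hs'.1.le, hs'.2.trans ht.2⟩
  have key' := (ae_restrict_iff' measurableSet_uIoc).mpr (key T ⟨hT, le_rfl⟩)
  refine ⟨?_, fun t ht => ?_⟩
  · exact hy.integrable.congr_ae key'
  · rw [hy.eq t ht, intervalIntegral.integral_congr_ae (key t ht)]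

/-- The energy identity. -/
lemma norm_sq (hT : 0 ≤ T) (hy : IsPrim T y h) {t : ℝ} (ht : t ∈ Set.Icc 0 T) :
    ‖y t‖ ^ 2 = ‖y 0‖ ^ 2 + ∫ s in (0 : ℝ)..t, 2 * ((starRingEnd ℂ) (y s) * h s).re := by
  have h1 := hy.conjugate.mul hT hy
  have h2 := congrArg Complex.re (h1.eq t ht)
  have h3 : (∫ s in (0 : ℝ)..t, ((starRingEnd ℂ) (h s) * y s + (starRingEnd ℂ) (y s) * h s)).re
      = ∫ s in (0 : ℝ)..t, ((starRingEnd ℂ) (h s) * y s + (starRingEnd ℂ) (y s) * h s).re :=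
    (Complex.reCLM.intervalIntegral_comp_comm (h1.intervalIntegrable ht)).symm
  rw [Complex.add_re, h3, ← Complex.normSq_eq_conj_mul_self, ← Complex.normSq_eq_conj_mul_self,
    Complex.ofReal_re, Complex.ofReal_re, Complex.normSq_eq_norm_sq,
    Complex.normSq_eq_norm_sq] at h2
  rw [h2]
  congr 1
  refine intervalIntegral.integral_congr fun s _ => ?_
  simp only [Complex.add_re, Complex.mul_re, Complex.conj_re, Complex.conj_im]
  ring

end IsPrim

/-- Solution of `y' = - μ y + g`, `y 0 = y₀` by Duhamel's formula. -/
def duhamel (μ : ℝ) (y₀ : ℂ) (g : ℝ → ℂ) (t : ℝ) : ℂ :=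
  (Real.exp (-(μ * t)) : ℂ) * (y₀ + ∫ s in (0 : ℝ)..t, (Real.exp (μ * s) : ℂ) * g s)

variable {T : ℝ} {g : ℝ → ℂ}

lemma duhamel_zero (μ : ℝ) (y₀ : ℂ) (g : ℝ → ℂ) : duhamel μ y₀ g 0 = y₀ := by
  simp [duhamel]

lemma isPrim_exp (hT : 0 ≤ T) (μ : ℝ) :
    IsPrim T (fun t => (Real.exp (μ * t) : ℂ)) (fun t => (μ : ℂ) * (Real.exp (μ * t) : ℂ)) := by
  refine IsPrim.of_hasDerivAt hT (fun t => ?_) (by fun_prop)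
  have h1 : HasDerivAt (fun t : ℝ => Real.exp (μ * t)) (Real.exp (μ * t) * (μ * 1)) t :=
    ((hasDerivAt_id t).const_mul μ).exp
  have h2 := h1.ofReal_comp
  convert! h2 using 1
  push_cast
  ring

lemma intervalIntegrable_exp_mul (hg : IntervalIntegrable g volume 0 T) (μ : ℝ) :
    IntervalIntegrable (fun s => (Real.exp (μ * s) : ℂ) * g s) volume 0 T :=
  hg.continuousOn_mul (by fun_prop)

lemma isPrim_duhamel (hT : 0 ≤ T) (μ : ℝ) (y₀ : ℂ) (hg : IntervalIntegrable g volume 0 T) :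
    IsPrim T (duhamel μ y₀ g) (fun t => -(μ : ℂ) * duhamel μ y₀ g t + g t) := by
  have h1 : IsPrim T (fun t => y₀ + ∫ s in (0 : ℝ)..t, (Real.exp (μ * s) : ℂ) * g s)
      (fun s => (Real.exp (μ * s) : ℂ) * g s) :=
    ⟨intervalIntegrable_exp_mul hg μ, fun t _ => by simp⟩
  have h2 := (isPrim_exp hT (-μ)).mul hT h1
  have e : (fun t => (Real.exp (-μ * t) : ℂ) *
      (y₀ + ∫ s in (0 : ℝ)..t, (Real.exp (μ * s) : ℂ) * g s)) = duhamel μ y₀ g := by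
    ext t; rw [duhamel, neg_mul]
  rw [e] at h2
  convert! h2 using 1
  ext t
  have e3 : (Real.exp (-μ * t) : ℂ) * (Real.exp (μ * t) : ℂ) = 1 := by
    rw [← Complex.ofReal_mul, ← Real.exp_add]; simp
  rw [← mul_assoc, e3, duhamel, neg_mul μ t]
  push_cast
  ring

/-- Integrating factor: `exp (μ t) y` is a primitive of `exp (μ t) g`. -/
lemma IsPrim.eq_duhamel (hT : 0 ≤ T) {μ : ℝ} {y : ℝ → ℂ} (hg : IntervalIntegrable g volume 0 T)
    (hy : IsPrim T y (fun t => -(μ : ℂ) * y t + g t)) {t : ℝ} (ht : t ∈ Set.Icc 0 T) :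
    y t = duhamel μ (y 0) g t := by
  have h := ((isPrim_exp hT μ).mul hT hy).eq t ht
  have e1 : ∀ s, (μ : ℂ) * (Real.exp (μ * s) : ℂ) * y s
      + (Real.exp (μ * s) : ℂ) * (-(μ : ℂ) * y s + g s) = (Real.exp (μ * s) : ℂ) * g s := by
    intro s; ring
  simp only [e1, mul_zero, Real.exp_zero, Complex.ofReal_one, one_mul] at h
  rw [duhamel, ← h, ← mul_assoc, ← Complex.ofReal_mul, ← Real.exp_add]
  simp

lemma duhamel_sub (hT : 0 ≤ T) {g₁ g₂ : ℝ → ℂ} (μ : ℝ) (y₁ y₂ : ℂ)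
    (h₁ : IntervalIntegrable g₁ volume 0 T) (h₂ : IntervalIntegrable g₂ volume 0 T) {t : ℝ}
    (ht : t ∈ Set.Icc 0 T) :
    duhamel μ y₁ g₁ t - duhamel μ y₂ g₂ t
      = duhamel μ (y₁ - y₂) (fun s => g₁ s - g₂ s) t := by
  have hs : Set.uIcc 0 t ⊆ Set.uIcc 0 T := Set.uIcc_subset_uIcc_left (Set.Icc_subset_uIcc ht)
  simp only [duhamel, mul_sub]
  rw [intervalIntegral.integral_sub ((intervalIntegrable_exp_mul h₁ μ).mono_set hs)
    ((intervalIntegrable_exp_mul h₂ μ).mono_set hs)]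
  ring

/-- Maximal regularity of `y' = - ν ℓ y + g`. -/
lemma duhamel_energy_le (hT : 0 ≤ T) {ν ℓ : ℝ} (hν : 0 < ν) (hℓ : 0 ≤ ℓ) (y₀ : ℂ)
    (hg : IntervalIntegrable g volume 0 T)
    (hg2 : IntervalIntegrable (fun s => ‖g s‖ ^ 2) volume 0 T) {t : ℝ} (ht : t ∈ Set.Icc 0 T) :
    ℓ * ‖duhamel (ν * ℓ) y₀ g t‖ ^ 2
      + ν * ∫ s in (0 : ℝ)..t, ℓ ^ 2 * ‖duhamel (ν * ℓ) y₀ g s‖ ^ 2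
      ≤ ℓ * ‖y₀‖ ^ 2 + ν⁻¹ * ∫ s in (0 : ℝ)..t, ‖g s‖ ^ 2 := by
  set y := duhamel (ν * ℓ) y₀ g with hy
  have hp : IsPrim T y (fun t => -((ν * ℓ : ℝ) : ℂ) * y t + g t) :=
    isPrim_duhamel hT (ν * ℓ) y₀ hg
  have hs : Set.uIcc 0 t ⊆ Set.uIcc 0 T := Set.uIcc_subset_uIcc_left (Set.Icc_subset_uIcc ht)
  have hyc : ContinuousOn y (Set.uIcc 0 T) := (hp.absolutelyContinuous hT).continuousOn
  have hys : IntervalIntegrable (fun s => ℓ ^ 2 * ‖y s‖ ^ 2) volume 0 t :=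
    (ContinuousOn.mono (by fun_prop) hs).intervalIntegrable
  have hg2' := hg2.mono_set hs
  have hre : IntervalIntegrable (fun s => ((starRingEnd ℂ) (y s) *
      (-((ν * ℓ : ℝ) : ℂ) * y s + g s)).re) volume 0 t := by
    have := (hp.integrable.continuousOn_mul
      (Complex.continuous_conj.comp_continuousOn hyc)).mono_set hs
    exact ⟨this.1.re, this.2.re⟩
  have h1 := hp.norm_sq hT ht
  rw [hy, duhamel_zero, ← hy] at h1
  -- The energy identity times `ℓ` produces the dissipation `2 ν ℓ² ‖y‖²`. Half of it stays on the
  -- left, and the other half absorbs the forcing by Young's inequality.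
  have h2 : ∀ s ∈ Set.Icc 0 t, ℓ * (2 * ((starRingEnd ℂ) (y s) *
      (-((ν * ℓ : ℝ) : ℂ) * y s + g s)).re) + ν * (ℓ ^ 2 * ‖y s‖ ^ 2) ≤ ν⁻¹ * ‖g s‖ ^ 2 := by
    intro s _
    have e1 : ((starRingEnd ℂ) (y s) * (-((ν * ℓ : ℝ) : ℂ) * y s + g s)).re
        = -(ν * ℓ) * ‖y s‖ ^ 2 + ((starRingEnd ℂ) (y s) * g s).re := by
      rw [← Complex.normSq_eq_norm_sq, Complex.normSq_apply]
      simp only [Complex.mul_re, Complex.conj_re, Complex.conj_im, Complex.add_re, Complex.add_im,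
        Complex.mul_im, Complex.neg_re, Complex.neg_im, Complex.ofReal_re, Complex.ofReal_im]
      ring
    have e2 : ((starRingEnd ℂ) (y s) * g s).re ≤ ‖y s‖ * ‖g s‖ := by
      refine (Complex.re_le_norm _).trans_eq ?_
      rw [norm_mul, RCLike.norm_conj]
    have e3 : 2 * (ℓ * ‖y s‖) * ‖g s‖ ≤ ν * (ℓ * ‖y s‖) ^ 2 + ν⁻¹ * ‖g s‖ ^ 2 := by
      have := sq_nonneg (ν * (ℓ * ‖y s‖) - ‖g s‖)
      have h3 : ν⁻¹ * (ν * (ℓ * ‖y s‖) - ‖g s‖) ^ 2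
          = ν * (ℓ * ‖y s‖) ^ 2 - 2 * (ℓ * ‖y s‖) * ‖g s‖ + ν⁻¹ * ‖g s‖ ^ 2 := by
        field_simp
        ring
      have h4 := mul_nonneg (inv_nonneg.mpr hν.le) this
      linarith
    rw [e1]
    have e4 := mul_le_mul_of_nonneg_left e2 hℓ
    nlinarith
  have h3 := intervalIntegral.integral_mono_on ht.1
    (((hre.const_mul 2).const_mul ℓ).add (hys.const_mul ν)) (hg2'.const_mul ν⁻¹) h2
  rw [intervalIntegral.integral_add ((hre.const_mul 2).const_mul ℓ) (hys.const_mul ν),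
    intervalIntegral.integral_const_mul ℓ, intervalIntegral.integral_const_mul ν,
    intervalIntegral.integral_const_mul ν⁻¹] at h3
  rw [h1]
  linarith

end Primitives

/-! ### The space of square summable families. -/

section SquareSummable

variable {ι : Type*}

/-- Square summable complex families. -/
abbrev ESeq (ι : Type*) : Type _ := lp (fun _ : ι => ℂ) 2

lemma hasSum_norm_sq (a : ESeq ι) : HasSum (fun p => ‖a p‖ ^ 2) (‖a‖ ^ 2) := by
  have h := lp.hasSum_norm (p := 2) (by norm_num) a
  simpa using h

lemma memℓp_two {f : ι → ℂ} (hf : Summable fun p => ‖f p‖ ^ 2) :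
    Memℓp (E := fun _ : ι => ℂ) f 2 :=
  memℓp_gen (by simpa using hf)

lemma norm_sub_sq_le (x y : ℂ) : ‖x - y‖ ^ 2 ≤ 2 * ‖x‖ ^ 2 + 2 * ‖y‖ ^ 2 := by
  have h := norm_sub_le x y
  have h0 := norm_nonneg (x - y)
  nlinarith [sq_nonneg (‖x‖ - ‖y‖)]

/-- Dominated convergence for the series of squared differences; coordinatewise continuity alone
would not suffice in ℓ². -/
lemma continuous_of_dominated_coord {X : Type*} [TopologicalSpace X] {z : X → ESeq ι}
    {B : ι → ℝ} (hB : Summable B) (hz : ∀ p, Continuous fun x => z x p)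
    (hb : ∀ x p, ‖z x p‖ ^ 2 ≤ B p) : Continuous z := by
  rw [continuous_iff_continuousAt]
  intro x
  rw [ContinuousAt, tendsto_iff_norm_sub_tendsto_zero]
  have h1 : Tendsto (fun y => ∑' p, ‖z y p - z x p‖ ^ 2) (𝓝 x) (𝓝 (∑' _ : ι, (0 : ℝ))) := by
    refine tendsto_tsum_of_dominated_convergence (bound := fun p => 4 * B p) (hB.mul_left 4)
      (fun p => ?_) (Eventually.of_forall fun y p => ?_)
    · have h2 : ContinuousAt (fun y => ‖z y p - z x p‖ ^ 2) x := by
        have := (hz p).continuousAt (x := x)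
        fun_prop
      have h3 := h2.tendsto
      simpa using h3
    · rw [Real.norm_of_nonneg (sq_nonneg _)]
      have := norm_sub_sq_le (z y p) (z x p)
      linarith [hb y p, hb x p]
  have h2 : ∀ y, ∑' p, ‖z y p - z x p‖ ^ 2 = ‖z y - z x‖ ^ 2 := fun y =>
    (hasSum_norm_sq (z y - z x)).tsum_eq
  simp only [h2, tsum_zero] at h1
  have h3 := h1.sqrt
  simpa [Real.sqrt_sq (norm_nonneg _)] using h3

end SquareSummable

/-! ### The abstract diagonal semilinear equation and its Duhamel map. -/

section FixedPoint

/-- Data of a semilinear diagonal evolution equation `y' = - ν ℓ y + F - Q y`. -/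
structure MildData (ι : Type*) where
  ν : ℝ
  T : ℝ
  ℓ : ι → ℝ
  Q : ESeq ι → ι → ℂ
  M : ι → ℝ
  y₀ : ι → ℂ
  F : ι → ℝ → ℂ
  hν : 0 < ν
  hT : 0 ≤ T
  hℓ : ∀ p, 0 ≤ ℓ p
  hM : Summable fun p => M p ^ 2
  hQ : ∀ a b p, ‖Q a p - Q b p‖ ≤ M p * ‖a - b‖
  hQ0 : ∀ p, Q 0 p = 0
  hy₀ : Summable fun p => ℓ p * ‖y₀ p‖ ^ 2
  hF : ∀ p, IntervalIntegrable (F p) volume 0 T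
  hF2 : ∀ p, IntervalIntegrable (fun s => ‖F p s‖ ^ 2) volume 0 T
  hFs : Summable fun p => ∫ s in (0 : ℝ)..T, ‖F p s‖ ^ 2

namespace MildData

variable {ι : Type*} (D : MildData ι)

lemma norm_Q_sub_sq_le (a b : ESeq ι) (p : ι) :
    ‖D.Q a p - D.Q b p‖ ^ 2 ≤ D.M p ^ 2 * ‖a - b‖ ^ 2 := by
  rw [← mul_pow]
  exact pow_le_pow_left₀ (norm_nonneg _) (D.hQ a b p) 2

lemma continuous_Q (p : ι) : Continuous fun a => D.Q a p := by
  have : LipschitzWith ⟨|D.M p|, abs_nonneg _⟩ fun a => D.Q a p :=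
    LipschitzWith.of_dist_le_mul fun a b => by
      rw [dist_eq_norm, dist_eq_norm]
      exact (D.hQ a b p).trans (mul_le_mul_of_nonneg_right (le_abs_self _) (norm_nonneg _))
  exact this.continuous

/-- The right-hand side `F - Q u`. -/
def rhs (u : ℝ → ESeq ι) (p : ι) (s : ℝ) : ℂ := D.F p s - D.Q (u s) p

/-- The right-hand side of Duhamel's formula, weighted with `√ℓ`. -/
def mild (u : ℝ → ESeq ι) (p : ι) (t : ℝ) : ℂ :=
  √(D.ℓ p) * duhamel (D.ν * D.ℓ p) (D.y₀ p) (D.rhs u p) t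

/-- `u` solves the equation in the mild sense; `u = √ℓ y`. -/
structure IsMild (u : ℝ → ESeq ι) : Prop where
  continuousOn : ContinuousOn u (Set.Icc 0 D.T)
  eq : ∀ t ∈ Set.Icc 0 D.T, ∀ p, u t p = D.mild u p t

variable {D} {u v : ℝ → ESeq ι}

lemma uIcc_subset {t : ℝ} (ht : t ∈ Set.Icc 0 D.T) : Set.uIcc 0 t ⊆ Set.Icc 0 D.T := by
  rw [Set.uIcc_of_le ht.1]
  exact Set.Icc_subset_Icc_right ht.2

lemma uIcc_T : Set.uIcc 0 D.T = Set.Icc 0 D.T := Set.uIcc_of_le D.hT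

lemma continuousOn_Q (hu : ContinuousOn u (Set.Icc 0 D.T)) (p : ι) :
    ContinuousOn (fun s => D.Q (u s) p) (Set.Icc 0 D.T) :=
  (D.continuous_Q p).comp_continuousOn hu

lemma intervalIntegrable_rhs (hu : ContinuousOn u (Set.Icc 0 D.T)) (p : ι) :
    IntervalIntegrable (D.rhs u p) volume 0 D.T :=
  (D.hF p).sub (ContinuousOn.intervalIntegrable (by rw [uIcc_T]; exact continuousOn_Q hu p))

lemma intervalIntegrable_rhs_sq (hu : ContinuousOn u (Set.Icc 0 D.T)) (p : ι) :
    IntervalIntegrable (fun s => ‖D.rhs u p s‖ ^ 2) volume 0 D.T := by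
  have hq := continuousOn_Q hu p
  have h1 : IntervalIntegrable (fun s => 2 * ‖D.F p s‖ ^ 2 + 2 * ‖D.Q (u s) p‖ ^ 2)
      volume 0 D.T := by
    refine ((D.hF2 p).const_mul 2).add (ContinuousOn.intervalIntegrable ?_)
    rw [uIcc_T]
    fun_prop
  refine h1.mono_fun
    (((intervalIntegrable_rhs hu p).aestronglyMeasurable_restrict_uIoc).norm.pow 2) ?_
  refine Eventually.of_forall fun s => ?_
  dsimp only
  rw [Real.norm_of_nonneg (sq_nonneg _), Real.norm_of_nonneg (by positivity)]
  exact norm_sub_sq_le _ _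

lemma integral_rhs_sq_le (hu : ContinuousOn u (Set.Icc 0 D.T)) (p : ι) :
    ∫ s in (0 : ℝ)..D.T, ‖D.rhs u p s‖ ^ 2 ≤ 2 * (∫ s in (0 : ℝ)..D.T, ‖D.F p s‖ ^ 2)
      + 2 * (D.M p ^ 2 * ∫ s in (0 : ℝ)..D.T, ‖u s‖ ^ 2) := by
  have hun : IntervalIntegrable (fun s => ‖u s‖ ^ 2) volume 0 D.T :=
    ContinuousOn.intervalIntegrable (by rw [uIcc_T]; fun_prop)
  rw [← intervalIntegral.integral_const_mul, ← intervalIntegral.integral_const_mul,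
    ← intervalIntegral.integral_const_mul, ← intervalIntegral.integral_add
      ((D.hF2 p).const_mul 2) ((hun.const_mul _).const_mul 2)]
  refine intervalIntegral.integral_mono_on D.hT (intervalIntegrable_rhs_sq hu p)
    (((D.hF2 p).const_mul 2).add ((hun.const_mul _).const_mul 2)) fun s _ => ?_
  refine (norm_sub_sq_le _ _).trans ?_
  have := D.norm_Q_sub_sq_le (u s) 0 p
  rw [D.hQ0, sub_zero, sub_zero] at this
  linarith

lemma summable_integral_rhs_sq (hu : ContinuousOn u (Set.Icc 0 D.T)) :
    Summable fun p => ∫ s in (0 : ℝ)..D.T, ‖D.rhs u p s‖ ^ 2 :=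
  Summable.of_nonneg_of_le
    (fun p => intervalIntegral.integral_nonneg D.hT fun _ _ => sq_nonneg _)
    (fun p => integral_rhs_sq_le hu p)
    ((D.hFs.mul_left 2).add ((D.hM.mul_right _).mul_left 2))

lemma sq_norm_mild (p : ι) (t : ℝ) : ‖D.mild u p t‖ ^ 2
    = D.ℓ p * ‖duhamel (D.ν * D.ℓ p) (D.y₀ p) (D.rhs u p) t‖ ^ 2 := by
  rw [mild, norm_mul, mul_pow, Complex.norm_real, Real.norm_eq_abs, sq_abs,
    Real.sq_sqrt (D.hℓ p)]

lemma integral_sq_mono {f : ℝ → ℂ} (hf : IntervalIntegrable (fun s => ‖f s‖ ^ 2) volume 0 D.T)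
    {t : ℝ} (ht : t ∈ Set.Icc 0 D.T) :
    ∫ s in (0 : ℝ)..t, ‖f s‖ ^ 2 ≤ ∫ s in (0 : ℝ)..D.T, ‖f s‖ ^ 2 :=
  intervalIntegral.integral_mono_interval le_rfl ht.1 ht.2
    (Eventually.of_forall fun _ => sq_nonneg _) hf

/-- Summable bound of the weighted Duhamel formula. -/
def bound (D : MildData ι) (u : ℝ → ESeq ι) (p : ι) : ℝ :=
  D.ℓ p * ‖D.y₀ p‖ ^ 2 + D.ν⁻¹ * ∫ s in (0 : ℝ)..D.T, ‖D.rhs u p s‖ ^ 2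

lemma summable_bound (hu : ContinuousOn u (Set.Icc 0 D.T)) : Summable (D.bound u) :=
  D.hy₀.add ((summable_integral_rhs_sq hu).mul_left _)

lemma energy_le_bound (hu : ContinuousOn u (Set.Icc 0 D.T)) (p : ι) {t : ℝ}
    (ht : t ∈ Set.Icc 0 D.T) :
    ‖D.mild u p t‖ ^ 2 + D.ν * ∫ s in (0 : ℝ)..t,
      D.ℓ p ^ 2 * ‖duhamel (D.ν * D.ℓ p) (D.y₀ p) (D.rhs u p) s‖ ^ 2 ≤ D.bound u p := by
  rw [sq_norm_mild]
  refine (duhamel_energy_le D.hT D.hν (D.hℓ p) (D.y₀ p) (intervalIntegrable_rhs hu p)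
    (intervalIntegrable_rhs_sq hu p) ht).trans ?_
  have := mul_le_mul_of_nonneg_left (integral_sq_mono (intervalIntegrable_rhs_sq hu p) ht)
    (inv_nonneg.mpr D.hν.le)
  rw [bound]
  linarith

lemma sq_norm_mild_le (hu : ContinuousOn u (Set.Icc 0 D.T)) (p : ι) {t : ℝ}
    (ht : t ∈ Set.Icc 0 D.T) : ‖D.mild u p t‖ ^ 2 ≤ D.bound u p := by
  refine le_trans (le_add_of_nonneg_right ?_) (energy_le_bound hu p ht)
  exact mul_nonneg D.hν.le (intervalIntegral.integral_nonneg ht.1 fun _ _ => by positivity)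

lemma continuousOn_mild (hu : ContinuousOn u (Set.Icc 0 D.T)) (p : ι) :
    ContinuousOn (D.mild u p) (Set.Icc 0 D.T) :=
  continuousOn_const.mul
    ((isPrim_duhamel D.hT _ _ (intervalIntegrable_rhs hu p)).continuousOn D.hT)

/-- The difference solves Duhamel's formula with zero data and forcing `Q v - Q u`. Maximal
regularity bounds mode `p` by `M p²` times the time integral of `‖u - v‖²`, and the `M p²` are
summable. The integral only up to `t` gives the Volterra structure. -/
lemma sum_mild_sub_sq_le (hu : ContinuousOn u (Set.Icc 0 D.T))
    (hv : ContinuousOn v (Set.Icc 0 D.T)) {t : ℝ} (ht : t ∈ Set.Icc 0 D.T) {a b : ESeq ι}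
    (ha : ∀ p, a p = D.mild u p t) (hb : ∀ p, b p = D.mild v p t) :
    ‖a - b‖ ^ 2 ≤ (D.ν⁻¹ * ∑' p, D.M p ^ 2) * ∫ s in (0 : ℝ)..t, ‖u s - v s‖ ^ 2 := by
  have hs : Set.uIcc 0 t ⊆ Set.uIcc 0 D.T := by rw [uIcc_T]; exact uIcc_subset ht
  have huv : ContinuousOn (fun s => u s - v s) (Set.Icc 0 D.T) := hu.sub hv
  have hI : IntervalIntegrable (fun s => ‖u s - v s‖ ^ 2) volume 0 t :=
    ContinuousOn.intervalIntegrable (ContinuousOn.mono (by fun_prop) (uIcc_subset ht))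
  have hg := fun p => (intervalIntegrable_rhs hu p).sub (intervalIntegrable_rhs hv p)
  have hQd (p : ι) (s : ℝ) : D.rhs u p s - D.rhs v p s = -(D.Q (u s) p - D.Q (v s) p) := by
    rw [rhs, rhs]; ring
  have hg2 (p : ι) : IntervalIntegrable (fun s => ‖D.rhs u p s - D.rhs v p s‖ ^ 2)
      volume 0 D.T := by
    simp only [hQd, norm_neg]
    have h1 := continuousOn_Q hu p
    have h2 := continuousOn_Q hv p
    refine ContinuousOn.intervalIntegrable ?_
    rw [uIcc_T]
    fun_prop
  have key (p : ι) : ‖(a - b) p‖ ^ 2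
      ≤ D.M p ^ 2 * (D.ν⁻¹ * ∫ s in (0 : ℝ)..t, ‖u s - v s‖ ^ 2) := by
    have h1 := duhamel_energy_le D.hT D.hν (D.hℓ p) (0 : ℂ) (hg p) (hg2 p) ht
    have h2 : ∫ s in (0 : ℝ)..t, ‖D.rhs u p s - D.rhs v p s‖ ^ 2
        ≤ D.M p ^ 2 * ∫ s in (0 : ℝ)..t, ‖u s - v s‖ ^ 2 := by
      rw [← intervalIntegral.integral_const_mul]
      refine intervalIntegral.integral_mono_on ht.1 ((hg2 p).mono_set hs) (hI.const_mul _)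
        fun s _ => ?_
      rw [hQd, norm_neg]
      exact D.norm_Q_sub_sq_le _ _ _
    have h3 : (a - b) p = √(D.ℓ p) *
        duhamel (D.ν * D.ℓ p) 0 (fun s => D.rhs u p s - D.rhs v p s) t := by
      rw [lp.coeFn_sub, Pi.sub_apply, ha, hb, mild, mild, ← mul_sub,
        duhamel_sub D.hT _ _ _ (intervalIntegrable_rhs hu p) (intervalIntegrable_rhs hv p) ht,
        sub_self]
    have h4 : 0 ≤ D.ν * ∫ s in (0 : ℝ)..t, D.ℓ p ^ 2 * ‖duhamel (D.ν * D.ℓ p) 0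
        (fun s => D.rhs u p s - D.rhs v p s) s‖ ^ 2 :=
      mul_nonneg D.hν.le (intervalIntegral.integral_nonneg ht.1 fun _ _ => by positivity)
    rw [h3, norm_mul, mul_pow, Complex.norm_real, Real.norm_eq_abs, sq_abs,
      Real.sq_sqrt (D.hℓ p)]
    have h5 := mul_le_mul_of_nonneg_left h2 (inv_nonneg.mpr D.hν.le)
    simp only [norm_zero, ne_eq, OfNat.ofNat_ne_zero, not_false_eq_true, zero_pow, mul_zero,
      zero_add] at h1
    linarith
  have := (hasSum_norm_sq (a - b)).tsum_eq
  rw [← this]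
  refine ((hasSum_norm_sq (a - b)).summable.tsum_le_tsum key (D.hM.mul_right _)).trans_eq ?_
  rw [tsum_mul_right]
  ring

end MildData

end FixedPoint

/-! ### Picard iteration on continuous curves in ℓ². -/

namespace MildData

variable {ι : Type*} (D : MildData ι)

/-- Extension of a curve on `[0,T]` to the real line. -/
def ext (u : C(Set.Icc 0 D.T, ESeq ι)) (s : ℝ) : ESeq ι := u (Set.projIcc 0 D.T D.hT s)

variable {D}

lemma continuous_ext (u : C(Set.Icc 0 D.T, ESeq ι)) : Continuous (D.ext u) :=
  u.continuous.comp continuous_projIcc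

lemma ext_coe (u : C(Set.Icc 0 D.T, ESeq ι)) (t : Set.Icc 0 D.T) : D.ext u t = u t := by
  rw [ext, Set.projIcc_val]

variable (D)

/-- Duhamel's formula as a map on continuous curves. -/
def picard (u : C(Set.Icc 0 D.T, ESeq ι)) : C(Set.Icc 0 D.T, ESeq ι) where
  toFun t := ⟨fun p => D.mild (D.ext u) p t, memℓp_two (Summable.of_nonneg_of_le
    (fun _ => sq_nonneg _) (fun p => sq_norm_mild_le (continuous_ext u).continuousOn p t.2)
    (summable_bound (continuous_ext u).continuousOn))⟩
  continuous_toFun := continuous_of_dominated_coord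
    (summable_bound (continuous_ext u).continuousOn)
    (fun p => (continuousOn_mild (continuous_ext u).continuousOn p).domRestrict)
    (fun t p => sq_norm_mild_le (continuous_ext u).continuousOn p t.2)

lemma picard_apply (u : C(Set.Icc 0 D.T, ESeq ι)) (t : Set.Icc 0 D.T) (p : ι) :
    D.picard u t p = D.mild (D.ext u) p t := rfl

/-- The Lipschitz constant of Duhamel's formula. -/
def lip : ℝ := D.ν⁻¹ * ∑' p, D.M p ^ 2

lemma lip_nonneg : 0 ≤ D.lip :=
  mul_nonneg (inv_nonneg.mpr D.hν.le) (tsum_nonneg fun _ => sq_nonneg _)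

/-- Iterating the Volterra estimate integrates `s ^ n` once more at each step, which produces the
factorial. Squares are kept because the basic estimate is quadratic. -/
lemma norm_iterate_picard_sub_sq_le (u v : C(Set.Icc 0 D.T, ESeq ι)) (n : ℕ)
    (t : Set.Icc 0 D.T) : ‖D.picard^[n] u t - D.picard^[n] v t‖ ^ 2
      ≤ (D.lip * t) ^ n / n.factorial * dist u v ^ 2 := by
  induction n generalizing t with
  | zero =>
    simp only [Function.iterate_zero, id_eq, pow_zero, Nat.factorial_zero, Nat.cast_one, div_one,
      one_mul]
    rw [← dist_eq_norm]
    exact pow_le_pow_left₀ dist_nonneg (ContinuousMap.dist_apply_le_dist t) 2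
  | succ n ih =>
    rw [Function.iterate_succ_apply', Function.iterate_succ_apply']
    have huc := continuous_ext (D.picard^[n] u)
    have hvc := continuous_ext (D.picard^[n] v)
    have h1 := sum_mild_sub_sq_le huc.continuousOn hvc.continuousOn t.2
      (D.picard_apply (D.picard^[n] u) t) (D.picard_apply (D.picard^[n] v) t)
    refine h1.trans ?_
    have h2 : ∫ s in (0 : ℝ)..t, ‖D.ext (D.picard^[n] u) s - D.ext (D.picard^[n] v) s‖ ^ 2
        ≤ ∫ s in (0 : ℝ)..t, (D.lip * s) ^ n / n.factorial * dist u v ^ 2 := by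
      refine intervalIntegral.integral_mono_on t.2.1
        (Continuous.intervalIntegrable (by fun_prop) _ _)
        (Continuous.intervalIntegrable (by fun_prop) _ _) fun s hs => ?_
      have hs' : s ∈ Set.Icc 0 D.T := ⟨hs.1, hs.2.trans t.2.2⟩
      have := ih ⟨s, hs'⟩
      rwa [← ext_coe, ← ext_coe] at this
    refine (mul_le_mul_of_nonneg_left h2 D.lip_nonneg).trans_eq ?_
    simp only [mul_pow, mul_div_assoc, mul_assoc]
    rw [intervalIntegral.integral_const_mul]
    have h3 : ∀ s : ℝ, s ^ n / (n.factorial : ℝ) * dist u v ^ 2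
        = s ^ n * ((n.factorial : ℝ)⁻¹ * dist u v ^ 2) := fun s => by ring
    have h4 : ∀ s : ℝ, s ^ n * dist u v ^ 2 / (n.factorial : ℝ)
        = s ^ n * ((n.factorial : ℝ)⁻¹ * dist u v ^ 2) := fun s => by ring
    simp only [h3, intervalIntegral.integral_mul_const, integral_pow]
    rw [Nat.factorial_succ]
    push_cast
    have h5 : (n.factorial : ℝ) ≠ 0 := by exact_mod_cast n.factorial_ne_zero
    have h6 : (n : ℝ) + 1 ≠ 0 := by positivity
    simp only [ne_eq, Nat.add_eq_zero_iff, one_ne_zero, and_false, not_false_eq_true, zero_pow,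
      sub_zero]
    change D.lip * _ = _
    field_simp
    ring

lemma exists_contracting : ∃ n : ℕ, ContractingWith (1 / 2) D.picard^[n] := by
  have h := FloorSemiring.tendsto_pow_div_factorial_atTop (D.lip * D.T)
  -- The estimate concerns squared distances, so `1 / 4` yields the contraction factor `1 / 2`.
  obtain ⟨n, hn⟩ := (h.eventually (gt_mem_nhds (show (0 : ℝ) < 1 / 4 by norm_num))).exists
  refine ⟨n, by rw [← NNReal.coe_lt_coe]; norm_num, LipschitzWith.of_dist_le_mul fun u v => ?_⟩
  have : ((1 / 2 : NNReal) : ℝ) = 1 / 2 := by norm_num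
  rw [this, ContinuousMap.dist_le (by positivity)]
  intro t
  have h1 := D.norm_iterate_picard_sub_sq_le u v n t
  have h2 : (D.lip * t) ^ n / n.factorial ≤ 1 / 4 := by
    refine le_trans ?_ hn.le
    have := D.lip_nonneg
    have h3 := t.2.1
    have h4 := t.2.2
    gcongr
  have h3 := h1.trans (mul_le_mul_of_nonneg_right h2 (sq_nonneg _))
  rw [dist_eq_norm]
  refine abs_le_of_sq_le_sq' ?_ (by positivity) |>.2
  linarith

variable {D}

lemma mild_congr {u v : ℝ → ESeq ι} (h : ∀ s ∈ Set.Icc 0 D.T, u s = v s) (p : ι) {t : ℝ}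
    (ht : t ∈ Set.Icc 0 D.T) : D.mild u p t = D.mild v p t := by
  rw [mild, mild, duhamel, duhamel]
  congr 3
  refine intervalIntegral.integral_congr fun s hs => ?_
  simp only [rhs, h s (uIcc_subset ht hs)]

variable (D)

/-- The fixed point of a contracting iterate is fixed by the map itself. No smallness of `T` is
required. -/
theorem exists_isMild : ∃ u : ℝ → ESeq ι, Continuous u ∧ D.IsMild u := by
  obtain ⟨n, hn⟩ := D.exists_contracting
  have h := hn.isFixedPt_fixedPoint_iterate
  set u := hn.fixedPoint D.picard^[n]
  refine ⟨D.ext u, continuous_ext u, (continuous_ext u).continuousOn, fun t ht p => ?_⟩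
  have h1 : D.ext u t = u ⟨t, ht⟩ := ext_coe u ⟨t, ht⟩
  have h2 := D.picard_apply u ⟨t, ht⟩ p
  rw [h.eq] at h2
  rw [h1, h2]

/-- The restriction of a mild solution is a fixed point of Duhamel's formula. -/
lemma IsMild.isFixedPt {D : MildData ι} {u : ℝ → ESeq ι} (hu : D.IsMild u) :
    Function.IsFixedPt D.picard ⟨_, hu.continuousOn.domRestrict⟩ := by
  ext t p
  rw [picard_apply]
  refine Eq.trans ?_ (hu.eq t t.2 p).symm
  refine mild_congr (fun s hs => ?_) p t.2
  exact ext_coe _ ⟨s, hs⟩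

/-- Both restrictions to `[0,T]` are fixed points of the same contracting iterate. -/
theorem IsMild.unique {D : MildData ι} {u v : ℝ → ESeq ι} (hu : D.IsMild u) (hv : D.IsMild v)
    {t : ℝ} (ht : t ∈ Set.Icc 0 D.T) : u t = v t := by
  obtain ⟨n, hn⟩ := D.exists_contracting
  have h := hn.fixedPoint_unique' (hu.isFixedPt.iterate n) (hv.isFixedPt.iterate n)
  exact congrArg (fun f : C(Set.Icc 0 D.T, ESeq ι) => f ⟨t, ht⟩) h

end MildData

/-! ### The convective term as a bounded bilinear map on weighted coefficients. -/

section Nonlinearity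

lemma summable_mul_of_sq {ι : Type*} {p q : ι → ℝ} (hp : Summable fun l => p l ^ 2)
    (hq : Summable fun l => q l ^ 2) : Summable fun l => p l * q l := by
  refine Summable.of_norm_bounded (hp.add hq) fun l => ?_
  rw [Real.norm_eq_abs, abs_mul]
  nlinarith [sq_nonneg (|p l| - |q l|), sq_abs (p l), sq_abs (q l), sq_nonneg (p l),
    sq_nonneg (q l)]

lemma tsum_mul_sq_le {ι : Type*} {p q : ι → ℝ} (hp : Summable fun l => p l ^ 2)
    (hq : Summable fun l => q l ^ 2) (hp0 : ∀ l, 0 ≤ p l) (hq0 : ∀ l, 0 ≤ q l) {A B : ℝ}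
    (hA : 0 ≤ A) (hB : 0 ≤ B) (hpA : ∑' l, p l ^ 2 ≤ A ^ 2) (hqB : ∑' l, q l ^ 2 ≤ B ^ 2) :
    ∑' l, p l * q l ≤ A * B := by
  refine Real.tsum_le_of_sum_le (fun l => mul_nonneg (hp0 l) (hq0 l)) fun s => ?_
  have h1 := Finset.sum_mul_sq_le_sq_mul_sq s p q
  have h2 : ∑ l ∈ s, p l ^ 2 ≤ A ^ 2 := (hp.sum_le_tsum s fun _ _ => sq_nonneg _).trans hpA
  have h3 : ∑ l ∈ s, q l ^ 2 ≤ B ^ 2 := (hq.sum_le_tsum s fun _ _ => sq_nonneg _).trans hqB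
  refine abs_le_of_sq_le_sq' ?_ (by positivity) |>.2
  rw [mul_pow]
  exact h1.trans (mul_le_mul h2 h3 (Finset.sum_nonneg fun _ _ => sq_nonneg _) (sq_nonneg _))

/-- Square summable families of Fourier coefficients of vector fields. -/
abbrev XSeq : Type := ESeq (Mode × Fin 3)

lemma summable_fiber (a : XSeq) (i : Fin 3) {e : Mode → Mode} (he : Function.Injective e) :
    Summable fun l => ‖a (e l, i)‖ ^ 2 :=
  (hasSum_norm_sq a).summable.comp_injective (i := fun l => (e l, i))
    fun _ _ h => he (Prod.mk.inj h).1

lemma tsum_fiber_le (a : XSeq) (i : Fin 3) {e : Mode → Mode} (he : Function.Injective e) :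
    ∑' l, ‖a (e l, i)‖ ^ 2 ≤ ‖a‖ ^ 2 := by
  rw [← (hasSum_norm_sq a).tsum_eq]
  exact Summable.tsum_le_tsum_of_inj (fun l => (e l, i))
    (fun _ _ h => he (Prod.mk.inj h).1) (fun _ _ => sq_nonneg _) (fun _ => le_rfl)
    (summable_fiber a i he) (hasSum_norm_sq a).summable

lemma sub_left_inj_mode (k : Mode) : Function.Injective fun l : Mode => k - l :=
  sub_right_injective

lemma summable_weighted_conv {W : Mode → ℝ} {C : ℝ} (hW : ∀ l, |W l| ≤ C) (a b : XSeq)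
    (k : Mode) (i j : Fin 3) :
    Summable fun l => ‖(W l : ℂ) * (a (l, i) * b (k - l, j))‖ := by
  have h := (summable_mul_of_sq (summable_fiber a i Function.injective_id)
    (summable_fiber b j (sub_left_inj_mode k))).mul_left C
  refine Summable.of_nonneg_of_le (fun _ => norm_nonneg _) (fun l => ?_) h
  rw [norm_mul, norm_mul, Complex.norm_real, Real.norm_eq_abs]
  exact mul_le_mul_of_nonneg_right (hW l) (by positivity)

/-- Cauchy–Schwarz: the convolution of two ℓ² families is bounded, uniformly in `k`. -/
lemma norm_weighted_conv_le {W : Mode → ℝ} {C : ℝ} (hW : ∀ l, |W l| ≤ C) (a b : XSeq)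
    (k : Mode) (i j : Fin 3) :
    ‖∑' l, (W l : ℂ) * (a (l, i) * b (k - l, j))‖ ≤ C * (‖a‖ * ‖b‖) := by
  have hC : 0 ≤ C := (abs_nonneg _).trans (hW 0)
  have h0 := summable_mul_of_sq (summable_fiber a i Function.injective_id)
    (summable_fiber b j (sub_left_inj_mode k))
  refine (norm_tsum_le_tsum_norm (summable_weighted_conv hW a b k i j)).trans ?_
  have h1 : ∑' l, ‖(W l : ℂ) * (a (l, i) * b (k - l, j))‖
      ≤ ∑' l, C * (‖a (l, i)‖ * ‖b (k - l, j)‖) := by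
    refine (summable_weighted_conv hW a b k i j).tsum_le_tsum (fun l => ?_) (h0.mul_left C)
    rw [norm_mul, norm_mul, Complex.norm_real, Real.norm_eq_abs]
    exact mul_le_mul_of_nonneg_right (hW l) (by positivity)
  refine h1.trans ?_
  rw [tsum_mul_left]
  refine mul_le_mul_of_nonneg_left ?_ hC
  exact tsum_mul_sq_le (summable_fiber a i Function.injective_id)
    (summable_fiber b j (sub_left_inj_mode k)) (fun _ => norm_nonneg _) (fun _ => norm_nonneg _)
    (norm_nonneg _) (norm_nonneg _) (tsum_fiber_le a i Function.injective_id)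
    (tsum_fiber_le b j (sub_left_inj_mode k))

/-- Modulus of the wave vector. -/
def waveAbs (L : ℝ) (k : Mode) : ℝ := √(waveSq L k)

variable {L α : ℝ} {N : ℕ}

lemma waveAbs_nonneg (k : Mode) : 0 ≤ waveAbs L k := Real.sqrt_nonneg _

lemma waveAbs_sq (k : Mode) : waveAbs L k ^ 2 = waveSq L k := Real.sq_sqrt (waveSq_nonneg k)

lemma waveAbs_zero : waveAbs L 0 = 0 := by simp [waveAbs, waveSq_zero]

lemma waveAbs_neg (k : Mode) : waveAbs L (-k) = waveAbs L k := by simp [waveAbs, waveSq_neg]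

/-- The Fourier coefficients `c` of a field for which `|k| c k = a k`. -/
def unweight (L : ℝ) (a : Mode × Fin 3 → ℂ) : Coeffs := fun k i => a (k, i) / (waveAbs L k : ℂ)

/-- The Fourier coefficients of `∇ · G (D_N w ⊗ D_N w)`. -/
def nonlin (L α : ℝ) (N : ℕ) (c : Coeffs) : Coeffs := fun k i =>
  ∑ j, Complex.I * (wave L k j : ℂ) * (filterSymbol L α k : ℂ) *
    ∑' l, (deconvSymbol L α N l * c l i) * (deconvSymbol L α N (k - l) * c (k - l) j)

/-- The Leray projection on Fourier coefficients. -/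
def leray (L : ℝ) (c : Coeffs) : Coeffs := fun k i =>
  c k i - (wave L k i : ℂ) * (∑ j, (wave L k j : ℂ) * c k j) / (waveSq L k : ℂ)

/-- The weight in the bilinear form of `nonlin ∘ unweight`. -/
def convWeight (L α : ℝ) (N : ℕ) (k : Mode) (j : Fin 3) (l : Mode) : ℝ :=
  wave L k j * (deconvSymbol L α N l * deconvSymbol L α N (k - l))
    / (waveAbs L l * waveAbs L (k - l))

/-- The bilinear form of `nonlin ∘ unweight`. -/
def bilin (L α : ℝ) (N : ℕ) (a b : XSeq) : Coeffs := fun k i =>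
  ∑ j, Complex.I * (filterSymbol L α k : ℂ) *
    ∑' l, (convWeight L α N k j l : ℂ) * (a (l, i) * b (k - l, j))

/-- The terms `l = 0` and `l = k` vanish on both sides, because division by zero gives zero in
`unweight` and in `convWeight` alike. No zero mean condition on `a` is needed. -/
lemma nonlin_unweight (a : XSeq) : nonlin L α N (unweight L a) = bilin L α N a a := by
  ext k i
  refine Finset.sum_congr rfl fun j _ => ?_
  rw [mul_right_comm Complex.I, mul_assoc _ (wave L k j : ℂ), ← tsum_mul_left]
  refine congrArg _ (tsum_congr fun l => ?_)
  simp only [unweight, convWeight]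
  push_cast
  simp only [div_eq_mul_inv, mul_inv]
  ring

lemma leray_sub (c d : Coeffs) : leray L (c - d) = leray L c - leray L d := by
  ext k i
  simp only [leray, Pi.sub_apply, mul_sub, Finset.sum_sub_distrib]
  ring

lemma leray_smul (r : ℂ) (c : Coeffs) : leray L (r • c) = r • leray L c := by
  ext k i
  simp only [leray, Pi.smul_apply, smul_eq_mul, mul_left_comm _ r, ← Finset.mul_sum]
  ring

/-- The constant is crude: `1` for the identity and `3` for the gradient part, one for each
component of the inner product. -/
lemma norm_leray_le {c : Coeffs} {k : Mode} {B : ℝ} (hc : ∀ i, ‖c k i‖ ≤ B) (i : Fin 3) :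
    ‖leray L c k i‖ ≤ 4 * B := by
  have hB : 0 ≤ B := (norm_nonneg _).trans (hc 0)
  have h1 : ‖(wave L k i : ℂ) * (∑ j, (wave L k j : ℂ) * c k j) / (waveSq L k : ℂ)‖
      ≤ 3 * B := by
    rw [norm_div, norm_mul, Complex.norm_real, Complex.norm_real, Real.norm_eq_abs,
      Real.norm_of_nonneg (waveSq_nonneg k)]
    refine div_le_of_le_mul₀ (waveSq_nonneg k) (by positivity) ?_
    have h2 : ‖∑ j, (wave L k j : ℂ) * c k j‖ ≤ ∑ _j : Fin 3, waveAbs L k * B := by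
      refine norm_sum_le_of_le _ fun j _ => ?_
      rw [norm_mul, Complex.norm_real, Real.norm_eq_abs]
      exact mul_le_mul (abs_wave_le k j) (hc j) (norm_nonneg _) (waveAbs_nonneg k)
    calc |wave L k i| * ‖∑ j, (wave L k j : ℂ) * c k j‖
        ≤ waveAbs L k * ∑ _j : Fin 3, waveAbs L k * B :=
          mul_le_mul (abs_wave_le k i) h2 (norm_nonneg _) (waveAbs_nonneg k)
      _ = 3 * B * waveSq L k := by
          rw [← waveAbs_sq]; simp; ring
  refine (norm_sub_le _ _).trans ?_
  linarith [hc i]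

variable [hL : Fact (0 < L)]

lemma waveAbs_ge {k : Mode} (hk : k ≠ 0) : 2 * Real.pi / L ≤ waveAbs L k := by
  have hLp := hL.out
  exact Real.le_sqrt_of_sq_le (waveSq_ge hk)

lemma waveAbs_pos {k : Mode} (hk : k ≠ 0) : 0 < waveAbs L k :=
  Real.sqrt_pos.mpr (waveSq_pos hk)

/-- Bound of the weight `convWeight`. -/
def convConst (L : ℝ) (N : ℕ) : ℝ := (N + 1) ^ 2 * (L / Real.pi)

lemma convConst_nonneg : 0 ≤ convConst L N := by
  have hLp := hL.out
  have := Real.pi_pos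
  unfold convConst; positivity

/-- By the triangle inequality `|k| / (|l| |k - l|) ≤ 1/|l| + 1/|k - l|`. Nonzero wave vectors have
length at least `2π/L`, so each summand is at most `L/(2π)`. The two deconvolution symbols
contribute `(N + 1)²`. The degenerate modes have weight zero. -/
lemma abs_convWeight_le (k : Mode) (j : Fin 3) (l : Mode) :
    |convWeight L α N k j l| ≤ convConst L N := by
  have hLp := hL.out
  have hpi := Real.pi_pos
  by_cases hl : l = 0
  · rw [convWeight, hl, waveAbs_zero]
    simpa using convConst_nonneg
  by_cases hkl : k - l = 0
  · rw [convWeight, hkl, waveAbs_zero]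
    simpa using convConst_nonneg
  have h1 := waveAbs_ge (L := L) hl
  have h2 := waveAbs_ge (L := L) hkl
  have p1 := waveAbs_pos (L := L) hl
  have p2 := waveAbs_pos (L := L) hkl
  have h3 : |wave L k j| ≤ waveAbs L l + waveAbs L (k - l) := by
    have : wave L k j = wave L l j + wave L (k - l) j := by rw [← wave_add]; simp
    rw [this]
    exact (abs_add_le _ _).trans (add_le_add (abs_wave_le l j) (abs_wave_le (k - l) j))
  have d1 := deconvSymbol_le (L := L) (α := α) N l
  have d2 := deconvSymbol_le (L := L) (α := α) N (k - l)
  have e1 := one_le_deconvSymbol (L := L) (α := α) N l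
  have e2 := one_le_deconvSymbol (L := L) (α := α) N (k - l)
  rw [convWeight, abs_div, abs_of_pos (mul_pos p1 p2), div_le_iff₀ (mul_pos p1 p2),
    abs_mul (wave L k j),
    abs_of_pos (a := deconvSymbol L α N l * _) (mul_pos (by linarith) (by linarith))]
  have h4 : waveAbs L l + waveAbs L (k - l)
      ≤ L / Real.pi * (waveAbs L l * waveAbs L (k - l)) := by
    have f1 : waveAbs L l ≤ L / (2 * Real.pi) * (waveAbs L l * waveAbs L (k - l)) := by
      have := mul_le_mul_of_nonneg_left h2 (mul_nonneg (div_nonneg hLp.le (by positivity :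
        (0:ℝ) ≤ 2 * Real.pi)) p1.le)
      calc waveAbs L l = L / (2 * Real.pi) * waveAbs L l * (2 * Real.pi / L) := by field_simp
        _ ≤ _ := this
        _ = _ := by ring
    have f2 : waveAbs L (k - l) ≤ L / (2 * Real.pi) * (waveAbs L l * waveAbs L (k - l)) := by
      have := mul_le_mul_of_nonneg_left h1 (mul_nonneg (div_nonneg hLp.le (by positivity :
        (0:ℝ) ≤ 2 * Real.pi)) p2.le)
      calc waveAbs L (k - l) = L / (2 * Real.pi) * waveAbs L (k - l) * (2 * Real.pi / L) := by
            field_simp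
        _ ≤ _ := this
        _ = _ := by ring
    calc _ ≤ _ := add_le_add f1 f2
      _ = _ := by field_simp; ring
  have h5 : deconvSymbol L α N l * deconvSymbol L α N (k - l) ≤ (N + 1) ^ 2 := by
    rw [sq]
    exact mul_le_mul d1 d2 (by linarith) (by positivity)
  calc _ ≤ (L / Real.pi * (waveAbs L l * waveAbs L (k - l))) * ((N : ℝ) + 1) ^ 2 :=
        mul_le_mul (h3.trans h4) h5 (mul_nonneg (by linarith) (by linarith)) (by positivity)
    _ = _ := by rw [convConst]; ring

lemma norm_bilin_le (a b : XSeq) (k : Mode) (i : Fin 3) :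
    ‖bilin L α N a b k i‖ ≤ 3 * convConst L N * filterSymbol L α k * (‖a‖ * ‖b‖) := by
  have h : ‖bilin L α N a b k i‖
      ≤ ∑ _j : Fin 3, filterSymbol L α k * (convConst L N * (‖a‖ * ‖b‖)) := by
    refine norm_sum_le_of_le _ fun j _ => ?_
    rw [norm_mul, norm_mul, Complex.norm_I, one_mul, Complex.norm_real,
      Real.norm_of_nonneg (filterSymbol_pos k).le]
    exact mul_le_mul_of_nonneg_left
      (norm_weighted_conv_le (fun l => abs_convWeight_le k j l) a b k i j) (filterSymbol_pos k).le
  refine h.trans_eq ?_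
  simp
  ring

lemma bilin_sub_left (a b c : XSeq) :
    bilin L α N (a - b) c = bilin L α N a c - bilin L α N b c := by
  ext k i
  simp only [bilin, Pi.sub_apply, ← Finset.sum_sub_distrib, ← mul_sub]
  refine Finset.sum_congr rfl fun j _ => ?_
  rw [← Summable.tsum_sub
    (summable_weighted_conv (fun l => abs_convWeight_le k j l) a c k i j).of_norm
    (summable_weighted_conv (fun l => abs_convWeight_le k j l) b c k i j).of_norm]
  congr 1
  refine tsum_congr fun l => ?_
  rw [lp.coeFn_sub, Pi.sub_apply]
  ring

lemma bilin_sub_right (a b c : XSeq) :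
    bilin L α N c (a - b) = bilin L α N c a - bilin L α N c b := by
  ext k i
  simp only [bilin, Pi.sub_apply, ← Finset.sum_sub_distrib, ← mul_sub]
  refine Finset.sum_congr rfl fun j _ => ?_
  rw [← Summable.tsum_sub
    (summable_weighted_conv (fun l => abs_convWeight_le k j l) c a k i j).of_norm
    (summable_weighted_conv (fun l => abs_convWeight_le k j l) c b k i j).of_norm]
  congr 1
  refine tsum_congr fun l => ?_
  rw [lp.coeFn_sub, Pi.sub_apply]
  ring

/-- Quadratic homogeneity; it shows that a radial truncation merely rescales the nonlinear term. -/
lemma bilin_smul (r : ℝ) (a : XSeq) :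
    bilin L α N (r • a) (r • a) = ((r ^ 2 : ℝ) : ℂ) • bilin L α N a a := by
  ext k i
  simp only [bilin, Pi.smul_apply, smul_eq_mul, Finset.mul_sum]
  refine Finset.sum_congr rfl fun j _ => ?_
  rw [mul_left_comm ((r ^ 2 : ℝ) : ℂ), ← tsum_mul_left (a := ((r ^ 2 : ℝ) : ℂ))]
  refine congrArg _ (tsum_congr fun l => ?_)
  rw [lp.coeFn_smul, Pi.smul_apply, Pi.smul_apply, Complex.real_smul, Complex.real_smul]
  push_cast
  ring

/-- `B(a,a) - B(b,b) = B(a - b, a) + B(b, a - b)`. -/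
lemma norm_bilin_self_sub_le (a b : XSeq) (k : Mode) (i : Fin 3) :
    ‖bilin L α N a a k i - bilin L α N b b k i‖
      ≤ 3 * convConst L N * filterSymbol L α k * ((‖a‖ + ‖b‖) * ‖a - b‖) := by
  have h : bilin L α N a a k i - bilin L α N b b k i
      = bilin L α N (a - b) a k i + bilin L α N b (a - b) k i := by
    rw [bilin_sub_left, bilin_sub_right]
    simp
  rw [h]
  refine (norm_add_le _ _).trans ((add_le_add (norm_bilin_le _ _ k i)
    (norm_bilin_le _ _ k i)).trans_eq ?_)
  ring

end Nonlinearity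

/-! ### Radial retraction onto a ball. -/

section Cutoff

variable {E : Type*} [NormedAddCommGroup E] [NormedSpace ℝ E]

/-- Radial retraction on the ball of radius `R`. -/
def retract (R : ℝ) (a : E) : E := (R / max R ‖a‖) • a

variable {R : ℝ}

lemma retract_of_le (hR : 0 < R) {a : E} (ha : ‖a‖ ≤ R) : retract R a = a := by
  rw [retract, max_eq_left ha, div_self hR.ne', one_smul]

lemma norm_retract_le (hR : 0 < R) (a : E) : ‖retract R a‖ ≤ R := by
  have h : 0 < max R ‖a‖ := lt_max_of_lt_left hR
  rw [retract, norm_smul, Real.norm_of_nonneg (by positivity), div_mul_eq_mul_div,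
    div_le_iff₀ h]
  exact mul_le_mul_of_nonneg_left (le_max_right _ _) hR.le

/-- With `λ` the scaling factor, the difference is `λ_a (a - b) + (λ_a - λ_b) b`, and each summand
has norm at most `‖a - b‖`. -/
lemma norm_retract_sub_le (hR : 0 < R) (a b : E) : ‖retract R a - retract R b‖ ≤ 2 * ‖a - b‖ := by
  have ha : 0 < max R ‖a‖ := lt_max_of_lt_left hR
  have hb : 0 < max R ‖b‖ := lt_max_of_lt_left hR
  have h1 : retract R a - retract R b
      = (R / max R ‖a‖) • (a - b) + (R / max R ‖a‖ - R / max R ‖b‖) • b := by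
    rw [retract, retract, smul_sub, sub_smul]
    abel
  have h2 : R / max R ‖a‖ ≤ 1 := (div_le_one ha).mpr (le_max_left _ _)
  have h3 : R / max R ‖a‖ - R / max R ‖b‖
      = (R / max R ‖a‖) * ((max R ‖b‖ - max R ‖a‖) / max R ‖b‖) := by
    field_simp
  have h4 : |max R ‖b‖ - max R ‖a‖| ≤ ‖a - b‖ := by
    rw [max_comm R, max_comm R]
    refine (abs_max_sub_max_le_abs _ _ R).trans ?_
    rw [norm_sub_rev]
    exact abs_norm_sub_norm_le b a
  rw [h1]
  refine (norm_add_le _ _).trans ?_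
  rw [norm_smul, norm_smul, Real.norm_of_nonneg (by positivity), h3, Real.norm_eq_abs, abs_mul,
    abs_of_nonneg (show 0 ≤ R / max R ‖a‖ by positivity), abs_div, abs_of_pos hb]
  have h5 : |max R ‖b‖ - max R ‖a‖| / max R ‖b‖ * ‖b‖ ≤ ‖a - b‖ := by
    rw [div_mul_eq_mul_div, div_le_iff₀ hb]
    exact mul_le_mul h4 (le_max_right _ _) (norm_nonneg _) (norm_nonneg _)
  have h6 : 0 ≤ R / max R ‖a‖ := by positivity
  calc _ = R / max R ‖a‖ * (‖a - b‖ + |max R ‖b‖ - max R ‖a‖| / max R ‖b‖ * ‖b‖) := by ring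
    _ ≤ 1 * (‖a - b‖ + ‖a - b‖) := by
      refine mul_le_mul h2 (by linarith) (by positivity) one_pos.le
    _ = _ := by ring

end Cutoff

/-! ### Vanishing of the trilinear energy form. -/

section Cancellation

/-- The shear `(m, l) ↦ (l + m, l)`. -/
def shear (A : Type*) [AddCommGroup A] : A × A ≃ A × A where
  toFun x := (x.2 + x.1, x.2)
  invFun x := (x.1 - x.2, x.2)
  left_inv x := by simp
  right_inv x := by simp

/-- Writing the first index as `l + m` makes the sum `∑ₘ p(m) ∑ₗ r(l + m) q(l)`. The inner sum is
bounded uniformly in `m` by Cauchy–Schwarz, and `p` is summable. -/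
lemma summable_trilinear {A : Type*} [AddCommGroup A] {p q r : A → ℝ} (hp0 : ∀ k, 0 ≤ p k)
    (hq0 : ∀ k, 0 ≤ q k) (hr0 : ∀ k, 0 ≤ r k) (hp : Summable p)
    (hq : Summable fun k => q k ^ 2) (hr : Summable fun k => r k ^ 2) :
    Summable fun x : A × A => r x.1 * q x.2 * p (x.1 - x.2) := by
  have hr' (m : A) : Summable fun l => r (l + m) ^ 2 :=
    hr.comp_injective (add_left_injective m)
  have hs (m : A) : Summable fun l => r (l + m) * q l := summable_mul_of_sq (hr' m) hq
  have hA : 0 ≤ ∑' k, r k ^ 2 := tsum_nonneg fun k => sq_nonneg (r k)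
  have hB : 0 ≤ ∑' k, q k ^ 2 := tsum_nonneg fun k => sq_nonneg (q k)
  have hle (m : A) : ∑' l, r (l + m) * q l ≤ √(∑' k, r k ^ 2) * √(∑' k, q k ^ 2) := by
    refine tsum_mul_sq_le (hr' m) hq (fun l => hr0 (l + m)) hq0 (Real.sqrt_nonneg _)
      (Real.sqrt_nonneg _) ?_ ?_
    · rw [Real.sq_sqrt hA]
      exact Summable.tsum_le_tsum_of_inj (fun l => l + m) (add_left_injective m)
        (fun k _ => sq_nonneg (r k)) (fun _ => le_rfl) (hr' m) hr
    · rw [Real.sq_sqrt hB]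
  have hpos (x : A × A) : 0 ≤ p x.1 * (r (x.2 + x.1) * q x.2) :=
    mul_nonneg (hp0 x.1) (mul_nonneg (hr0 (x.2 + x.1)) (hq0 x.2))
  have h1 : Summable fun x : A × A => p x.1 * (r (x.2 + x.1) * q x.2) := by
    rw [summable_prod_of_nonneg hpos]
    refine ⟨fun m => (hs m).mul_left (p m), ?_⟩
    refine Summable.of_nonneg_of_le (fun m => tsum_nonneg fun l => hpos (m, l)) (fun m => ?_)
      (hp.mul_right (√(∑' k, r k ^ 2) * √(∑' k, q k ^ 2)))
    dsimp only
    rw [tsum_mul_left]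
    exact mul_le_mul_of_nonneg_left (hle m) (hp0 m)
  rw [← (shear A).summable_iff]
  refine h1.congr fun x => ?_
  simp only [Function.comp_apply, shear, Equiv.coe_fn_mk, add_sub_cancel_left]
  ring

variable {L α : ℝ} {N : ℕ}

/-- Antisymmetry of the trilinear form `∑ κⱼ(k) v̄ₖⁱ vₗⁱ vₖ₋ₗʲ` on divergence-free fields. -/
lemma im_trilinear_eq_zero {v : Coeffs} (hreal : ∀ k i, v (-k) i = conj (v k i))
    (hdiv : ∀ k, ∑ i, (wave L k i : ℂ) * v k i = 0) :
    (∑' x : Mode × Mode, ∑ i, ∑ j,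
      (wave L x.1 j : ℂ) * (conj (v x.1 i) * (v x.2 i * v (x.1 - x.2) j))).im = 0 := by
  set g : Mode × Mode → ℂ := fun x => ∑ i, ∑ j,
      (wave L x.1 j : ℂ) * (conj (v x.1 i) * (v x.2 i * v (x.1 - x.2) j)) with hg
  -- Swapping `k` and `l` and conjugating only replaces the wave vector of `k` by that of `l`. The
  -- difference contains the divergence of `v` in mode `k - l`, which is zero. So the series equals
  -- its own conjugate.
  have h1 (x : Mode × Mode) : conj (g x.swap) = g x := by
    have h2 : conj (g x.swap) = ∑ i, ∑ j,
        (wave L x.2 j : ℂ) * (conj (v x.1 i) * (v x.2 i * v (x.1 - x.2) j)) := by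
      simp only [hg, map_sum, map_mul, Complex.conj_ofReal, Prod.fst_swap, Prod.snd_swap,
        Complex.conj_conj]
      refine Finset.sum_congr rfl fun i _ => Finset.sum_congr rfl fun j _ => ?_
      have h5 : conj (v (x.2 - x.1) j) = v (x.1 - x.2) j := by rw [← hreal, neg_sub]
      rw [h5]
      ring
    have h3 : g x - conj (g x.swap) = ∑ i, (conj (v x.1 i) * v x.2 i) *
        ∑ j, (wave L (x.1 - x.2) j : ℂ) * v (x.1 - x.2) j := by
      rw [h2, hg, ← Finset.sum_sub_distrib]
      refine Finset.sum_congr rfl fun i _ => ?_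
      rw [← Finset.sum_sub_distrib, Finset.mul_sum]
      refine Finset.sum_congr rfl fun j _ => ?_
      have : wave L (x.1 - x.2) j = wave L x.1 j - wave L x.2 j := by
        rw [sub_eq_add_neg, wave_add, wave_neg]; ring
      rw [this]
      push_cast
      ring
    simp only [hdiv, mul_zero, Finset.sum_const_zero] at h3
    exact (sub_eq_zero.mp h3).symm
  have h4 : conj (∑' x, g x) = ∑' x, g x := by
    rw [Complex.conj_tsum, ← (Equiv.prodComm Mode Mode).tsum_eq]
    exact tsum_congr fun x => h1 x
  exact Complex.conj_eq_iff_im.mp h4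

/-- The discarded gradient part is parallel to the wave vector, hence orthogonal to a
divergence-free `c`. -/
lemma sum_conj_mul_leray {c n : Coeffs} (hdiv : ∀ k, ∑ i, (wave L k i : ℂ) * c k i = 0)
    (k : Mode) : ∑ i, conj (c k i) * leray L n k i = ∑ i, conj (c k i) * n k i := by
  have h : ∑ i, conj (c k i) * (wave L k i : ℂ) = 0 := by
    have := congrArg conj (hdiv k)
    rw [map_sum, map_zero] at this
    rw [← this]
    refine Finset.sum_congr rfl fun i _ => ?_
    rw [map_mul, Complex.conj_ofReal, mul_comm]
  simp only [leray, mul_sub, Finset.sum_sub_distrib, sub_eq_self]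
  calc _ = (∑ i, conj (c k i) * (wave L k i : ℂ)) *
        ((∑ j, (wave L k j : ℂ) * n k j) / (waveSq L k : ℂ)) := by
        rw [Finset.sum_mul]
        exact Finset.sum_congr rfl fun i _ => by ring
    _ = 0 := by rw [h, zero_mul]

variable [hL : Fact (0 < L)]

/-- The Poincaré constant squared. -/
def poincare (L : ℝ) : ℝ := (L / (2 * Real.pi)) ^ 2

lemma one_le_poincare_mul {k : Mode} (hk : k ≠ 0) : 1 ≤ poincare L * waveSq L k := by
  have hLp := hL.out
  have hpi := Real.pi_pos
  have h := mul_le_mul_of_nonneg_left (waveSq_ge (L := L) hk) (sq_nonneg (L / (2 * Real.pi)))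
  refine le_trans (le_of_eq ?_) h
  field_simp

lemma poincare_nonneg : 0 ≤ poincare L := sq_nonneg _

/-- The energy form of the nonlinear term vanishes. -/
lemma tsum_energy_nonlin_eq_zero (hα : 0 < α) {c : Coeffs}
    (hreal : ∀ k i, c (-k) i = conj (c k i)) (hdiv : ∀ k, ∑ i, (wave L k i : ℂ) * c k i = 0)
    (hzero : ∀ i, c 0 i = 0) (hc : ∀ i, Summable fun k => (waveSq L k * ‖c k i‖) ^ 2) :
    ∑' k, ∑ i, (1 + α ^ 2 * waveSq L k) * deconvSymbol L α N k *
      (conj (c k i) * leray L (nonlin L α N c) k i).re = 0 := by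
  set v : Coeffs := fun k i => deconvSymbol L α N k * c k i with hv
  have hdn (k : Mode) : 0 ≤ deconvSymbol L α N k := zero_le_one.trans (one_le_deconvSymbol N k)
  have hP := poincare_nonneg (L := L)
  have hvreal (k i) : v (-k) i = conj (v k i) := by
    simp only [hv, deconvSymbol_neg, hreal, map_mul, Complex.conj_ofReal]
  have hvdiv (k) : ∑ i, (wave L k i : ℂ) * v k i = 0 := by
    simp only [hv, mul_left_comm _ (deconvSymbol L α N k : ℂ), ← Finset.mul_sum, hdiv, mul_zero]
  have hvn (k i) : ‖v k i‖ ≤ (N + 1) * ‖c k i‖ := by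
    rw [hv, norm_mul, Complex.norm_real, Real.norm_of_nonneg (hdn k)]
    exact mul_le_mul_of_nonneg_right (deconvSymbol_le N k) (norm_nonneg _)
  have hcn (k i) : ‖c k i‖ ≤ poincare L * (waveSq L k * ‖c k i‖) := by
    by_cases hk : k = 0
    · rw [hk, hzero]; simp
    · rw [← mul_assoc]
      exact le_mul_of_one_le_left (norm_nonneg _) (one_le_poincare_mul hk)
  have hcl (k i) : waveAbs L k * ‖c k i‖ ≤ (1 + poincare L) * (waveSq L k * ‖c k i‖) := by
    have h1 : waveAbs L k ≤ 1 + waveSq L k := by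
      rw [← waveAbs_sq]; nlinarith [sq_nonneg (waveAbs L k - 1), waveAbs_nonneg (L := L) k]
    have h2 := mul_le_mul_of_nonneg_right h1 (norm_nonneg (c k i))
    linarith [hcn k i]
  have hv2 (i) : Summable fun k => ‖v k i‖ ^ 2 := by
    refine Summable.of_nonneg_of_le (fun _ => sq_nonneg _) (fun k => ?_)
      ((hc i).mul_left (((N + 1) * poincare L) ^ 2))
    rw [← mul_pow, mul_assoc]
    exact pow_le_pow_left₀ (norm_nonneg _) ((hvn k i).trans
      (mul_le_mul_of_nonneg_left (hcn k i) (by positivity))) 2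
  have hvw (i) : Summable fun k => (waveAbs L k * ‖v k i‖) ^ 2 := by
    refine Summable.of_nonneg_of_le (fun _ => sq_nonneg _) (fun k => ?_)
      ((hc i).mul_left (((N + 1) * (1 + poincare L)) ^ 2))
    rw [← mul_pow, mul_assoc]
    refine pow_le_pow_left₀ (mul_nonneg (waveAbs_nonneg k) (norm_nonneg _)) ?_ 2
    calc waveAbs L k * ‖v k i‖ ≤ waveAbs L k * ((N + 1) * ‖c k i‖) :=
          mul_le_mul_of_nonneg_left (hvn k i) (waveAbs_nonneg k)
      _ = (N + 1) * (waveAbs L k * ‖c k i‖) := by ring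
      _ ≤ _ := mul_le_mul_of_nonneg_left (hcl k i) (by positivity)
  -- This is where `H₂` regularity is needed. Since `G(k)(1 + α²|k|²) = 1`, the family is dominated
  -- by the product of the square summable symbol and an `H₂` weighted ℓ² family.
  have hv1 (i) : Summable fun k => ‖v k i‖ := by
    have h2 : Summable fun k => filterSymbol L α k *
        ((N + 1) * ((poincare L + α ^ 2) * (waveSq L k * ‖c k i‖))) := by
      refine summable_mul_of_sq (summable_filterSymbol_sq hα) ?_
      simp only [mul_pow ((N : ℝ) + 1), mul_pow (poincare L + α ^ 2)]
      exact ((hc i).mul_left _).mul_left _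
    refine Summable.of_nonneg_of_le (fun _ => norm_nonneg _) (fun k => ?_) h2
    have h3 : ‖c k i‖ = filterSymbol L α k * ((1 + α ^ 2 * waveSq L k) * ‖c k i‖) := by
      rw [← mul_assoc, mul_comm (filterSymbol L α k), denom_mul_filterSymbol, one_mul]
    have h4 : (1 + α ^ 2 * waveSq L k) * ‖c k i‖
        ≤ (poincare L + α ^ 2) * (waveSq L k * ‖c k i‖) := by
      linarith [hcn k i]
    calc ‖v k i‖ ≤ (N + 1) * ‖c k i‖ := hvn k i
      _ = filterSymbol L α k * ((N + 1) * ((1 + α ^ 2 * waveSq L k) * ‖c k i‖)) := by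
          linear_combination ((N : ℝ) + 1) * h3
      _ ≤ _ := mul_le_mul_of_nonneg_left (mul_le_mul_of_nonneg_left h4 (by positivity))
          (filterSymbol_pos k).le
  have hsij (i j : Fin 3) : Summable fun x : Mode × Mode =>
      (wave L x.1 j : ℂ) * (conj (v x.1 i) * (v x.2 i * v (x.1 - x.2) j)) := by
    refine Summable.of_norm_bounded (summable_trilinear (fun _ => norm_nonneg _)
      (fun _ => norm_nonneg _) (fun _ => mul_nonneg (waveAbs_nonneg _) (norm_nonneg _))
      (hv1 j) (hv2 i) (hvw i)) fun x => ?_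
    rw [norm_mul, norm_mul, norm_mul, Complex.norm_real, RCLike.norm_conj, Real.norm_eq_abs]
    calc _ ≤ waveAbs L x.1 * (‖v x.1 i‖ * (‖v x.2 i‖ * ‖v (x.1 - x.2) j‖)) :=
          mul_le_mul_of_nonneg_right (abs_wave_le _ _) (by positivity)
      _ = _ := by ring
  have hsum : Summable fun x : Mode × Mode => ∑ i, ∑ j,
      (wave L x.1 j : ℂ) * (conj (v x.1 i) * (v x.2 i * v (x.1 - x.2) j)) :=
    summable_sum fun i _ => summable_sum fun j _ => hsij i j
  have him := im_trilinear_eq_zero hvreal hvdiv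
  have hk (k : Mode) : ∑ i, (1 + α ^ 2 * waveSq L k) * deconvSymbol L α N k *
      (conj (c k i) * leray L (nonlin L α N c) k i).re
      = -(∑' l, ∑ i, ∑ j, (wave L k j : ℂ) * (conj (v k i) * (v l i * v (k - l) j))).im := by
    have e1 : ∑ i, (1 + α ^ 2 * waveSq L k) * deconvSymbol L α N k *
        (conj (c k i) * leray L (nonlin L α N c) k i).re
        = ((((1 + α ^ 2 * waveSq L k) * deconvSymbol L α N k : ℝ) : ℂ) *
          ∑ i, conj (c k i) * nonlin L α N c k i).re := by
      rw [← sum_conj_mul_leray hdiv, Complex.re_ofReal_mul, Complex.re_sum, Finset.mul_sum]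
    -- The first factor of the weight cancels the filter and the second turns the test factor `c`
    -- into `v`. What is left is `i` times the trilinear form of `v`, so its real part is minus the
    -- imaginary part of that form.
    have e2 : (((1 + α ^ 2 * waveSq L k) * deconvSymbol L α N k : ℝ) : ℂ) *
          ∑ i, conj (c k i) * nonlin L α N c k i
        = Complex.I * ∑' l, ∑ i, ∑ j,
          (wave L k j : ℂ) * (conj (v k i) * (v l i * v (k - l) j)) := by
      have hfib (i j : Fin 3) : Summable fun l =>
          (wave L k j : ℂ) * (conj (v k i) * (v l i * v (k - l) j)) :=
        (hsij i j).comp_injective (i := fun l => (k, l)) fun _ _ h => (Prod.mk.inj h).2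
      rw [Summable.tsum_finsetSum fun i _ => summable_sum fun j _ => hfib i j,
        Finset.mul_sum, Finset.mul_sum]
      refine Finset.sum_congr rfl fun i _ => ?_
      rw [Summable.tsum_finsetSum fun j _ => hfib i j, nonlin, Finset.mul_sum, Finset.mul_sum,
        Finset.mul_sum]
      refine Finset.sum_congr rfl fun j _ => ?_
      rw [tsum_mul_left, tsum_mul_left]
      have e3 : (((1 + α ^ 2 * waveSq L k : ℝ)) : ℂ) * (filterSymbol L α k : ℂ) = 1 := by
        exact_mod_cast denom_mul_filterSymbol (L := L) (α := α) k
      simp only [hv, map_mul, Complex.conj_ofReal]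
      rw [Complex.ofReal_mul]
      linear_combination (Complex.I * (deconvSymbol L α N k : ℂ) * conj (c k i) *
        (wave L k j : ℂ) * ∑' l, (deconvSymbol L α N l * c l i) *
          (deconvSymbol L α N (k - l) * c (k - l) j)) * e3
    rw [e1, e2, Complex.I_mul_re]
  rw [tsum_congr hk, tsum_neg, ← Complex.im_tsum, ← hsum.tsum_prod, him, neg_zero]
  exact hsum.prod

end Cancellation

/-! ### Further properties of Duhamel's formula. -/

section DuhamelExtra

variable {T : ℝ} {g g' : ℝ → ℂ}

lemma duhamel_congr_ae (hgg : ∀ᵐ s ∂(volume.restrict (Set.Icc 0 T)), g s = g' s) (μ : ℝ) (y₀ : ℂ)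
    {t : ℝ} (ht : t ∈ Set.Icc 0 T) : duhamel μ y₀ g t = duhamel μ y₀ g' t := by
  rw [duhamel, duhamel]
  congr 2
  rw [ae_restrict_iff' measurableSet_Icc] at hgg
  refine intervalIntegral.integral_congr_ae ?_
  filter_upwards [hgg] with s hs hs'
  rw [Set.uIoc_of_le ht.1] at hs'
  rw [hs ⟨hs'.1.le, hs'.2.trans ht.2⟩]

lemma conj_duhamel (μ : ℝ) (y₀ : ℂ) (g : ℝ → ℂ) (t : ℝ) :
    conj (duhamel μ y₀ g t) = duhamel μ (conj y₀) (fun s => conj (g s)) t := by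
  rw [duhamel, duhamel, map_mul, map_add, Complex.conj_ofReal]
  congr 2
  simp only [intervalIntegral, map_sub, ← integral_conj, map_mul, Complex.conj_ofReal]

lemma IsPrim.sum_mul {ι : Type*} (s : Finset ι) {y h : ι → ℝ → ℂ} (c : ι → ℂ)
    (hy : ∀ i ∈ s, IsPrim T (y i) (h i)) :
    IsPrim T (fun t => ∑ i ∈ s, c i * y i t) (fun t => ∑ i ∈ s, c i * h i t) := by
  have hi (t : ℝ) (ht : ∀ i ∈ s, IntervalIntegrable (h i) volume 0 t) :
      ∀ i ∈ s, IntervalIntegrable (fun τ => c i * h i τ) volume 0 t :=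
    fun i his => (ht i his).const_mul _
  refine ⟨?_, fun t ht => ?_⟩
  · have := IntervalIntegrable.sum s (hi T fun i his => (hy i his).integrable)
    convert! this using 1
    ext t
    simp
  · rw [intervalIntegral.integral_finsetSum
      (hi t fun i his => (hy i his).intervalIntegrable ht), ← Finset.sum_add_distrib]
    refine Finset.sum_congr rfl fun i his => ?_
    rw [intervalIntegral.integral_const_mul, (hy i his).eq t ht]
    ring

end DuhamelExtra

/-! ### The truncated model as an instance of the abstract equation. -/

section CoefficientEquation

lemma summable_mode_fin {g : Mode × Fin 3 → ℝ} (h0 : ∀ p, 0 ≤ g p)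
    (hg : ∀ i, Summable fun k => g (k, i)) : Summable g := by
  rw [← (Equiv.prodComm (Fin 3) Mode).summable_iff]
  exact (summable_prod_of_nonneg (f := g ∘ Equiv.prodComm (Fin 3) Mode) fun x => h0 _).mpr
    ⟨fun i => hg i, Summable.of_finite⟩

lemma Summable.fiber {g : Mode × Fin 3 → ℝ} (hg : Summable g) (i : Fin 3) :
    Summable fun k => g (k, i) :=
  hg.comp_injective (i := fun k => (k, i)) fun _ _ h => (Prod.mk.inj h).1

/-- A forcing term in `L²(0,T; H₋₁)`, through its Fourier coefficients. -/
structure IsForcing (L T : ℝ) (f : ℝ → Coeffs) : Prop where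
  integrable : ∀ k i, IntervalIntegrable (fun s => f s k i) volume 0 T
  sq_integrable : ∀ k i, IntervalIntegrable (fun s => ‖f s k i‖ ^ 2) volume 0 T
  summable : Summable fun p : Mode × Fin 3 =>
    (waveSq L p.1)⁻¹ * ∫ s in (0 : ℝ)..T, ‖f s p.1 p.2‖ ^ 2
  isReal : ∀ᵐ s ∂(volume.restrict (Set.Icc 0 T)), ∀ k i, f s (-k) i = conj (f s k i)
  divFree : ∀ᵐ s ∂(volume.restrict (Set.Icc 0 T)), ∀ k, ∑ i, (wave L k i : ℂ) * f s k i = 0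
  zeroMean : ∀ᵐ s ∂(volume.restrict (Set.Icc 0 T)), ∀ i, f s 0 i = 0

/-- An initial velocity in `H₁`, through its Fourier coefficients. -/
structure IsInitial (L : ℝ) (c : Coeffs) : Prop where
  summable : Summable fun p : Mode × Fin 3 => waveSq L p.1 * ‖c p.1 p.2‖ ^ 2
  isReal : ∀ k i, c (-k) i = conj (c k i)
  divFree : ∀ k, ∑ i, (wave L k i : ℂ) * c k i = 0
  zeroMean : ∀ i, c 0 i = 0

lemma nonlin_zero_mode {L α : ℝ} {N : ℕ} (c : Coeffs) (i : Fin 3) : nonlin L α N c 0 i = 0 := by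
  simp [nonlin, wave_zero]

lemma leray_zero_mode {L : ℝ} (c : Coeffs) (i : Fin 3) : leray L c 0 i = c 0 i := by
  simp [leray, wave_zero]

/-- The projected term is divergence-free, so it cannot create divergence in the mode equations. -/
lemma sum_wave_mul_leray {L : ℝ} [Fact (0 < L)] (c : Coeffs) (k : Mode) :
    ∑ i, (wave L k i : ℂ) * leray L c k i = 0 := by
  by_cases hk : k = 0
  · simp [hk, wave_zero]
  have h0 : (waveSq L k : ℂ) ≠ 0 := by exact_mod_cast (waveSq_pos hk).ne'
  have h1 : ∑ i, (wave L k i : ℂ) * (wave L k i : ℂ) = (waveSq L k : ℂ) := by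
    rw [waveSq]; push_cast
    exact Finset.sum_congr rfl fun i _ => by ring
  simp only [leray, mul_sub, Finset.sum_sub_distrib]
  have h2 : ∑ i, (wave L k i : ℂ) *
      ((wave L k i : ℂ) * (∑ j, (wave L k j : ℂ) * c k j) / (waveSq L k : ℂ))
      = (∑ i, (wave L k i : ℂ) * (wave L k i : ℂ)) *
        ((∑ j, (wave L k j : ℂ) * c k j) / (waveSq L k : ℂ)) := by
    rw [Finset.sum_mul]
    exact Finset.sum_congr rfl fun i _ => by ring
  rw [h2, h1, mul_div_cancel₀ _ h0, sub_self]

/-- Complex conjugation combined with `k ↦ -k`. -/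
def refl (a : XSeq) : XSeq :=
  ⟨fun p => conj (a (-p.1, p.2)), memℓp_two (by
    simp only [RCLike.norm_conj]
    exact (hasSum_norm_sq a).summable.comp_injective
      (i := fun p : Mode × Fin 3 => (-p.1, p.2)) fun x y h => by
        have := Prod.mk.inj h
        exact Prod.ext (neg_injective this.1) this.2)⟩

lemma refl_apply (a : XSeq) (k : Mode) (i : Fin 3) : refl a (k, i) = conj (a (-k, i)) := rfl

lemma norm_refl (a : XSeq) : ‖refl a‖ = ‖a‖ := by
  have h1 := (hasSum_norm_sq (refl a)).tsum_eq
  have h2 := (hasSum_norm_sq a).tsum_eq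
  have h3 : ∑' p, ‖refl a p‖ ^ 2 = ∑' p, ‖a p‖ ^ 2 := by
    rw [← ((Equiv.neg Mode).prodCongr (Equiv.refl (Fin 3))).tsum_eq (fun p => ‖a p‖ ^ 2)]
    refine tsum_congr fun p => ?_
    rw [show refl a p = conj (a (-p.1, p.2)) from rfl, RCLike.norm_conj]
    rfl
  have h4 : ‖refl a‖ ^ 2 = ‖a‖ ^ 2 := by rw [← h1, ← h2, h3]
  exact (pow_left_inj₀ (norm_nonneg _) (norm_nonneg _) two_ne_zero).mp h4

lemma refl_sub (a b : XSeq) : refl (a - b) = refl a - refl b := by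
  ext p
  exact map_sub (starRingEnd ℂ) (a (-p.1, p.2)) (b (-p.1, p.2))

lemma refl_smul (r : ℝ) (a : XSeq) : refl (r • a) = r • refl a := by
  ext p
  simp [refl]

lemma continuous_refl : Continuous refl := by
  refine LipschitzWith.continuous (K := 1) (LipschitzWith.of_dist_le_mul fun a b => ?_)
  rw [dist_eq_norm, dist_eq_norm, ← refl_sub, norm_refl]
  simp

lemma retract_refl (R : ℝ) (a : XSeq) : retract R (refl a) = refl (retract R a) := by
  rw [retract, retract, norm_refl, refl_smul]

variable {L α : ℝ} {N : ℕ}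

/-- After `l ↦ -l`, the sign from the odd wave vector cancels the one from conjugating `i`. This
equivariance is what keeps solutions real. -/
lemma bilin_refl (a : XSeq) (k : Mode) (i : Fin 3) :
    bilin L α N (refl a) (refl a) k i = conj (bilin L α N a a (-k) i) := by
  simp only [bilin, map_sum, map_mul, Complex.conj_I, Complex.conj_ofReal, Complex.conj_tsum,
    filterSymbol_neg]
  refine Finset.sum_congr rfl fun j _ => ?_
  rw [neg_mul, neg_mul, ← mul_neg, ← tsum_neg, ← (Equiv.neg Mode).tsum_eq]
  refine congrArg _ (tsum_congr fun l => ?_)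
  simp only [Equiv.neg_apply, refl_apply, neg_neg, neg_sub]
  have h1 : -k - l = -l - k := by abel
  have h2 : k - -l = -(-k - l) := by abel
  have h3 : convWeight L α N k j (-l) = -convWeight L α N (-k) j l := by
    simp only [convWeight, wave_neg, deconvSymbol_neg, waveAbs_neg, h2]
    ring
  rw [h3, h1]
  push_cast
  ring

lemma leray_refl {c d : Coeffs} (h : ∀ k i, c k i = conj (d (-k) i)) (k : Mode) (i : Fin 3) :
    leray L c k i = conj (leray L d (-k) i) := by
  simp only [leray, h, map_sub, map_div₀, map_mul, map_sum, Complex.conj_ofReal, wave_neg,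
    waveSq_neg, Complex.ofReal_neg, neg_mul, Finset.sum_neg_distrib, mul_neg, neg_neg]

variable [hL : Fact (0 < L)]

/-- `G² ≤ G ≤ 1/(α²|k|²)`: the filter gains the derivative that takes `H₋₁` forcing to `L²` and `L²`
data to `H₁`. -/
lemma filterSymbol_sq_le (hα : 0 < α) {k : Mode} (hk : k ≠ 0) :
    filterSymbol L α k ^ 2 ≤ (α ^ 2)⁻¹ * (waveSq L k)⁻¹ := by
  have h1 : filterSymbol L α k ^ 2 ≤ filterSymbol L α k := by
    rw [sq]
    exact mul_le_of_le_one_left (filterSymbol_pos k).le (filterSymbol_le_one k)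
  refine h1.trans ?_
  rw [← mul_inv, filterSymbol, one_div]
  have := waveSq_pos (L := L) hk
  exact inv_anti₀ (by positivity) (by linarith)

/-- The Leray projected nonlinear term, cut off at radius `R`. -/
def cutNonlin (L α R : ℝ) (N : ℕ) (a : XSeq) (p : Mode × Fin 3) : ℂ :=
  leray L (bilin L α N (retract R a) (retract R a)) p.1 p.2

/-- Lipschitz constants of `cutNonlin`. -/
def cutLip (L α R : ℝ) (N : ℕ) (p : Mode × Fin 3) : ℝ :=
  48 * convConst L N * R * filterSymbol L α p.1

lemma summable_cutLip_sq (hα : 0 < α) (R : ℝ) : Summable fun p => cutLip L α R N p ^ 2 := by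
  have h : Summable fun p : Mode × Fin 3 => filterSymbol L α p.1 ^ 2 :=
    summable_mode_fin (fun p => sq_nonneg _) fun _ => summable_filterSymbol_sq hα
  exact (h.mul_left ((48 * convConst L N * R) ^ 2)).congr fun p => (mul_pow _ _ 2).symm

/-- The constant is `48 = 4 · 3 · 2 · 2`: the Leray bound, the three derivative directions, `‖·‖ +
‖·‖ ≤ 2R`, and the Lipschitz constant of the retraction. -/
lemma norm_cutNonlin_sub_le {R : ℝ} (hR : 0 < R) (a b : XSeq) (p : Mode × Fin 3) :
    ‖cutNonlin L α R N a p - cutNonlin L α R N b p‖ ≤ cutLip L α R N p * ‖a - b‖ := by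
  have h1 : ∀ i, ‖(bilin L α N (retract R a) (retract R a)
      - bilin L α N (retract R b) (retract R b)) p.1 i‖
      ≤ 12 * convConst L N * R * filterSymbol L α p.1 * ‖a - b‖ := by
    intro i
    refine (norm_bilin_self_sub_le (retract R a) (retract R b) p.1 i).trans ?_
    have h2 : (‖retract R a‖ + ‖retract R b‖) * ‖retract R a - retract R b‖
        ≤ (R + R) * (2 * ‖a - b‖) :=
      mul_le_mul (add_le_add (norm_retract_le hR a) (norm_retract_le hR b))
        (norm_retract_sub_le hR a b) (norm_nonneg _) (by positivity)
    have h3 := mul_le_mul_of_nonneg_left h2 (mul_nonneg (mul_nonneg (by norm_num : (0:ℝ) ≤ 3)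
      (convConst_nonneg (L := L) (N := N))) (filterSymbol_pos (L := L) (α := α) p.1).le)
    refine h3.trans_eq ?_
    ring
  have h4 := norm_leray_le (L := L) h1 p.2
  rw [leray_sub] at h4
  refine h4.trans_eq ?_
  rw [cutLip]
  ring

lemma cutNonlin_zero (R : ℝ) (p : Mode × Fin 3) : cutNonlin L α R N 0 p = 0 := by
  have h0 : retract R (0 : XSeq) = 0 := by simp [retract]
  have h1 : ∀ i, ‖bilin L α N (0 : XSeq) 0 p.1 i‖ ≤ 0 := fun i => by
    simpa using norm_bilin_le (L := L) (α := α) (N := N) (0 : XSeq) 0 p.1 i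
  have h2 := norm_leray_le (L := L) h1 p.2
  rw [mul_zero] at h2
  rw [cutNonlin, h0]
  exact norm_le_zero_iff.mp h2

lemma integral_filter_forcing_le {T : ℝ} (hT : 0 ≤ T) (hα : 0 < α) {f : ℝ → Coeffs}
    (hf : IsForcing L T f) (p : Mode × Fin 3) :
    ∫ s in (0 : ℝ)..T, ‖(filterSymbol L α p.1 : ℂ) * f s p.1 p.2‖ ^ 2
      ≤ (α ^ 2)⁻¹ * ((waveSq L p.1)⁻¹ * ∫ s in (0 : ℝ)..T, ‖f s p.1 p.2‖ ^ 2) := by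
  have h0 : 0 ≤ ∫ s in (0 : ℝ)..T, ‖f s p.1 p.2‖ ^ 2 :=
    intervalIntegral.integral_nonneg hT fun _ _ => sq_nonneg _
  have h2 : ∫ s in (0 : ℝ)..T, ‖(filterSymbol L α p.1 : ℂ) * f s p.1 p.2‖ ^ 2
      = filterSymbol L α p.1 ^ 2 * ∫ s in (0 : ℝ)..T, ‖f s p.1 p.2‖ ^ 2 := by
    rw [← intervalIntegral.integral_const_mul]
    refine intervalIntegral.integral_congr fun s _ => ?_
    simp only [norm_mul, mul_pow, Complex.norm_real, Real.norm_eq_abs, sq_abs]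
  rw [h2]
  -- In mode zero the right side is `0` because `0⁻¹ = 0`, so the zero mean of the forcing is
  -- essential.
  by_cases hp : p.1 = 0
  · have h1 : ∫ s in (0 : ℝ)..T, ‖f s p.1 p.2‖ ^ 2 = 0 := by
      refine intervalIntegral.integral_zero_ae ?_
      have := hf.zeroMean
      rw [ae_restrict_iff' measurableSet_Icc] at this
      filter_upwards [this] with s hs hs'
      rw [Set.uIoc_of_le hT] at hs'
      rw [hp, hs ⟨hs'.1.le, hs'.2⟩]
      simp
    rw [h1]; simp
  · rw [← mul_assoc]
    exact mul_le_mul_of_nonneg_right (filterSymbol_sq_le hα hp) h0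

/-- The mild formulation of the Leray projected model with the nonlinear term cut off
at radius `R`. -/
def admData (L α ν T R : ℝ) [Fact (0 < L)] (N : ℕ) (hα : 0 < α) (hν : 0 < ν) (hT : 0 ≤ T)
    (hR : 0 < R) {c : Coeffs} {f : ℝ → Coeffs} (hc : IsInitial L c) (hf : IsForcing L T f) :
    MildData (Mode × Fin 3) where
  ν := ν
  T := T
  ℓ p := waveSq L p.1
  Q := cutNonlin L α R N
  M := cutLip L α R N
  y₀ p := c p.1 p.2
  F p s := filterSymbol L α p.1 * f s p.1 p.2
  hν := hν
  hT := hT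
  hℓ p := waveSq_nonneg p.1
  hM := summable_cutLip_sq hα R
  hQ := norm_cutNonlin_sub_le hR
  hQ0 := cutNonlin_zero R
  hy₀ := hc.summable
  hF p := (hf.integrable p.1 p.2).const_mul _
  hF2 p := by
    simp only [norm_mul, mul_pow]
    exact (hf.sq_integrable p.1 p.2).const_mul _
  hFs := Summable.of_nonneg_of_le
    (fun p => intervalIntegral.integral_nonneg hT fun _ _ => sq_nonneg _)
    (integral_filter_forcing_le hT hα hf) (hf.summable.mul_left ((α ^ 2)⁻¹))

end CoefficientEquation

/-! ### Almost everywhere summability from summable integrals. -/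

section Summability

/-- Tonelli: the sum has a finite integral, hence is finite almost everywhere. -/
lemma ae_summable_of_summable_integral {ι X : Type*} [Countable ι] [MeasurableSpace X]
    {μ : Measure X} {h : ι → X → ℝ} (h0 : ∀ p x, 0 ≤ h p x) (hi : ∀ p, Integrable (h p) μ)
    (hs : Summable fun p => ∫ x, h p x ∂μ) : ∀ᵐ x ∂μ, Summable fun p => h p x := by
  have h1 : ∫⁻ x, ∑' p, ENNReal.ofReal (h p x) ∂μ ≠ ⊤ := by
    rw [lintegral_tsum fun p => (hi p).aemeasurable.ennreal_ofReal]
    have h2 (p : ι) : ∫⁻ x, ENNReal.ofReal (h p x) ∂μ = ENNReal.ofReal (∫ x, h p x ∂μ) :=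
      (ofReal_integral_eq_lintegral_ofReal (hi p) (Eventually.of_forall (h0 p))).symm
    simp only [h2]
    exact hs.tsum_ofReal_ne_top
  have h3 := ae_lt_top' (AEMeasurable.tsum fun p => (hi p).aemeasurable.ennreal_ofReal) h1
  filter_upwards [h3] with x hx
  have h4 := ENNReal.summable_toReal hx.ne
  refine h4.congr fun p => ?_
  rw [ENNReal.toReal_ofReal (h0 p x)]

end Summability

/-! ### Mode equations, divergence, reality and `H₂` regularity of the truncated solution. -/

section MildSolution

variable {L α ν T R : ℝ} [hL : Fact (0 < L)] {N : ℕ} {hα : 0 < α} {hν : 0 < ν} {hT : 0 ≤ T}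
  {hR : 0 < R} {c : Coeffs} {f : ℝ → Coeffs} {hc : IsInitial L c} {hf : IsForcing L T f}
  {u : ℝ → XSeq}

lemma waveAbs_mul_unweight {a : XSeq} (ha : ∀ i, a (0, i) = 0) (k : Mode) (i : Fin 3) :
    (waveAbs L k : ℂ) * unweight L a k i = a (k, i) := by
  by_cases hk : k = 0
  · rw [hk, ha, waveAbs_zero]; simp
  · have : (waveAbs L k : ℂ) ≠ 0 := by exact_mod_cast (waveAbs_pos hk).ne'
    rw [unweight, mul_div_cancel₀ _ this]

lemma unweight_zero_mode (a : XSeq) (i : Fin 3) : unweight L a 0 i = 0 := by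
  simp [unweight, waveAbs_zero]

lemma sq_norm_eq_waveSq_mul {a : XSeq} (ha : ∀ i, a (0, i) = 0) (p : Mode × Fin 3) :
    ‖a p‖ ^ 2 = waveSq L p.1 * ‖unweight L a p.1 p.2‖ ^ 2 := by
  rw [show a p = a (p.1, p.2) from rfl, ← waveAbs_mul_unweight (L := L) ha, norm_mul, mul_pow,
    Complex.norm_real, Real.norm_eq_abs, sq_abs, waveAbs_sq]

lemma MildData.IsMild.apply_zero_mode (hu : (admData L α ν T R N hα hν hT hR hc hf).IsMild u)
    {t : ℝ} (ht : t ∈ Set.Icc 0 T) (i : Fin 3) : u t (0, i) = 0 := by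
  rw [hu.eq t ht, MildData.mild]
  simp [admData, waveSq_zero]

lemma MildData.IsMild.unweight_eq (hu : (admData L α ν T R N hα hν hT hR hc hf).IsMild u)
    {t : ℝ} (ht : t ∈ Set.Icc 0 T) {k : Mode} (hk : k ≠ 0) (i : Fin 3) :
    unweight L (u t) k i = duhamel (ν * waveSq L k) (c k i)
      ((admData L α ν T R N hα hν hT hR hc hf).rhs u (k, i)) t := by
  have h0 : (waveAbs L k : ℂ) ≠ 0 := by exact_mod_cast (waveAbs_pos hk).ne'
  rw [unweight, hu.eq t ht, MildData.mild]
  exact mul_div_cancel_left₀ _ h0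

lemma rhs_eq (s : ℝ) (p : Mode × Fin 3) :
    (admData L α ν T R N hα hν hT hR hc hf).rhs u p s
      = filterSymbol L α p.1 * f s p.1 p.2 - cutNonlin L α R N (u s) p := rfl

lemma cutNonlin_zero_mode (a : XSeq) (i : Fin 3) : cutNonlin L α R N a (0, i) = 0 := by
  rw [cutNonlin, leray_zero_mode, ← nonlin_unweight, nonlin_zero_mode]

lemma MildData.IsMild.isPrim (hu : (admData L α ν T R N hα hν hT hR hc hf).IsMild u)
    (k : Mode) (i : Fin 3) : IsPrim T (fun t => unweight L (u t) k i)
      (fun t => -((ν * waveSq L k : ℝ) : ℂ) * unweight L (u t) k i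
        + (filterSymbol L α k * f t k i - cutNonlin L α R N (u t) (k, i))) := by
  by_cases hk : k = 0
  · subst hk
    simp only [unweight_zero_mode, cutNonlin_zero_mode, mul_zero, zero_add, sub_zero]
    have h1 : IsPrim T (fun _ => (0 : ℂ)) (fun _ => 0) := ⟨by simp, by simp⟩
    refine h1.congr_right hT ?_
    filter_upwards [hf.zeroMean] with s hs
    rw [hs, mul_zero]
  · have h1 := isPrim_duhamel hT (ν * waveSq L k) (c k i)
      (MildData.intervalIntegrable_rhs hu.continuousOn (k, i))
    refine (h1.congr_left hT fun t ht => (hu.unweight_eq ht hk i).symm).congr_right hT ?_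
    rw [ae_restrict_iff' measurableSet_Icc]
    refine Eventually.of_forall fun t ht => ?_
    rw [hu.unweight_eq ht hk i, rhs_eq]

lemma MildData.IsMild.unweight_initial
    (hu : (admData L α ν T R N hα hν hT hR hc hf).IsMild u) (k : Mode) (i : Fin 3) :
    unweight L (u 0) k i = c k i := by
  by_cases hk : k = 0
  · rw [hk, unweight_zero_mode, hc.zeroMean]
  · rw [hu.unweight_eq ⟨le_rfl, hT⟩ hk, duhamel_zero]

/-- Converse of `MildData.IsMild.isPrim`. -/
lemma isMild_of_isPrim (hT : 0 ≤ T) (hc : IsInitial L c) (hf : IsForcing L T f)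
    (huc : ContinuousOn u (Set.Icc 0 T))
    (hu0 : ∀ t ∈ Set.Icc 0 T, ∀ i, u t (0, i) = 0) (hi : ∀ k i, unweight L (u 0) k i = c k i)
    (hp : ∀ k i, IsPrim T (fun t => unweight L (u t) k i)
      (fun t => -((ν * waveSq L k : ℝ) : ℂ) * unweight L (u t) k i
        + (filterSymbol L α k * f t k i - cutNonlin L α R N (u t) (k, i)))) :
    (admData L α ν T R N hα hν hT hR hc hf).IsMild u := by
  refine ⟨huc, fun t ht p => ?_⟩
  obtain ⟨k, i⟩ := p
  change t ∈ Set.Icc 0 T at ht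
  have h1 := (hp k i).eq_duhamel hT (MildData.intervalIntegrable_rhs
    (D := admData L α ν T R N hα hν hT hR hc hf) huc (k, i)) ht
  rw [hi] at h1
  rw [MildData.mild, ← waveAbs_mul_unweight (L := L) (hu0 t ht), h1]
  rfl

/-- Forcing and projected nonlinearity are divergence-free, so the divergence of each mode solves
`y' = -ν|k|² y` with zero data. -/
lemma MildData.IsMild.divFree (hu : (admData L α ν T R N hα hν hT hR hc hf).IsMild u)
    {t : ℝ} (ht : t ∈ Set.Icc 0 T) (k : Mode) :
    ∑ i, (wave L k i : ℂ) * unweight L (u t) k i = 0 := by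
  have h1 := IsPrim.sum_mul Finset.univ (fun i => (wave L k i : ℂ)) fun i _ => hu.isPrim k i
  have h2 : IsPrim T (fun t => ∑ i, (wave L k i : ℂ) * unweight L (u t) k i)
      (fun t => -((ν * waveSq L k : ℝ) : ℂ) * (∑ i, (wave L k i : ℂ) * unweight L (u t) k i)
        + 0) := by
    refine h1.congr_right hT ?_
    filter_upwards [hf.divFree] with s hs
    have e1 : ∑ i, (wave L k i : ℂ) * cutNonlin L α R N (u s) (k, i) = 0 :=
      sum_wave_mul_leray _ k
    simp only [mul_add, mul_sub, Finset.sum_add_distrib, Finset.sum_sub_distrib, e1, sub_zero,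
      mul_left_comm _ (filterSymbol L α k : ℂ), ← Finset.mul_sum, hs k, mul_zero, add_zero,
      mul_left_comm _ (-((ν * waveSq L k : ℝ) : ℂ))]
  have h3 := h2.eq_duhamel hT (g := fun _ => 0) (by simp) ht
  simp only [hu.unweight_initial, hc.divFree] at h3
  rw [h3]
  simp [duhamel]

lemma cutNonlin_refl (a : XSeq) (k : Mode) (i : Fin 3) :
    cutNonlin L α R N (refl a) (k, i) = conj (cutNonlin L α R N a (-k, i)) := by
  rw [cutNonlin, cutNonlin, retract_refl]
  exact leray_refl (fun k i => bilin_refl _ k i) k i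

/-- Real data make the equation equivariant under this reflection. Uniqueness of mild solutions then
forces `u` to be its own reflection, that is, a real field. -/
lemma MildData.IsMild.refl (hu : (admData L α ν T R N hα hν hT hR hc hf).IsMild u) :
    (admData L α ν T R N hα hν hT hR hc hf).IsMild fun t => ADM.refl (u t) := by
  refine ⟨continuous_refl.comp_continuousOn hu.continuousOn, fun t ht p => ?_⟩
  obtain ⟨k, i⟩ := p
  rw [refl_apply, hu.eq t ht, MildData.mild, MildData.mild, map_mul, Complex.conj_ofReal,
    conj_duhamel]
  have e1 : (admData L α ν T R N hα hν hT hR hc hf).ℓ (-k, i)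
    = (admData L α ν T R N hα hν hT hR hc hf).ℓ (k, i) := waveSq_neg k
  have e2 : conj ((admData L α ν T R N hα hν hT hR hc hf).y₀ (-k, i))
    = (admData L α ν T R N hα hν hT hR hc hf).y₀ (k, i) := by
    change conj (c (-k) i) = c k i
    rw [hc.isReal, Complex.conj_conj]
  rw [e1, e2]
  refine congrArg _ (duhamel_congr_ae (T := T) ?_ _ _ ht)
  filter_upwards [hf.isReal] with s hs
  rw [rhs_eq, rhs_eq, cutNonlin_refl, map_sub, map_mul, Complex.conj_ofReal, hs,
    Complex.conj_conj, filterSymbol_neg]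

lemma MildData.IsMild.isReal (hu : (admData L α ν T R N hα hν hT hR hc hf).IsMild u)
    {t : ℝ} (ht : t ∈ Set.Icc 0 T) (k : Mode) (i : Fin 3) :
    unweight L (u t) (-k) i = conj (unweight L (u t) k i) := by
  have h := hu.unique hu.refl ht
  rw [unweight, unweight, waveAbs_neg, map_div₀, Complex.conj_ofReal]
  congr 1
  conv_lhs => rw [h]
  rw [refl_apply, neg_neg]

lemma MildData.IsMild.continuousOn_unweight
    (hu : (admData L α ν T R N hα hν hT hR hc hf).IsMild u) (k : Mode) (i : Fin 3) :
    ContinuousOn (fun t => unweight L (u t) k i) (Set.Icc 0 T) :=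
  (hu.isPrim k i).continuousOn hT

/-- The dissipation half of the maximal regularity estimate: it places the solution in `L²(0,T;
H₂)`. -/
lemma MildData.IsMild.summable_integral
    (hu : (admData L α ν T R N hα hν hT hR hc hf).IsMild u) :
    Summable fun p : Mode × Fin 3 =>
      ∫ s in (0 : ℝ)..T, (waveSq L p.1 * ‖unweight L (u s) p.1 p.2‖) ^ 2 := by
  refine Summable.of_nonneg_of_le
    (fun p => intervalIntegral.integral_nonneg hT fun _ _ => sq_nonneg _) (fun p => ?_)
    ((MildData.summable_bound hu.continuousOn).mul_left ν⁻¹)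
  have h1 := MildData.energy_le_bound hu.continuousOn p (t := T) ⟨hT, le_rfl⟩
  have h2 : ∫ s in (0 : ℝ)..T, (waveSq L p.1 * ‖unweight L (u s) p.1 p.2‖) ^ 2
      = ∫ s in (0 : ℝ)..T, waveSq L p.1 ^ 2 * ‖duhamel (ν * waveSq L p.1) (c p.1 p.2)
        ((admData L α ν T R N hα hν hT hR hc hf).rhs u p) s‖ ^ 2 := by
    refine intervalIntegral.integral_congr fun s hs => ?_
    rw [Set.uIcc_of_le hT] at hs
    by_cases hp : p.1 = 0
    · simp [hp, waveSq_zero]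
    · simp only [hu.unweight_eq hs hp, mul_pow]
  rw [h2, le_inv_mul_iff₀ hν]
  refine le_trans ?_ h1
  exact le_add_of_nonneg_left (sq_nonneg _)

end MildSolution

/-! ### A priori bound in `H₁`, uniform in the truncation radius. -/

section Energy

variable {L α ν T R : ℝ} [hL : Fact (0 < L)] {N : ℕ} {hα : 0 < α} {hν : 0 < ν} {hT : 0 ≤ T}
  {hR : 0 < R} {c : Coeffs} {f : ℝ → Coeffs} {hc : IsInitial L c} {hf : IsForcing L T f}
  {u : ℝ → XSeq}

/-- The weight `(1 + α² |k|²) D_N(k)` of the model energy. -/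
def energyWeight (L α : ℝ) (N : ℕ) (k : Mode) : ℝ :=
  (1 + α ^ 2 * waveSq L k) * deconvSymbol L α N k

lemma energyWeight_nonneg (k : Mode) : 0 ≤ energyWeight L α N k :=
  mul_nonneg (zero_le_one.trans (one_le_filter_denom k))
    (zero_le_one.trans (one_le_deconvSymbol N k))

/-- Upper bound of `energyWeight` relative to `|k|²`. -/
def energyConst (L α : ℝ) (N : ℕ) : ℝ := (N + 1) * (poincare L + α ^ 2)

lemma energyConst_nonneg : 0 ≤ energyConst L α N := by
  have := poincare_nonneg (L := L)
  unfold energyConst; positivity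

lemma energyWeight_le {k : Mode} (hk : k ≠ 0) :
    energyWeight L α N k ≤ energyConst L α N * waveSq L k := by
  have h1 : 1 + α ^ 2 * waveSq L k ≤ (poincare L + α ^ 2) * waveSq L k := by
    linarith [one_le_poincare_mul (L := L) hk]
  have h2 := mul_le_mul h1 (deconvSymbol_le (L := L) (α := α) N k)
    (zero_le_one.trans (one_le_deconvSymbol N k))
    (zero_le_one.trans ((one_le_filter_denom k).trans h1))
  refine h2.trans_eq ?_
  rw [energyConst]; ring

/-- The model energy controls the `H₁` norm because `D_N ≥ 1`; this uses `α > 0`. -/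
lemma waveSq_le_energyWeight (hα : 0 < α) (k : Mode) :
    waveSq L k ≤ (α ^ 2)⁻¹ * energyWeight L α N k := by
  rw [le_inv_mul_iff₀ (by positivity)]
  calc α ^ 2 * waveSq L k ≤ 1 + α ^ 2 * waveSq L k := by linarith
    _ ≤ _ := le_mul_of_one_le_right (zero_le_one.trans (one_le_filter_denom k))
      (one_le_deconvSymbol N k)

lemma energyWeight_mul_norm_le {w : Coeffs} (hw : ∀ i, w 0 i = 0) (k : Mode) (i : Fin 3) :
    energyWeight L α N k * ‖w k i‖ ≤ energyConst L α N * (waveSq L k * ‖w k i‖) := by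
  by_cases hk : k = 0
  · rw [hk, hw]; simp
  · rw [← mul_assoc]
    exact mul_le_mul_of_nonneg_right (energyWeight_le hk) (norm_nonneg _)

/-- The a priori bound of the `H₁` norm contributed by one coefficient. -/
def aprioriTerm (L α ν T : ℝ) (N : ℕ) (c : Coeffs) (f : ℝ → Coeffs) (p : Mode × Fin 3) : ℝ :=
  energyWeight L α N p.1 * ‖c p.1 p.2‖ ^ 2 + (N + 1) / (2 * ν) *
    ((waveSq L p.1)⁻¹ * ∫ s in (0 : ℝ)..T, ‖f s p.1 p.2‖ ^ 2)

lemma summable_aprioriTerm (hc : IsInitial L c) (hf : IsForcing L T f) :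
    Summable (aprioriTerm L α ν T N c f) := by
  refine Summable.add ?_ (hf.summable.mul_left _)
  refine Summable.of_nonneg_of_le
    (fun p => mul_nonneg (energyWeight_nonneg _) (sq_nonneg _)) (fun p => ?_)
    (hc.summable.mul_left (energyConst L α N))
  by_cases hp : p.1 = 0
  · rw [hp, hc.zeroMean]; simp
  · rw [← mul_assoc]
    exact mul_le_mul_of_nonneg_right (energyWeight_le hp) (sq_nonneg _)

/-- The energy production of the nonlinear term in one coefficient. -/
def production (L α R : ℝ) (N : ℕ) (a : XSeq) (p : Mode × Fin 3) : ℝ :=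
  energyWeight L α N p.1 * (conj (unweight L a p.1 p.2) * cutNonlin L α R N a p).re

lemma norm_production_le (a : XSeq) (p : Mode × Fin 3) :
    ‖production L α R N a p‖ ≤ energyConst L α N *
      ((waveSq L p.1 * ‖unweight L a p.1 p.2‖) ^ 2 + ‖cutNonlin L α R N a p‖ ^ 2) := by
  rw [production, norm_mul, Real.norm_of_nonneg (energyWeight_nonneg _)]
  have h1 : ‖(conj (unweight L a p.1 p.2) * cutNonlin L α R N a p).re‖
      ≤ ‖unweight L a p.1 p.2‖ * ‖cutNonlin L α R N a p‖ := by
    refine (Complex.abs_re_le_norm _).trans_eq ?_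
    rw [norm_mul, RCLike.norm_conj]
  have h2 := mul_le_mul_of_nonneg_left h1 (energyWeight_nonneg (L := L) (α := α) (N := N) p.1)
  have h3 := mul_le_mul_of_nonneg_right (energyWeight_mul_norm_le (L := L) (α := α) (N := N)
    (unweight_zero_mode (L := L) a) p.1 p.2) (norm_nonneg (cutNonlin L α R N a p))
  have h4 : (waveSq L p.1 * ‖unweight L a p.1 p.2‖) * ‖cutNonlin L α R N a p‖
      ≤ (waveSq L p.1 * ‖unweight L a p.1 p.2‖) ^ 2 + ‖cutNonlin L α R N a p‖ ^ 2 := by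
    nlinarith [sq_nonneg ((waveSq L p.1 * ‖unweight L a p.1 p.2‖) - ‖cutNonlin L α R N a p‖),
      sq_nonneg (waveSq L p.1 * ‖unweight L a p.1 p.2‖), sq_nonneg ‖cutNonlin L α R N a p‖]
  have h5 := mul_le_mul_of_nonneg_left h4 (energyConst_nonneg (L := L) (α := α) (N := N))
  linarith

/-- One scalar serves all modes, since the retraction is a homothety and the nonlinearity is
quadratic. The energy cancellation therefore persists after truncation. -/
lemma cutNonlin_eq (R : ℝ) (a : XSeq) : ∃ θ : ℝ, ∀ p : Mode × Fin 3,
    cutNonlin L α R N a p = (θ : ℂ) * leray L (nonlin L α N (unweight L a)) p.1 p.2 := by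
  refine ⟨(R / max R ‖a‖) ^ 2, fun p => ?_⟩
  rw [cutNonlin, retract, bilin_smul (L := L), leray_smul, nonlin_unweight]
  rfl

lemma summable_sq_cutNonlin (hα : 0 < α) (hR : 0 < R) (a : XSeq) :
    Summable fun p => ‖cutNonlin L α R N a p‖ ^ 2 := by
  refine Summable.of_nonneg_of_le (fun _ => sq_nonneg _) (fun p => ?_)
    ((summable_cutLip_sq (L := L) (N := N) hα R).mul_right (‖a‖ ^ 2))
  have := norm_cutNonlin_sub_le (L := L) (α := α) (N := N) hR a 0 p
  rw [cutNonlin_zero, sub_zero, sub_zero] at this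
  rw [← mul_pow]
  exact pow_le_pow_left₀ (norm_nonneg _) this 2

lemma tsum_production_eq_zero (hα : 0 < α) (hR : 0 < R) {a : XSeq}
    (hreal : ∀ k i, unweight L a (-k) i = conj (unweight L a k i))
    (hdiv : ∀ k, ∑ i, (wave L k i : ℂ) * unweight L a k i = 0)
    (hs : Summable fun p : Mode × Fin 3 => (waveSq L p.1 * ‖unweight L a p.1 p.2‖) ^ 2) :
    ∑' p, production L α R N a p = 0 := by
  have hsum : Summable (production L α R N a) :=
    Summable.of_norm_bounded ((hs.add (summable_sq_cutNonlin hα hR a)).mul_left _)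
      (norm_production_le a)
  obtain ⟨θ, hθ⟩ := cutNonlin_eq (L := L) (α := α) (N := N) R a
  have h1 := tsum_energy_nonlin_eq_zero (N := N) hα hreal hdiv (unweight_zero_mode a)
    (fun i => Summable.fiber hs i)
  rw [hsum.tsum_prod]
  have h2 (k : Mode) : ∑' i, production L α R N a (k, i)
      = θ * ∑ i, (1 + α ^ 2 * waveSq L k) * deconvSymbol L α N k *
        (conj (unweight L a k i) * leray L (nonlin L α N (unweight L a)) k i).re := by
    rw [tsum_fintype, Finset.mul_sum]
    refine Finset.sum_congr rfl fun i _ => ?_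
    rw [production, hθ, mul_left_comm (conj _), Complex.re_ofReal_mul, energyWeight]
    ring
  rw [tsum_congr h2, tsum_mul_left, h1, mul_zero]

/-- Weighted energy identity of one mode. The weight times `G` is `D_N`, which lies between `1` and
`N + 1` and below the weight. Young's inequality thus lets the full dissipation absorb the forcing,
leaving `(N + 1)/(2ν)`. The nonlinear production stays as an integral, because it cancels only after
summation over the modes. -/
lemma MildData.IsMild.energy_mode_le
    (hu : (admData L α ν T R N hα hν hT hR hc hf).IsMild u) {t : ℝ} (ht : t ∈ Set.Icc 0 T)
    (p : Mode × Fin 3) : energyWeight L α N p.1 * ‖unweight L (u t) p.1 p.2‖ ^ 2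
      ≤ aprioriTerm L α ν T N c f p - 2 * ∫ s in (0 : ℝ)..t, production L α R N (u s) p := by
  obtain ⟨k, i⟩ := p
  by_cases hk : k = 0
  · subst hk
    have h1 : ∀ s, production L α R N (u s) (0, i) = 0 := fun s => by
      simp [production, unweight_zero_mode]
    have h2 : 0 ≤ aprioriTerm L α ν T N c f (0, i) := by
      simp [aprioriTerm, waveSq_zero, hc.zeroMean]
    simpa [h1, unweight_zero_mode] using h2
  have hP := hu.isPrim k i
  have hE := hP.norm_sq hT ht
  rw [hu.unweight_initial] at hE
  set w : ℝ → ℂ := fun s => unweight L (u s) k i with hw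
  set e := energyWeight L α N k with he
  set lam := waveSq L k with hlam
  have hlam0 : 0 < lam := waveSq_pos hk
  have hwc : ContinuousOn w (Set.Icc 0 T) := hu.continuousOn_unweight k i
  have hQc : ContinuousOn (fun s => cutNonlin L α R N (u s) (k, i)) (Set.Icc 0 T) :=
    MildData.continuousOn_Q (D := admData L α ν T R N hα hν hT hR hc hf) hu.continuousOn (k, i)
  have hsub : Set.uIcc 0 t ⊆ Set.Icc 0 T := by
    rw [Set.uIcc_of_le ht.1]; exact Set.Icc_subset_Icc_right ht.2
  have hcw : ContinuousOn (fun s => conj (w s)) (Set.Icc 0 T) :=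
    Complex.continuous_conj.comp_continuousOn hwc
  have hprod : IntervalIntegrable (fun s => production L α R N (u s) (k, i)) volume 0 t := by
    refine ContinuousOn.intervalIntegrable (ContinuousOn.mono ?_ hsub)
    exact continuousOn_const.mul (Complex.continuous_re.comp_continuousOn (hcw.mul hQc))
  have hre : IntervalIntegrable (fun s => 2 * (conj (w s) * (-((ν * lam : ℝ) : ℂ) * w s
      + (filterSymbol L α k * f s k i - cutNonlin L α R N (u s) (k, i)))).re) volume 0 t := by
    have h1 : IntervalIntegrable (fun s => conj (w s) * (-((ν * lam : ℝ) : ℂ) * w s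
      + (filterSymbol L α k * f s k i - cutNonlin L α R N (u s) (k, i)))) volume 0 t :=
      (hP.intervalIntegrable ht).continuousOn_mul (hcw.mono hsub)
    exact IntervalIntegrable.const_mul ⟨h1.1.re, h1.2.re⟩ 2
  have hf2 : IntervalIntegrable (fun s => ‖f s k i‖ ^ 2) volume 0 t :=
    (hf.sq_integrable k i).mono_set (by rwa [Set.uIcc_of_le hT])
  have key : ∀ s ∈ Set.Icc 0 t, e * (2 * (conj (w s) * (-((ν * lam : ℝ) : ℂ) * w s
      + (filterSymbol L α k * f s k i - cutNonlin L α R N (u s) (k, i)))).re)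
      ≤ (N + 1) / (2 * ν) * (lam⁻¹ * ‖f s k i‖ ^ 2)
        - 2 * production L α R N (u s) (k, i) := by
    intro s _
    have e1 : (conj (w s) * (-((ν * lam : ℝ) : ℂ) * w s
        + (filterSymbol L α k * f s k i - cutNonlin L α R N (u s) (k, i)))).re
        = -(ν * lam) * ‖w s‖ ^ 2 + filterSymbol L α k * (conj (w s) * f s k i).re
          - (conj (w s) * cutNonlin L α R N (u s) (k, i)).re := by
      rw [← Complex.normSq_eq_norm_sq, Complex.normSq_apply]
      simp only [Complex.mul_re, Complex.conj_re, Complex.conj_im, Complex.add_re, Complex.add_im,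
        Complex.mul_im, Complex.neg_re, Complex.neg_im, Complex.ofReal_re, Complex.ofReal_im,
        Complex.sub_re, Complex.sub_im]
      ring
    have e2 : (conj (w s) * f s k i).re ≤ ‖w s‖ * ‖f s k i‖ := by
      refine (Complex.re_le_norm _).trans_eq ?_
      rw [norm_mul, RCLike.norm_conj]
    have e3 : production L α R N (u s) (k, i)
        = e * (conj (w s) * cutNonlin L α R N (u s) (k, i)).re := rfl
    have e4 : e * filterSymbol L α k = deconvSymbol L α N k := by
      rw [he, energyWeight, mul_right_comm, denom_mul_filterSymbol, one_mul]
    have hd1 := one_le_deconvSymbol (L := L) (α := α) N k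
    have hd2 := deconvSymbol_le (L := L) (α := α) N k
    have e5 : deconvSymbol L α N k ≤ e :=
      le_mul_of_one_le_left (zero_le_one.trans hd1) (one_le_filter_denom k)
    have e6 : 2 * (‖w s‖ * ‖f s k i‖)
        ≤ 2 * (ν * lam) * ‖w s‖ ^ 2 + (2 * ν)⁻¹ * (lam⁻¹ * ‖f s k i‖ ^ 2) := by
      have h1 := mul_nonneg (show 0 ≤ (2 * ν)⁻¹ * lam⁻¹ by positivity)
        (sq_nonneg (2 * (ν * lam) * ‖w s‖ - ‖f s k i‖))
      have h2 : (2 * ν)⁻¹ * lam⁻¹ * (2 * (ν * lam) * ‖w s‖ - ‖f s k i‖) ^ 2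
          = 2 * (ν * lam) * ‖w s‖ ^ 2 - 2 * (‖w s‖ * ‖f s k i‖)
            + (2 * ν)⁻¹ * (lam⁻¹ * ‖f s k i‖ ^ 2) := by
        field_simp
        ring
      linarith
    have e7 := mul_le_mul_of_nonneg_left e6 (zero_le_one.trans hd1)
    have e8 : deconvSymbol L α N k * (2 * (ν * lam) * ‖w s‖ ^ 2)
        ≤ e * (2 * (ν * lam) * ‖w s‖ ^ 2) := mul_le_mul_of_nonneg_right e5 (by positivity)
    have e9 : deconvSymbol L α N k * ((2 * ν)⁻¹ * (lam⁻¹ * ‖f s k i‖ ^ 2))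
        ≤ (N + 1) / (2 * ν) * (lam⁻¹ * ‖f s k i‖ ^ 2) := by
      rw [div_eq_mul_inv, mul_assoc _ (2 * ν)⁻¹]
      exact mul_le_mul_of_nonneg_right hd2 (by positivity)
    have e10 := mul_le_mul_of_nonneg_left e2 (zero_le_one.trans hd1)
    have e11 : e * (2 * (conj (w s) * (-((ν * lam : ℝ) : ℂ) * w s
        + (filterSymbol L α k * f s k i - cutNonlin L α R N (u s) (k, i)))).re)
        = -(e * (2 * (ν * lam) * ‖w s‖ ^ 2))
          + 2 * (deconvSymbol L α N k * (conj (w s) * f s k i).re)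
          - 2 * production L α R N (u s) (k, i) := by
      rw [e1, e3, ← e4]
      ring
    rw [e11]
    linarith
  have h1 := intervalIntegral.integral_mono_on ht.1 (hre.const_mul e)
    (((hf2.const_mul lam⁻¹).const_mul ((N + 1) / (2 * ν))).sub (hprod.const_mul 2)) key
  have i1 : ∫ s in (0 : ℝ)..t, 2 * production L α R N (u s) (k, i)
      = 2 * ∫ s in (0 : ℝ)..t, production L α R N (u s) (k, i) :=
    intervalIntegral.integral_const_mul _ _
  have i2 : ∫ s in (0 : ℝ)..t, (N + 1) / (2 * ν) * (lam⁻¹ * ‖f s k i‖ ^ 2)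
      = (N + 1) / (2 * ν) * (lam⁻¹ * ∫ s in (0 : ℝ)..t, ‖f s k i‖ ^ 2) := by
    rw [intervalIntegral.integral_const_mul, intervalIntegral.integral_const_mul]
  rw [intervalIntegral.integral_const_mul e, intervalIntegral.integral_sub
    ((hf2.const_mul lam⁻¹).const_mul ((N + 1) / (2 * ν))) (hprod.const_mul 2), i1, i2] at h1
  have h2 : ∫ s in (0 : ℝ)..t, ‖f s k i‖ ^ 2 ≤ ∫ s in (0 : ℝ)..T, ‖f s k i‖ ^ 2 :=
    intervalIntegral.integral_mono_interval le_rfl ht.1 ht.2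
      (Eventually.of_forall fun _ => sq_nonneg _) (hf.sq_integrable k i)
  have h3 := mul_le_mul_of_nonneg_left (mul_le_mul_of_nonneg_left h2 (inv_nonneg.mpr hlam0.le))
    (show 0 ≤ ((N : ℝ) + 1) / (2 * ν) by positivity)
  rw [hE, mul_add, aprioriTerm]
  change e * ‖c k i‖ ^ 2 + e * _ ≤ e * ‖c k i‖ ^ 2 + (N + 1) / (2 * ν) *
    (lam⁻¹ * ∫ s in (0 : ℝ)..T, ‖f s k i‖ ^ 2) - _
  linarith

/-- Summation and time integration commute, because the production is dominated by the `H₂` density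
and the squared nonlinear term, both with summable integrals. At almost every time the solution is
in `H₂`, where the sum over modes is zero. -/
lemma MildData.IsMild.integrable_production
    (hu : (admData L α ν T R N hα hν hT hR hc hf).IsMild u) {t : ℝ} (ht : t ∈ Set.Icc 0 T) :
    HasSum (fun p => ∫ s in (0 : ℝ)..t, production L α R N (u s) p) 0 := by
  have hsub : Set.Icc 0 t ⊆ Set.Icc 0 T := Set.Icc_subset_Icc_right ht.2
  have hcp (p : Mode × Fin 3) :
      ContinuousOn (fun s => production L α R N (u s) p) (Set.Icc 0 T) := by
    have hwc := hu.continuousOn_unweight p.1 p.2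
    have hQc : ContinuousOn (fun s => cutNonlin L α R N (u s) p) (Set.Icc 0 T) :=
      MildData.continuousOn_Q (D := admData L α ν T R N hα hν hT hR hc hf) hu.continuousOn p
    exact continuousOn_const.mul (Complex.continuous_re.comp_continuousOn
      ((Complex.continuous_conj.comp_continuousOn hwc).mul hQc))
  have hcw (p : Mode × Fin 3) : ContinuousOn
      (fun s => (waveSq L p.1 * ‖unweight L (u s) p.1 p.2‖) ^ 2) (Set.Icc 0 T) := by
    have hwc := hu.continuousOn_unweight p.1 p.2
    fun_prop
  have hcQ (p : Mode × Fin 3) : ContinuousOn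
      (fun s => ‖cutNonlin L α R N (u s) p‖ ^ 2) (Set.Icc 0 T) := by
    have hQc : ContinuousOn (fun s => cutNonlin L α R N (u s) p) (Set.Icc 0 T) :=
      MildData.continuousOn_Q (D := admData L α ν T R N hα hν hT hR hc hf) hu.continuousOn p
    fun_prop
  have hint {g : ℝ → ℝ} (hg : ContinuousOn g (Set.Icc 0 T)) :
      Integrable g (volume.restrict (Set.Ioc 0 T)) :=
    (hg.integrableOn_Icc).mono_set Set.Ioc_subset_Icc_self
  have hle : volume.restrict (Set.Ioc 0 t) ≤ volume.restrict (Set.Ioc 0 T) :=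
    Measure.restrict_mono_set _ (Set.Ioc_subset_Ioc_right ht.2)
  have hS1 : Summable fun p : Mode × Fin 3 => ∫ s in Set.Ioc 0 T,
      (waveSq L p.1 * ‖unweight L (u s) p.1 p.2‖) ^ 2 := by
    have := hu.summable_integral
    simpa only [intervalIntegral.integral_of_le hT] using this
  have hun : ContinuousOn (fun s => ‖u s‖ ^ 2) (Set.Icc 0 T) := by
    have h1 : ContinuousOn u (Set.Icc 0 T) := hu.continuousOn
    fun_prop
  have hS2 : Summable fun p : Mode × Fin 3 => ∫ s in Set.Ioc 0 T,
      ‖cutNonlin L α R N (u s) p‖ ^ 2 := by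
    refine Summable.of_nonneg_of_le
      (fun p => integral_nonneg fun _ => sq_nonneg _) (fun p => ?_)
      ((summable_cutLip_sq (L := L) (N := N) hα R).mul_right (∫ s in Set.Ioc 0 T, ‖u s‖ ^ 2))
    rw [← integral_const_mul]
    refine integral_mono (hint (hcQ p)) ((hint hun).const_mul _) fun s => ?_
    have := norm_cutNonlin_sub_le (L := L) (α := α) (N := N) hR (u s) 0 p
    rw [cutNonlin_zero, sub_zero, sub_zero] at this
    dsimp only
    rw [← mul_pow]
    exact pow_le_pow_left₀ (norm_nonneg _) this 2
  have hnorm : Summable fun p => ∫ s in Set.Ioc 0 t, ‖production L α R N (u s) p‖ := by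
    refine Summable.of_nonneg_of_le (fun p => integral_nonneg fun _ => norm_nonneg _)
      (fun p => ?_) ((hS1.add hS2).mul_left (energyConst L α N))
    have h1 : ∫ s in Set.Ioc 0 t, ‖production L α R N (u s) p‖
        ≤ ∫ s in Set.Ioc 0 T, ‖production L α R N (u s) p‖ :=
      integral_mono_measure hle (Eventually.of_forall fun _ => norm_nonneg _)
        (hint (hcp p)).norm
    refine h1.trans ?_
    rw [← integral_add (hint (hcw p)) (hint (hcQ p)), ← integral_const_mul]
    exact integral_mono (hint (hcp p)).norm (((hint (hcw p)).add (hint (hcQ p))).const_mul _)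
      fun s => norm_production_le (u s) p
  have h1 := hasSum_integral_of_summable_integral_norm
    (fun p => ((hint (hcp p)).mono_measure hle)) hnorm
  simp only [intervalIntegral.integral_of_le ht.1]
  convert! h1 using 1
  symm
  refine integral_eq_zero_of_ae ?_
  have h2 := ae_summable_of_summable_integral (fun p s => sq_nonneg _)
    (fun p => hint (hcw p)) hS1
  have h3 : ∀ᵐ s ∂(volume.restrict (Set.Ioc 0 t)), Summable fun p : Mode × Fin 3 =>
      (waveSq L p.1 * ‖unweight L (u s) p.1 p.2‖) ^ 2 := ae_mono hle h2
  filter_upwards [h3, ae_restrict_mem measurableSet_Ioc] with s hs hs'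
  have hsT : s ∈ Set.Icc 0 T := ⟨hs'.1.le, hs'.2.trans ht.2⟩
  exact tsum_production_eq_zero hα hR (hu.isReal hsT) (hu.divFree hsT) hs

/-- The a priori bound of the `H₁` norm, which does not depend on the cutoff radius. -/
lemma MildData.IsMild.norm_sq_le
    (hu : (admData L α ν T R N hα hν hT hR hc hf).IsMild u) {t : ℝ} (ht : t ∈ Set.Icc 0 T) :
    ‖u t‖ ^ 2 ≤ (α ^ 2)⁻¹ * ∑' p, aprioriTerm L α ν T N c f p := by
  have h1 := (summable_aprioriTerm (α := α) (ν := ν) (N := N) hc hf).hasSum.sub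
    ((hu.integrable_production ht).mul_left 2)
  rw [mul_zero, sub_zero] at h1
  refine hasSum_le (fun p => ?_) (hasSum_norm_sq (u t)) (h1.mul_left ((α ^ 2)⁻¹))
  rw [sq_norm_eq_waveSq_mul (L := L) (hu.apply_zero_mode ht)]
  have h2 := mul_le_mul_of_nonneg_right (waveSq_le_energyWeight (L := L) (N := N) hα p.1)
    (sq_nonneg ‖unweight L (u t) p.1 p.2‖)
  have h3 := mul_le_mul_of_nonneg_left (hu.energy_mode_le ht p)
    (show 0 ≤ (α ^ 2)⁻¹ by positivity)
  linarith

end Energy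

/-! ### Existence and uniqueness for the untruncated mode equations. -/

section CoefficientSolution

variable {L α ν T : ℝ} [hL : Fact (0 < L)] {N : ℕ} {c : Coeffs} {f : ℝ → Coeffs}

/-- Solutions of the Leray projected model in terms of Fourier coefficients; `u` is weighted by
the modulus of the wave vector. -/
structure IsCoeffSolution (L α ν T : ℝ) (N : ℕ) (c : Coeffs) (f : ℝ → Coeffs)
    (u : ℝ → XSeq) : Prop where
  continuousOn : ContinuousOn u (Set.Icc 0 T)
  zeroMean : ∀ t ∈ Set.Icc 0 T, ∀ i, u t (0, i) = 0
  initial : ∀ k i, unweight L (u 0) k i = c k i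
  equation : ∀ k i, IsPrim T (fun t => unweight L (u t) k i)
    (fun t => -((ν * waveSq L k : ℝ) : ℂ) * unweight L (u t) k i
      + (filterSymbol L α k * f t k i - leray L (nonlin L α N (unweight L (u t))) k i))

lemma cutNonlin_of_norm_le {R : ℝ} (hR : 0 < R) {a : XSeq} (ha : ‖a‖ ≤ R) (p : Mode × Fin 3) :
    cutNonlin L α R N a p = leray L (nonlin L α N (unweight L a)) p.1 p.2 := by
  rw [cutNonlin, retract_of_le hR ha, nonlin_unweight]

/-- On the ball of radius `R` the retraction is the identity, so a bounded solution does not notice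
the truncation. -/
lemma IsCoeffSolution.isMild {u : ℝ → XSeq} (hα : 0 < α) (hν : 0 < ν) (hT : 0 ≤ T)
    (hc : IsInitial L c) (hf : IsForcing L T f) (hu : IsCoeffSolution L α ν T N c f u) {R : ℝ}
    (hR : 0 < R) (hb : ∀ t ∈ Set.Icc 0 T, ‖u t‖ ≤ R) :
    (admData L α ν T R N hα hν hT hR hc hf).IsMild u := by
  refine isMild_of_isPrim hT hc hf hu.continuousOn hu.zeroMean hu.initial fun k i => ?_
  refine (hu.equation k i).congr_right hT ?_
  filter_upwards [ae_restrict_mem measurableSet_Icc] with s hs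
  rw [cutNonlin_of_norm_le hR (hb s hs)]

/-- Continuous curves on a compact interval are bounded, so one radius suits both solutions and the
uniqueness of the truncated problem applies. -/
theorem IsCoeffSolution.unique {u v : ℝ → XSeq} (hα : 0 < α) (hν : 0 < ν) (hT : 0 ≤ T)
    (hc : IsInitial L c) (hf : IsForcing L T f) (hu : IsCoeffSolution L α ν T N c f u)
    (hv : IsCoeffSolution L α ν T N c f v) {t : ℝ} (ht : t ∈ Set.Icc 0 T) : u t = v t := by
  obtain ⟨A, hA⟩ := isCompact_Icc.exists_bound_of_continuousOn hu.continuousOn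
  obtain ⟨B, hB⟩ := isCompact_Icc.exists_bound_of_continuousOn hv.continuousOn
  have hR : 0 < max 1 (max A B) := lt_max_of_lt_left one_pos
  have h1 := hu.isMild hα hν hT hc hf hR fun t ht =>
    (hA t ht).trans ((le_max_left _ _).trans (le_max_right _ _))
  have h2 := hv.isMild hα hν hT hc hf hR fun t ht =>
    (hB t ht).trans ((le_max_right _ _).trans (le_max_right _ _))
  exact h1.unique h2 ht

theorem exists_coeffSolution (hα : 0 < α) (hν : 0 < ν) (hT : 0 ≤ T) (hc : IsInitial L c)
    (hf : IsForcing L T f) : ∃ u : ℝ → XSeq, Continuous u ∧ IsCoeffSolution L α ν T N c f u ∧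
      (∀ t ∈ Set.Icc 0 T, ∀ k i, unweight L (u t) (-k) i = conj (unweight L (u t) k i)) ∧
      (∀ t ∈ Set.Icc 0 T, ∀ k, ∑ i, (wave L k i : ℂ) * unweight L (u t) k i = 0) ∧
      Summable fun p : Mode × Fin 3 =>
        ∫ s in (0 : ℝ)..T, (waveSq L p.1 * ‖unweight L (u s) p.1 p.2‖) ^ 2 := by
  -- The a priori bound does not depend on `R`, so the choice is not circular; adding `1` makes the
  -- radius positive.
  set R := √((α ^ 2)⁻¹ * ∑' p, aprioriTerm L α ν T N c f p) + 1 with hRdef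
  have hR : 0 < R := by positivity
  obtain ⟨u, huc, hu⟩ := (admData L α ν T R N hα hν hT hR hc hf).exists_isMild
  have hb : ∀ t ∈ Set.Icc 0 T, ‖u t‖ ≤ R := fun t ht =>
    (Real.le_sqrt_of_sq_le (hu.norm_sq_le ht)).trans (by linarith)
  refine ⟨u, huc, ⟨hu.continuousOn, fun t ht => hu.apply_zero_mode ht, hu.unweight_initial,
    fun k i => (hu.isPrim k i).congr_right hT ?_⟩, fun t ht => hu.isReal ht,
    fun t ht => hu.divFree ht, hu.summable_integral⟩
  filter_upwards [ae_restrict_mem measurableSet_Icc] with s hs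
  rw [cutNonlin_of_norm_le hR (hb s hs)]

end CoefficientSolution

/-! ### Sobolev and Bochner norms as series of Fourier coefficients. -/

section SobolevNorms

lemma summable_iff_tsum_ofReal_lt_top {ι : Type*} {h : ι → ℝ} (h0 : ∀ p, 0 ≤ h p) :
    Summable h ↔ ∑' p, ENNReal.ofReal (h p) < ⊤ := by
  refine ⟨fun hs => hs.tsum_ofReal_lt_top, fun hs => ?_⟩
  refine (ENNReal.summable_toReal hs.ne).congr fun p => ?_
  rw [ENNReal.toReal_ofReal (h0 p)]

/-- Tonelli, in the form that translates between extended norms and real summable series. -/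
lemma lintegral_tsum_ofReal_lt_top_iff {ι X : Type*} [Countable ι] [MeasurableSpace X]
    {μ : Measure X} {h : ι → X → ℝ} (h0 : ∀ p x, 0 ≤ h p x) (hm : ∀ p, AEMeasurable (h p) μ) :
    (∫⁻ x, ∑' p, ENNReal.ofReal (h p x) ∂μ) < ⊤ ↔
      (∀ p, Integrable (h p) μ) ∧ Summable fun p => ∫ x, h p x ∂μ := by
  rw [lintegral_tsum fun p => (hm p).ennreal_ofReal]
  have key (p : ι) (hp : Integrable (h p) μ) :
      ENNReal.ofReal (∫ x, h p x ∂μ) = ∫⁻ x, ENNReal.ofReal (h p x) ∂μ :=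
    ofReal_integral_eq_lintegral_ofReal hp (Eventually.of_forall (h0 p))
  constructor
  · intro hs
    have hi (p : ι) : Integrable (h p) μ := by
      refine ⟨(hm p).aestronglyMeasurable, ?_⟩
      rw [hasFiniteIntegral_iff_ofReal (Eventually.of_forall (h0 p))]
      exact (ENNReal.le_tsum p).trans_lt hs
    refine ⟨hi, (summable_iff_tsum_ofReal_lt_top fun p => integral_nonneg (h0 p)).mpr ?_⟩
    simpa only [key _ (hi _)] using hs
  · rintro ⟨hi, hs⟩
    have := (summable_iff_tsum_ofReal_lt_top fun p => integral_nonneg (h0 p)).mp hs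
    simpa only [key _ (hi _)] using this

variable {L : ℝ}

lemma hNormSq_eq_tsum (s : ℝ) (c : Coeffs) : hNormSq L s c
    = ∑' p : Mode × Fin 3, ENNReal.ofReal (waveSq L p.1 ^ s * ‖c p.1 p.2‖ ^ 2) := by
  rw [ENNReal.tsum_prod', hNormSq]
  refine tsum_congr fun k => ?_
  rw [tsum_fintype, Finset.mul_sum, ENNReal.ofReal_sum_of_nonneg]
  intro i _
  exact mul_nonneg (Real.rpow_nonneg (waveSq_nonneg k) s) (sq_nonneg _)

lemma sobolev_term_nonneg (s : ℝ) (c : Coeffs) (p : Mode × Fin 3) :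
    0 ≤ waveSq L p.1 ^ s * ‖c p.1 p.2‖ ^ 2 :=
  mul_nonneg (Real.rpow_nonneg (waveSq_nonneg _) s) (sq_nonneg _)

lemma hNormSq_lt_top_iff (s : ℝ) (c : Coeffs) : hNormSq L s c < ⊤ ↔
    Summable fun p : Mode × Fin 3 => waveSq L p.1 ^ s * ‖c p.1 p.2‖ ^ 2 := by
  rw [hNormSq_eq_tsum, summable_iff_tsum_ofReal_lt_top (sobolev_term_nonneg s c)]

lemma lintegral_hNormSq_lt_top_iff {μ : Measure ℝ} (s : ℝ) {c : ℝ → Coeffs}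
    (hm : ∀ k i, AEMeasurable (fun t => c t k i) μ) :
    (∫⁻ t, hNormSq L s (c t) ∂μ) < ⊤ ↔
      (∀ p : Mode × Fin 3, Integrable (fun t => waveSq L p.1 ^ s * ‖c t p.1 p.2‖ ^ 2) μ) ∧
      Summable fun p : Mode × Fin 3 => waveSq L p.1 ^ s * ∫ t, ‖c t p.1 p.2‖ ^ 2 ∂μ := by
  simp only [hNormSq_eq_tsum]
  rw [lintegral_tsum_ofReal_lt_top_iff (fun p t => sobolev_term_nonneg s (c t) p)
    (fun p => ((hm p.1 p.2).norm.pow_const 2).const_mul _)]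
  simp only [integral_const_mul]

variable [hL : Fact (0 < L)]

lemma lintegral_h1NormSq_lt_top_iff {μ : Measure ℝ} {q : ℝ → L2 L}
    (hm : AEStronglyMeasurable q μ) :
    (∫⁻ t, h1NormSq (q t) ∂μ) < ⊤ ↔
      (∀ k : Mode, Integrable (fun t => (1 + waveSq L k) * ‖fc (⇑(q t)) k‖ ^ 2) μ) ∧
      Summable fun k : Mode => (1 + waveSq L k) * ∫ t, ‖fc (⇑(q t)) k‖ ^ 2 ∂μ := by
  have h0 (k : Mode) : 0 ≤ 1 + waveSq L k := add_nonneg zero_le_one (waveSq_nonneg k)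
  simp only [h1NormSq]
  rw [lintegral_tsum_ofReal_lt_top_iff (fun k t => mul_nonneg (h0 k) (sq_nonneg _))
    (fun k => ((aemeasurable_fc hm k).norm.pow_const 2).const_mul _)]
  simp only [integral_const_mul]

/-- Square integrability in time of an `L²`-valued function, in terms of Fourier coefficients. -/
lemma memLp_two_iff_fc {μ : Measure ℝ} {u : ℝ → L2 L}
    (hm : ∀ k, AEMeasurable (fun t => fc (⇑(u t)) k) μ) : MemLp u 2 μ ↔
      (∀ k, Integrable (fun t => ‖fc (⇑(u t)) k‖ ^ 2) μ) ∧
      Summable fun k => ∫ t, ‖fc (⇑(u t)) k‖ ^ 2 ∂μ := by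
  have hLp := hL.out
  have hu := aestronglyMeasurable_of_fc hm
  have h3 : (L ^ 3) ≠ 0 := by positivity
  have hs (t : ℝ) : ‖u t‖ ^ 2 = L ^ 3 * ∑' k, ‖fc (⇑(u t)) k‖ ^ 2 := by
    rw [← (hasSum_fc_norm_sq (u t)).tsum_eq, tsum_mul_left]
  rw [memLp_two_iff_integrable_sq_norm hu,
    ← lintegral_tsum_ofReal_lt_top_iff (fun k t => sq_nonneg _) (fun k => (hm k).norm.pow_const 2)]
  simp only [hs]
  rw [integrable_const_mul_iff (Ne.isUnit h3)]
  have hm2 : AEStronglyMeasurable (fun t => ∑' k, ‖fc (⇑(u t)) k‖ ^ 2) μ := by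
    have := (hu.norm.pow 2).const_mul (L ^ 3)⁻¹
    refine this.congr (Eventually.of_forall fun t => ?_)
    change (L ^ 3)⁻¹ * ‖u t‖ ^ 2 = _
    rw [hs, inv_mul_cancel_left₀ h3]
  have h0 (t : ℝ) : 0 ≤ ∑' k, ‖fc (⇑(u t)) k‖ ^ 2 := tsum_nonneg fun k => sq_nonneg _
  have he (t : ℝ) : ENNReal.ofReal (∑' k, ‖fc (⇑(u t)) k‖ ^ 2)
      = ∑' k, ENNReal.ofReal (‖fc (⇑(u t)) k‖ ^ 2) :=
    ENNReal.ofReal_tsum_of_nonneg (fun k => sq_nonneg _) (summable_fc_norm_sq (u t))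
  rw [Integrable, and_iff_right hm2, hasFiniteIntegral_iff_ofReal (Eventually.of_forall h0)]
  simp only [he]

lemma memLp_two_of_fc_le {μ : Measure ℝ} {u : ℝ → L2 L}
    (hm : ∀ k, AEMeasurable (fun t => fc (⇑(u t)) k) μ) {g : Mode → ℝ → ℝ}
    (hg : ∀ k, Integrable (g k) μ) (hs : Summable fun k => ∫ t, g k t ∂μ)
    (hle : ∀ k, ∀ᵐ t ∂μ, ‖fc (⇑(u t)) k‖ ^ 2 ≤ g k t) : MemLp u 2 μ := by
  have hi (k : Mode) : Integrable (fun t => ‖fc (⇑(u t)) k‖ ^ 2) μ := by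
    refine (hg k).mono' ((hm k).norm.pow_const 2).aestronglyMeasurable ?_
    filter_upwards [hle k] with t ht
    rwa [Real.norm_of_nonneg (sq_nonneg _)]
  refine (memLp_two_iff_fc hm).mpr ⟨hi, ?_⟩
  exact Summable.of_nonneg_of_le (fun k => integral_nonneg fun t => sq_nonneg _)
    (fun k => integral_mono_ae (hi k) (hg k) (hle k)) hs

end SobolevNorms

/-! ### The data of the theorem in coefficient form. -/

section Data

variable {L α T : ℝ} [hL : Fact (0 < L)]

lemma isForcing_of_memL2HDist (hT : 0 ≤ T) {f : ℝ → Coeffs} (hf : MemL2HDist L T (-1) f) :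
    IsForcing L T f := by
  have h1 := (lintegral_hNormSq_lt_top_iff (-1) hf.measurable).mp hf.finite
  have h2 : ∀ k i, Integrable (fun t => ‖f t k i‖ ^ 2) (volume.restrict (Set.Icc 0 T)) := by
    intro k i
    -- The `H₋₁` weight of mode zero is `0` by convention and gives no information there, so the
    -- zero mean is used instead.
    by_cases hk : k = 0
    · subst hk
      refine (integrable_zero ℝ ℝ _).congr ?_
      filter_upwards [hf.mem] with t ht
      rw [ht.zeroMean]; simp
    · have h3 := h1.1 (k, i)
      have h4 : waveSq L k ^ (-1 : ℝ) ≠ 0 := (Real.rpow_pos_of_pos (waveSq_pos hk) _).ne'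
      exact (integrable_const_mul_iff (Ne.isUnit h4) _).mp h3
  have h3 : ∀ k i, Integrable (fun t => f t k i) (volume.restrict (Set.Icc 0 T)) := by
    intro k i
    have := (memLp_two_iff_integrable_sq_norm
      (hf.measurable k i).aestronglyMeasurable).mpr (h2 k i)
    exact this.integrable one_le_two
  refine ⟨fun k i => ?_, fun k i => ?_, ?_, ?_, ?_, ?_⟩
  · exact (intervalIntegrable_iff_integrableOn_Icc_of_le hT).mpr (h3 k i)
  · exact (intervalIntegrable_iff_integrableOn_Icc_of_le hT).mpr (h2 k i)
  · simpa only [intervalIntegral.integral_of_le hT, ← integral_Icc_eq_integral_Ioc,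
      Real.rpow_neg_one] using h1.2
  · filter_upwards [hf.mem] with t ht using ht.isReal
  · filter_upwards [hf.mem] with t ht using ht.divFree
  · filter_upwards [hf.mem] with t ht using ht.zeroMean

/-- The Fourier coefficients of the filtered initial velocity. -/
def initialCoeffs (α : ℝ) (u₀ : VField L) : Coeffs := coeffs fun i => filter α ⇑(u₀ i)

lemma isInitial_initialCoeffs (hα : 0 < α) {u₀ : VField L} (h : MemH L 0 (coeffs u₀)) :
    IsInitial L (initialCoeffs α u₀) := by
  have e (k : Mode) (i : Fin 3) :
      initialCoeffs α u₀ k i = filterSymbol L α k * coeffs u₀ k i := fc_filter hα _ _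
  refine ⟨?_, fun k i => ?_, fun k => ?_, fun i => ?_⟩
  · have h1 := (hNormSq_lt_top_iff 0 _).mp h.finite
    simp only [Real.rpow_zero, one_mul] at h1
    refine Summable.of_nonneg_of_le (fun p => mul_nonneg (waveSq_nonneg _) (sq_nonneg _))
      (fun p => ?_) (h1.mul_left (α ^ 2)⁻¹)
    rw [e, norm_mul, mul_pow, Complex.norm_real, Real.norm_eq_abs, sq_abs, ← mul_assoc]
    refine mul_le_mul_of_nonneg_right ?_ (sq_nonneg _)
    by_cases hp : p.1 = 0
    · rw [hp, waveSq_zero, zero_mul]; positivity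
    · have h2 := mul_le_mul_of_nonneg_left (filterSymbol_sq_le (L := L) hα hp)
        (waveSq_nonneg (L := L) p.1)
      refine h2.trans_eq ?_
      rw [mul_left_comm, mul_inv_cancel₀ (waveSq_pos hp).ne', mul_one]
  · exact fc_neg_mode _ _
  · simp only [e, mul_left_comm]
    rw [← Finset.mul_sum, h.divFree, mul_zero]
  · rw [e, h.zeroMean, mul_zero]

end Data

/-! ### Spatial integrals, integration by parts, and the flux. -/

section Spatial

variable {L α : ℝ} [hL : Fact (0 < L)] {N : ℕ}

lemma integral_sum_mul {ι : Type*} [Fintype ι] (a b : ι → L2 L) :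
    ∫ x : Torus L, ∑ i, a i x * b i x = ∑ i, inner ℝ (a i) (b i) := by
  have h (i : ι) : Integrable (fun x => a i x * b i x) (volume : Measure (Torus L)) :=
    (Lp.memLp (a i)).integrable_mul (Lp.memLp (b i))
  rw [integral_finsetSum _ fun i _ => h i]
  refine Finset.sum_congr rfl fun i _ => ?_
  rw [MeasureTheory.L2.inner_def]
  refine integral_congr_ae (Eventually.of_forall fun x => ?_)
  simp [mul_comm]

lemma integral_sum_sum_mul {ι κ : Type*} [Fintype ι] [Fintype κ] (a b : ι → κ → L2 L) :
    ∫ x : Torus L, ∑ i, ∑ j, a i j x * b i j x = ∑ i, ∑ j, inner ℝ (a i j) (b i j) := by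
  have := integral_sum_mul (fun p : ι × κ => a p.1 p.2) (fun p : ι × κ => b p.1 p.2)
  simpa only [Fintype.sum_prod_type] using this

/-- The Fourier coefficients of the divergence. -/
def dvgCoeff (G : Fin 3 → L2 L) (k : Mode) : ℂ := ∑ j, Complex.I * (wave L k j : ℂ) * fc (⇑(G j)) k

/-- The divergence of a field (zero if it is not square integrable). -/
def dvg (G : Fin 3 → L2 L) : L2 L := ofCoeff (dvgCoeff G)

lemma dvgCoeff_neg_mode (G : Fin 3 → L2 L) (k : Mode) :
    dvgCoeff G (-k) = conj (dvgCoeff G k) := by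
  rw [dvgCoeff, dvgCoeff, map_sum]
  refine Finset.sum_congr rfl fun j _ => ?_
  rw [wave_neg, fc_neg_mode, map_mul, map_mul, Complex.conj_I, Complex.conj_ofReal]
  push_cast; ring

lemma fc_dvg {G : Fin 3 → L2 L} (hG : Summable fun k => ‖dvgCoeff G k‖ ^ 2) (k : Mode) :
    fc (⇑(dvg G)) k = dvgCoeff G k :=
  fc_ofCoeff hG (dvgCoeff_neg_mode G) k

/-- Integration by parts through Parseval. Only the divergence of `G` must be square integrable, not
its individual derivatives. -/
lemma sum_inner_pd {G : Fin 3 → L2 L} {v : L2 L} (hG : Summable fun k => ‖dvgCoeff G k‖ ^ 2)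
    (hv : Summable fun k => waveSq L k * ‖fc (⇑v) k‖ ^ 2) :
    ∑ j, inner ℝ (G j) (pd j v) = -inner ℝ (dvg G) v := by
  have h1 := hasSum_sum (s := Finset.univ) fun j _ => hasSum_fc_inner (G j) (pd j v)
  have h2 := (hasSum_fc_inner (dvg G) v).neg
  refine h1.unique (h2.congr_fun fun k => ?_)
  rw [← Finset.mul_sum, ← mul_neg, fc_dvg hG, dvgCoeff, map_sum, Finset.sum_mul, ← Complex.re_sum,
    ← Complex.neg_re, ← Finset.sum_neg_distrib]
  congr 2
  refine Finset.sum_congr rfl fun j _ => ?_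
  rw [fc_pd hv, map_mul, map_mul, Complex.conj_I, Complex.conj_ofReal]
  ring

lemma norm_deconv_le (hα : 0 < α) (u : L2 L) : ‖deconv α N u‖ ^ 2 ≤ (N + 1) ^ 2 * ‖u‖ ^ 2 := by
  have hLp := hL.out
  refine hasSum_le (fun k => ?_) (hasSum_fc_norm_sq _) ((hasSum_fc_norm_sq u).mul_left _)
  rw [fc_deconv hα, norm_mul, mul_pow, Complex.norm_real, Real.norm_eq_abs, sq_abs, mul_left_comm]
  have h1 := one_le_deconvSymbol (L := L) (α := α) N k
  have h2 := pow_le_pow_left₀ (by linarith) (deconvSymbol_le (L := L) (α := α) N k) 2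
  exact mul_le_mul_of_nonneg_right h2 (by positivity)

lemma norm_fc_mul_le (u v : L2 L) (k : Mode) :
    ‖fc (fun x => u x * v x) k‖ ≤ (L ^ 3)⁻¹ * (‖u‖ * ‖v‖) := by
  have hLp := hL.out
  have hs (w : L2 L) : ∑' l, ‖fc (⇑w) l‖ ^ 2 = (L ^ 3)⁻¹ * ‖w‖ ^ 2 := by
    rw [← (hasSum_fc_norm_sq w).tsum_eq, tsum_mul_left, inv_mul_cancel_left₀ (by positivity)]
  have hinj : Function.Injective fun l : Mode => k - l := sub_right_injective
  have hu := summable_fc_norm_sq u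
  have hv : Summable fun l => ‖fc (⇑v) (k - l)‖ ^ 2 :=
    (summable_fc_norm_sq v).comp_injective hinj
  have hprod := summable_mul_of_sq hu hv
  rw [← (hasSum_fc_mul u v k).tsum_eq]
  have h1 : ‖∑' l, fc (⇑u) l * fc (⇑v) (k - l)‖ ≤ ∑' l, ‖fc (⇑u) l‖ * ‖fc (⇑v) (k - l)‖ := by
    simp only [← norm_mul] at hprod ⊢
    exact norm_tsum_le_tsum_norm hprod
  refine h1.trans ?_
  have h2 := tsum_mul_sq_le hu hv (fun _ => norm_nonneg _) (fun _ => norm_nonneg _)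
    (A := √(L ^ 3)⁻¹ * ‖u‖) (B := √(L ^ 3)⁻¹ * ‖v‖) (by positivity) (by positivity)
    (by rw [mul_pow, Real.sq_sqrt (by positivity), hs])
    (by
      rw [mul_pow, Real.sq_sqrt (by positivity), ← hs]
      exact tsum_comp_le_tsum_of_inj (summable_fc_norm_sq v) (fun _ => sq_nonneg _) hinj)
  refine h2.trans_eq ?_
  rw [mul_mul_mul_comm, Real.mul_self_sqrt (by positivity)]

/-- The components of the filtered convective flux. -/
def flux (α : ℝ) (N : ℕ) (w : VField L) (i j : Fin 3) : L2 L :=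
  filter α fun y => deconv α N (w i) y * deconv α N (w j) y

lemma fc_flux (hα : 0 < α) (w : VField L) (i j : Fin 3) (k : Mode) :
    fc (⇑(flux α N w i j)) k = (filterSymbol L α k : ℂ) * ∑' l,
      (deconvSymbol L α N l * coeffs w l i)
        * (deconvSymbol L α N (k - l) * coeffs w (k - l) j) := by
  rw [flux, fc_filter hα, ← (hasSum_fc_mul _ _ k).tsum_eq]
  simp only [fc_deconv hα]
  rfl

/-- Links the operators of the statement with the coefficient nonlinearity for which the equation
was solved. -/
lemma dvgCoeff_flux (hα : 0 < α) (w : VField L) (i : Fin 3) (k : Mode) :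
    dvgCoeff (flux α N w i) k = nonlin L α N (coeffs w) k i := by
  refine Finset.sum_congr rfl fun j _ => ?_
  rw [fc_flux hα]
  ring

lemma norm_fc_flux_le (hα : 0 < α) (w : VField L) (i j : Fin 3) (k : Mode) :
    ‖fc (⇑(flux α N w i j)) k‖
      ≤ filterSymbol L α k * ((L ^ 3)⁻¹ * ((N + 1) ^ 2 * (‖w i‖ * ‖w j‖))) := by
  have hLp := hL.out
  rw [flux, fc_filter hα, norm_mul, Complex.norm_real, Real.norm_of_nonneg (filterSymbol_pos k).le]
  refine mul_le_mul_of_nonneg_left ((norm_fc_mul_le _ _ k).trans ?_) (filterSymbol_pos k).le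
  refine mul_le_mul_of_nonneg_left ?_ (by positivity)
  have h (u : L2 L) : ‖deconv α N u‖ ≤ (N + 1) * ‖u‖ := by
    refine le_of_sq_le_sq ?_ (by positivity)
    rw [mul_pow]
    exact norm_deconv_le hα u
  calc _ ≤ ((N + 1) * ‖w i‖) * ((N + 1) * ‖w j‖) :=
        mul_le_mul (h _) (h _) (norm_nonneg _) (by positivity)
    _ = _ := by ring

end Spatial

/-! ### Isometry between `H₁` and weighted square summable families. -/

section Weighted

variable {L : ℝ}

open Classical in
/-- The Fourier coefficients weighted by the modulus of the wave vector, for elements of `H₁`. -/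
def weight (L : ℝ) (c : Coeffs) : XSeq :=
  if h : Memℓp (fun p : Mode × Fin 3 => (waveAbs L p.1 : ℂ) * c p.1 p.2) 2 then ⟨_, h⟩ else 0

lemma norm_sq_waveAbs_mul (k : Mode) (z : ℂ) :
    ‖(waveAbs L k : ℂ) * z‖ ^ 2 = waveSq L k * ‖z‖ ^ 2 := by
  rw [norm_mul, mul_pow, Complex.norm_real, Real.norm_eq_abs, sq_abs, waveAbs_sq]

lemma weight_apply {c : Coeffs}
    (hc : Summable fun p : Mode × Fin 3 => waveSq L p.1 * ‖c p.1 p.2‖ ^ 2)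
    (p : Mode × Fin 3) : weight L c p = waveAbs L p.1 * c p.1 p.2 := by
  have h : Memℓp (fun p : Mode × Fin 3 => (waveAbs L p.1 : ℂ) * c p.1 p.2) 2 :=
    memℓp_two (hc.congr fun p => (norm_sq_waveAbs_mul _ _).symm)
  rw [weight, dif_pos h]

variable [hL : Fact (0 < L)]

lemma unweight_weight {c : Coeffs}
    (hc : Summable fun p : Mode × Fin 3 => waveSq L p.1 * ‖c p.1 p.2‖ ^ 2) (h0 : ∀ i, c 0 i = 0) :
    unweight L (weight L c) = c := by
  ext k i
  rw [unweight, weight_apply hc]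
  by_cases hk : k = 0
  · simp [hk, h0]
  · have : (waveAbs L k : ℂ) ≠ 0 := by exact_mod_cast (waveAbs_pos hk).ne'
    rw [mul_div_cancel_left₀ _ this]

lemma MemH.summable_one {c : Coeffs} (h : MemH L 1 c) :
    Summable fun p : Mode × Fin 3 => waveSq L p.1 * ‖c p.1 p.2‖ ^ 2 := by
  simpa only [Real.rpow_one] using (hNormSq_lt_top_iff 1 c).mp h.finite

/-- Weighting is an isometry, so continuity in `H₁` is continuity of the weighted curve in ℓ². -/
lemma hNormSq_one_sub {c d : Coeffs}
    (hc : Summable fun p : Mode × Fin 3 => waveSq L p.1 * ‖c p.1 p.2‖ ^ 2)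
    (hd : Summable fun p : Mode × Fin 3 => waveSq L p.1 * ‖d p.1 p.2‖ ^ 2) :
    hNormSq L 1 (fun k i => c k i - d k i) = ENNReal.ofReal (‖weight L c - weight L d‖ ^ 2) := by
  rw [hNormSq_eq_tsum, ← (hasSum_norm_sq _).tsum_eq,
    ENNReal.ofReal_tsum_of_nonneg (fun _ => sq_nonneg _) (hasSum_norm_sq _).summable]
  refine tsum_congr fun p => ?_
  rw [lp.coeFn_sub, Pi.sub_apply, weight_apply hc, weight_apply hd, ← mul_sub,
    norm_sq_waveAbs_mul, Real.rpow_one]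

lemma coeffs_sub (u v : VField L) : coeffs (u - v) = fun k i => coeffs u k i - coeffs v k i := by
  ext k i
  exact fc_sub _ _ _

lemma norm_sq_le_weight {w : VField L} (hw : MemH L 1 (coeffs w)) (i : Fin 3) :
    ‖w i‖ ^ 2 ≤ L ^ 3 * poincare L * ‖weight L (coeffs w)‖ ^ 2 := by
  have hLp := hL.out
  have h1 := hasSum_norm_sq (weight L (coeffs w))
  have h2 := Summable.fiber h1.summable i
  have h3 : ∑' k, ‖weight L (coeffs w) (k, i)‖ ^ 2 ≤ ‖weight L (coeffs w)‖ ^ 2 := by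
    rw [← h1.tsum_eq]
    exact tsum_comp_le_tsum_of_inj (i := fun k => (k, i)) h1.summable (fun _ => sq_nonneg _)
      fun _ _ h => (Prod.mk.inj h).1
  have h4 : ‖w i‖ ^ 2 ≤ L ^ 3 * poincare L * ∑' k, ‖weight L (coeffs w) (k, i)‖ ^ 2 := by
    refine hasSum_le (fun k => ?_) (hasSum_fc_norm_sq (w i)) (h2.hasSum.mul_left _)
    rw [weight_apply hw.summable_one, norm_sq_waveAbs_mul]
    by_cases hk : k = 0
    · have := hw.zeroMean i
      rw [coeffs] at this
      subst hk
      rw [this, waveSq_zero]; simp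
    · have := mul_le_mul_of_nonneg_right (one_le_poincare_mul (L := L) hk)
        (show 0 ≤ L ^ 3 * ‖fc (⇑(w i)) k‖ ^ 2 by positivity)
      change _ ≤ L ^ 3 * poincare L * (waveSq L k * ‖fc (⇑(w i)) k‖ ^ 2)
      linarith
  refine h4.trans (mul_le_mul_of_nonneg_left h3 ?_)
  have := poincare_nonneg (L := L)
  positivity

end Weighted

/-! ### Square integrability in time of all terms of the equation. -/

section TimeRegularity

variable {L α ν T : ℝ} [hL : Fact (0 < L)] {N : ℕ}

lemma integrable_inner_of_memLp {X E : Type*} [MeasurableSpace X] [NormedAddCommGroup E]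
    [InnerProductSpace ℝ E] {μ : Measure X} {A B : X → E} (hA : MemLp A 2 μ) (hB : MemLp B 2 μ) :
    Integrable (fun t => inner ℝ (A t) (B t)) μ := by
  refine ((hA.integrable_norm_pow two_ne_zero).add (hB.integrable_norm_pow two_ne_zero)).mono'
    (hA.1.inner hB.1) (Eventually.of_forall fun t => ?_)
  have h1 := norm_inner_le_norm (𝕜 := ℝ) (A t) (B t)
  change _ ≤ ‖A t‖ ^ 2 + ‖B t‖ ^ 2
  nlinarith [sq_nonneg (‖A t‖ - ‖B t‖), sq_nonneg (‖A t‖), sq_nonneg (‖B t‖)]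

/-- A Fourier multiplier dominated by the Sobolev weight `W` lands in `L²(0,T; L²)`. Gradients, the
Laplacian and the filtered forcing are all treated this way. -/
lemma memLp_two_of_symbol {μ : Measure ℝ} {U : ℝ → L2 L} {g : Mode → ℝ → ℂ} (m : Mode → ℂ)
    {W : Mode → ℝ} (hg : ∀ k, AEMeasurable (g k) μ)
    (hU : ∀ k, ∀ᵐ t ∂μ, fc (⇑(U t)) k = m k * g k t)
    (hi : ∀ k, Integrable (fun t => W k * ‖g k t‖ ^ 2) μ)
    (hs : Summable fun k => W k * ∫ t, ‖g k t‖ ^ 2 ∂μ) (C : ℝ)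
    (hm : ∀ k, ‖m k‖ ^ 2 ≤ C * W k) : MemLp U 2 μ := by
  refine memLp_two_of_fc_le (g := fun k t => C * (W k * ‖g k t‖ ^ 2)) (fun k => ?_)
    (fun k => (hi k).const_mul C) ?_ fun k => ?_
  · exact ((hg k).const_mul (m k)).congr ((hU k).mono fun t ht => ht.symm)
  · simpa only [integral_const_mul] using hs.mul_left C
  · filter_upwards [hU k] with t ht
    rw [ht, norm_mul, mul_pow, ← mul_assoc]
    exact mul_le_mul_of_nonneg_right (hm k) (sq_nonneg _)

lemma norm_I_wave_sq_le (k : Mode) (j : Fin 3) :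
    ‖Complex.I * (wave L k j : ℂ)‖ ^ 2 ≤ waveSq L k := by
  rw [norm_mul, Complex.norm_I, one_mul, Complex.norm_real, Real.norm_eq_abs, sq_abs]
  exact wave_sq_le k j

lemma waveSq_le_sq (k : Mode) : waveSq L k ≤ poincare L * waveSq L k ^ 2 := by
  by_cases hk : k = 0
  · rw [hk, waveSq_zero]; simp
  · have := mul_le_mul_of_nonneg_right (one_le_poincare_mul (L := L) hk) (waveSq_nonneg (L := L) k)
    linarith

lemma summable_waveSq_of_h1 {v : L2 L} (hv : h1NormSq v < ⊤) :
    Summable fun k => waveSq L k * ‖fc (⇑v) k‖ ^ 2 := by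
  have h := (summable_iff_tsum_ofReal_lt_top fun k => mul_nonneg
    (add_nonneg zero_le_one (waveSq_nonneg k)) (sq_nonneg _)).mpr hv
  refine Summable.of_nonneg_of_le (fun k => mul_nonneg (waveSq_nonneg _) (sq_nonneg _))
    (fun k => ?_) h
  exact mul_le_mul_of_nonneg_right (by linarith) (sq_nonneg _)

lemma MemL2H1.ae_h1 {q : ℝ → L2 L} (hq : MemL2H1 T q) :
    ∀ᵐ t ∂(volume.restrict (Set.Icc 0 T)), Summable fun k => waveSq L k * ‖fc (⇑(q t)) k‖ ^ 2 := by
  have h1 : AEMeasurable (fun t => h1NormSq (q t)) (volume.restrict (Set.Icc 0 T)) :=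
    AEMeasurable.tsum fun k =>
      (((aemeasurable_fc hq.measurable k).norm.pow_const 2).const_mul _).ennreal_ofReal
  filter_upwards [ae_lt_top' h1 hq.finite.ne] with t ht using summable_waveSq_of_h1 ht

lemma MemL2H1.memLp {q : ℝ → L2 L} (hq : MemL2H1 T q) :
    MemLp q 2 (volume.restrict (Set.Icc 0 T)) := by
  have h := (lintegral_h1NormSq_lt_top_iff hq.measurable).mp hq.finite
  refine memLp_two_of_symbol (fun _ => 1) (aemeasurable_fc hq.measurable)
    (fun k => Eventually.of_forall fun t => (one_mul _).symm) h.1 h.2 1 fun k => ?_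
  have := waveSq_nonneg (L := L) k
  rw [norm_one]; linarith

lemma MemL2H1.memLp_pd {q : ℝ → L2 L} (hq : MemL2H1 T q) (j : Fin 3) :
    MemLp (fun t => pd j (q t)) 2 (volume.restrict (Set.Icc 0 T)) := by
  have h := (lintegral_h1NormSq_lt_top_iff hq.measurable).mp hq.finite
  refine memLp_two_of_symbol (fun k => Complex.I * (wave L k j : ℂ)) (aemeasurable_fc hq.measurable)
    (fun k => ?_) h.1 h.2 1 fun k => ?_
  · filter_upwards [hq.ae_h1] with t ht using fc_pd ht j k
  · have := norm_I_wave_sq_le (L := L) k j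
    linarith

lemma MemL2H.aestronglyMeasurable_apply {s : ℝ} {w : ℝ → VField L} (hw : MemL2H T s w) (i : Fin 3) :
    AEStronglyMeasurable (fun t => w t i) (volume.restrict (Set.Icc 0 T)) :=
  (continuous_apply i).comp_aestronglyMeasurable hw.measurable

lemma MemL2H.integrable_summable {s : ℝ} {w : ℝ → VField L} (hw : MemL2H T s w) (i : Fin 3) :
    (∀ k, Integrable (fun t => waveSq L k ^ s * ‖fc (⇑(w t i)) k‖ ^ 2)
      (volume.restrict (Set.Icc 0 T))) ∧
    Summable fun k => waveSq L k ^ s * ∫ t in Set.Icc 0 T, ‖fc (⇑(w t i)) k‖ ^ 2 := by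
  have h := (lintegral_hNormSq_lt_top_iff s (c := fun t => coeffs (w t))
    fun k i => aemeasurable_fc (hw.aestronglyMeasurable_apply i) k).mp hw.finite
  exact ⟨fun k => h.1 (k, i), Summable.fiber h.2 i⟩

lemma MemL2H.memLp {w : ℝ → VField L} (hw : MemL2H T 0 w) (i : Fin 3) :
    MemLp (fun t => w t i) 2 (volume.restrict (Set.Icc 0 T)) := by
  have h := hw.integrable_summable i
  refine memLp_two_of_symbol (fun _ => 1) (aemeasurable_fc (hw.aestronglyMeasurable_apply i))
    (fun k => Eventually.of_forall fun t => (one_mul _).symm) h.1 h.2 1 fun k => ?_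
  simp

lemma MemH.summable_component {s : ℝ} {w : VField L} (h : MemH L s (coeffs w)) (i : Fin 3) :
    Summable fun k => waveSq L k ^ s * ‖fc (⇑(w i)) k‖ ^ 2 :=
  Summable.fiber (g := fun p : Mode × Fin 3 => waveSq L p.1 ^ s * ‖coeffs w p.1 p.2‖ ^ 2)
    ((hNormSq_lt_top_iff s _).mp h.finite) i

lemma MemH.summable_component_one {w : VField L} (h : MemH L 1 (coeffs w)) (i : Fin 3) :
    Summable fun k => waveSq L k * ‖fc (⇑(w i)) k‖ ^ 2 := by
  simpa only [Real.rpow_one] using h.summable_component i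

lemma MemL2H.memLp_pd {w : ℝ → VField L} (hw : MemL2H T 2 w) (hw1 : MemCH T 1 w) (i j : Fin 3) :
    MemLp (fun t => pd j (w t i)) 2 (volume.restrict (Set.Icc 0 T)) := by
  have h := hw.integrable_summable i
  refine memLp_two_of_symbol (fun k => Complex.I * (wave L k j : ℂ))
    (aemeasurable_fc (hw.aestronglyMeasurable_apply i)) (fun k => ?_) h.1 h.2 (poincare L)
    fun k => ?_
  · filter_upwards [ae_restrict_mem measurableSet_Icc] with t ht
    exact fc_pd ((hw1.mem t ht).summable_component_one i) j k
  · rw [Real.rpow_two]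
    exact (norm_I_wave_sq_le k j).trans (waveSq_le_sq k)

lemma dvgCoeff_pd {u : L2 L} (hu : Summable fun k => waveSq L k * ‖fc (⇑u) k‖ ^ 2) (k : Mode) :
    dvgCoeff (fun j => pd j u) k = -(waveSq L k : ℂ) * fc (⇑u) k := by
  have h (j : Fin 3) : Complex.I * (wave L k j : ℂ) * fc (⇑(pd j u)) k
      = -((wave L k j ^ 2 : ℝ) : ℂ) * fc (⇑u) k := by
    rw [fc_pd hu]
    push_cast
    linear_combination (wave L k j : ℂ) ^ 2 * fc (⇑u) k * Complex.I_mul_I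
  rw [dvgCoeff, Finset.sum_congr rfl fun j _ => h j, ← Finset.sum_mul, waveSq]
  push_cast
  rw [Finset.sum_neg_distrib]

lemma summable_dvgCoeff_pd {c : VField L} (hc : MemH L 2 (coeffs c)) (hc1 : MemH L 1 (coeffs c))
    (i : Fin 3) : Summable fun k => ‖dvgCoeff (fun j => pd j (c i)) k‖ ^ 2 := by
  refine (hc.summable_component i).congr fun k => ?_
  rw [dvgCoeff_pd (hc1.summable_component_one i), norm_mul, mul_pow, norm_neg,
    Complex.norm_real, Real.norm_eq_abs, sq_abs, Real.rpow_two]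

lemma MemL2H.memLp_lap {w : ℝ → VField L} (hw : MemL2H T 2 w) (hw1 : MemCH T 1 w) (i : Fin 3) :
    MemLp (fun t => dvg fun j => pd j (w t i)) 2 (volume.restrict (Set.Icc 0 T)) := by
  have h := hw.integrable_summable i
  refine memLp_two_of_symbol (fun k => -(waveSq L k : ℂ))
    (aemeasurable_fc (hw.aestronglyMeasurable_apply i)) (fun k => ?_) h.1 h.2 1
    fun k => ?_
  · filter_upwards [ae_restrict_mem measurableSet_Icc, hw.mem] with t ht ht2
    rw [fc_dvg (summable_dvgCoeff_pd ht2 (hw1.mem t ht) i),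
      dvgCoeff_pd ((hw1.mem t ht).summable_component_one i)]
  · rw [norm_neg, Complex.norm_real, Real.norm_eq_abs, sq_abs, Real.rpow_two, one_mul]

lemma fc_filterDist (hα : 0 < α) {c : Coeffs} (hc : MemH L (-1) c) (k : Mode) (i : Fin 3) :
    fc (⇑((filterDist α c : VField L) i)) k = filterSymbol L α k * c k i := by
  refine fc_ofCoeff ?_ (fun k => ?_) k
  · have h := Summable.fiber
      (g := fun p : Mode × Fin 3 => waveSq L p.1 ^ (-1 : ℝ) * ‖c p.1 p.2‖ ^ 2)
      ((hNormSq_lt_top_iff (-1) _).mp hc.finite) i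
    refine Summable.of_nonneg_of_le (fun k => sq_nonneg _) (fun k => ?_) (h.mul_left (α ^ 2)⁻¹)
    by_cases hk : k = 0
    · rw [hk, hc.zeroMean]; simp
    · rw [norm_mul, mul_pow, Complex.norm_real, Real.norm_eq_abs, sq_abs, Real.rpow_neg_one,
        ← mul_assoc]
      exact mul_le_mul_of_nonneg_right (filterSymbol_sq_le hα hk) (sq_nonneg _)
  · rw [filterSymbol_neg, hc.isReal, map_mul, Complex.conj_ofReal]

lemma MemL2HDist.memLp_filterDist (hα : 0 < α) {f : ℝ → Coeffs} (hf : MemL2HDist L T (-1) f)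
    (i : Fin 3) :
    MemLp (fun t => (filterDist α (f t) : VField L) i) 2 (volume.restrict (Set.Icc 0 T)) := by
  have h := (lintegral_hNormSq_lt_top_iff (-1) hf.measurable).mp hf.finite
  -- The multiplier is set to `0` in mode zero because the `H₋₁` weight vanishes there while the
  -- filter symbol is `1`. Zero mean makes the change harmless.
  refine memLp_two_of_symbol (fun k => if k = 0 then 0 else (filterSymbol L α k : ℂ))
    (fun k => hf.measurable k i) (fun k => ?_) (fun k => h.1 (k, i)) (Summable.fiber h.2 i)
    (α ^ 2)⁻¹ fun k => ?_
  · filter_upwards [hf.mem] with t ht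
    rw [fc_filterDist hα ht]
    split_ifs with hk
    · rw [hk, ht.zeroMean]; simp
    · rfl
  · split_ifs with hk
    · have := Real.rpow_nonneg (waveSq_nonneg (L := L) k) (-1)
      rw [norm_zero, sq, zero_mul]; exact mul_nonneg (by positivity) this
    · rw [Complex.norm_real, Real.norm_eq_abs, sq_abs, Real.rpow_neg_one]
      exact filterSymbol_sq_le hα hk

lemma MemCH.continuousOn_weight {w : ℝ → VField L} (hw : MemCH T 1 w) :
    ContinuousOn (fun t => weight L (coeffs (w t))) (Set.Icc 0 T) := by
  intro t ht
  have h1 := hw.continuous t ht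
  have h2 : Tendsto (fun τ => ENNReal.ofReal
      (‖weight L (coeffs (w τ)) - weight L (coeffs (w t))‖ ^ 2)) (𝓝[Set.Icc 0 T] t) (𝓝 0) := by
    refine h1.congr' ?_
    filter_upwards [self_mem_nhdsWithin] with τ hτ
    rw [coeffs_sub, hNormSq_one_sub (hw.mem τ hτ).summable_one (hw.mem t ht).summable_one]
  have h3 := (ENNReal.tendsto_toReal ENNReal.zero_ne_top).comp h2
  simp only [Function.comp_def, ENNReal.toReal_ofReal (sq_nonneg _), ENNReal.toReal_zero] at h3
  have h4 := h3.sqrt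
  simp only [Real.sqrt_sq (norm_nonneg _), Real.sqrt_zero] at h4
  exact tendsto_iff_norm_sub_tendsto_zero.mpr h4

lemma MemCH.exists_bound {w : ℝ → VField L} (hw : MemCH T 1 w) :
    ∃ B, ∀ t ∈ Set.Icc 0 T, ‖weight L (coeffs (w t))‖ ≤ B :=
  isCompact_Icc.exists_bound_of_continuousOn hw.continuousOn_weight

lemma MemCH.exists_norm_bound {w : ℝ → VField L} (hw : MemCH T 1 w) :
    ∃ B, 0 ≤ B ∧ ∀ t ∈ Set.Icc 0 T, ∀ i, ‖w t i‖ ≤ B := by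
  have hLp := hL.out
  have hP := poincare_nonneg (L := L)
  obtain ⟨B, hB⟩ := hw.exists_bound
  refine ⟨√(L ^ 3 * poincare L * B ^ 2), Real.sqrt_nonneg _, fun t ht i => Real.le_sqrt_of_sq_le ?_⟩
  refine (norm_sq_le_weight (hw.mem t ht) i).trans ?_
  exact mul_le_mul_of_nonneg_left (pow_le_pow_left₀ (norm_nonneg _) (hB t ht) 2) (by positivity)

/-- The majorant is constant in time and square summable over the modes, and the time interval is
finite. -/
lemma memLp_two_of_filterSymbol_bound (hα : 0 < α) {U : ℝ → L2 L}
    (hm : ∀ k, AEMeasurable (fun t => fc (⇑(U t)) k) (volume.restrict (Set.Icc 0 T))) {C : ℝ}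
    (hC : ∀ t ∈ Set.Icc 0 T, ∀ k, ‖fc (⇑(U t)) k‖ ≤ filterSymbol L α k * C) :
    MemLp U 2 (volume.restrict (Set.Icc 0 T)) := by
  refine memLp_two_of_fc_le hm (g := fun k _ => filterSymbol L α k ^ 2 * C ^ 2)
    (fun k => integrable_const _) ?_ fun k => ?_
  · simp only [integral_const, smul_eq_mul]
    exact ((summable_filterSymbol_sq hα).mul_right _).mul_left _
  · filter_upwards [ae_restrict_mem measurableSet_Icc] with t ht
    rw [← mul_pow]
    exact pow_le_pow_left₀ (norm_nonneg _) (hC t ht k) 2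

lemma aemeasurable_fc_flux (hα : 0 < α) {w : ℝ → VField L} {μ : Measure ℝ}
    (hw : ∀ i, AEStronglyMeasurable (fun t => w t i) μ) (i j : Fin 3) (k : Mode) :
    AEMeasurable (fun t => fc (⇑(flux α N (w t) i j)) k) μ := by
  simp only [fc_flux hα]
  refine (AEMeasurable.tsum fun l => ?_).const_mul _
  exact ((aemeasurable_fc (hw i) l).const_mul _).mul ((aemeasurable_fc (hw j) (k - l)).const_mul _)

lemma memLp_flux (hα : 0 < α) {w : ℝ → VField L} (hw : MemL2H T 2 w) (hw1 : MemCH T 1 w)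
    (i j : Fin 3) : MemLp (fun t => flux α N (w t) i j) 2 (volume.restrict (Set.Icc 0 T)) := by
  have hLp := hL.out
  obtain ⟨B, hB0, hB⟩ := hw1.exists_norm_bound
  refine memLp_two_of_filterSymbol_bound hα (C := (L ^ 3)⁻¹ * ((N + 1) ^ 2 * (B * B)))
    (fun k => aemeasurable_fc_flux hα hw.aestronglyMeasurable_apply i j k) fun t ht k => ?_
  refine (norm_fc_flux_le hα (w t) i j k).trans
    (mul_le_mul_of_nonneg_left ?_ (filterSymbol_pos k).le)
  gcongr
  · exact hB t ht i
  · exact hB t ht j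

lemma norm_nonlin_le {w : VField L} (hw : MemH L 1 (coeffs w)) (k : Mode) (i : Fin 3) :
    ‖nonlin L α N (coeffs w) k i‖ ≤ filterSymbol L α k *
      (3 * convConst L N * ‖weight L (coeffs w)‖ ^ 2) := by
  rw [← unweight_weight hw.summable_one hw.zeroMean, nonlin_unweight,
    unweight_weight hw.summable_one hw.zeroMean]
  refine (norm_bilin_le _ _ k i).trans_eq (by ring)

lemma summable_dvgCoeff_flux (hα : 0 < α) {w : VField L} (hw : MemH L 1 (coeffs w)) (i : Fin 3) :
    Summable fun k => ‖dvgCoeff (flux α N w i) k‖ ^ 2 := by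
  refine Summable.of_nonneg_of_le (fun k => sq_nonneg _) (fun k => ?_)
    ((summable_filterSymbol_sq (L := L) hα).mul_right
      ((3 * convConst L N * ‖weight L (coeffs w)‖ ^ 2) ^ 2))
  rw [dvgCoeff_flux hα, ← mul_pow]
  exact pow_le_pow_left₀ (norm_nonneg _) (norm_nonlin_le hw k i) 2

lemma memLp_dvg_flux (hα : 0 < α) {w : ℝ → VField L} (hw : MemL2H T 2 w) (hw1 : MemCH T 1 w)
    (i : Fin 3) : MemLp (fun t => dvg (flux α N (w t) i)) 2 (volume.restrict (Set.Icc 0 T)) := by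
  obtain ⟨B, hB⟩ := hw1.exists_bound
  have hC := convConst_nonneg (L := L) (N := N)
  have hfc : ∀ t ∈ Set.Icc 0 T, ∀ k,
      fc (⇑(dvg (flux α N (w t) i))) k = dvgCoeff (flux α N (w t) i) k := fun t ht k =>
    fc_dvg (summable_dvgCoeff_flux hα (hw1.mem t ht) i) k
  refine memLp_two_of_filterSymbol_bound hα (C := 3 * convConst L N * B ^ 2) (fun k => ?_)
    fun t ht k => ?_
  · have : AEMeasurable (fun t => dvgCoeff (flux α N (w t) i) k)
        (volume.restrict (Set.Icc 0 T)) := by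
      refine Finset.aemeasurable_fun_sum _ fun j _ => ?_
      exact (aemeasurable_fc_flux hα hw.aestronglyMeasurable_apply i j k).const_mul _
    refine this.congr ?_
    filter_upwards [ae_restrict_mem measurableSet_Icc] with t ht
    rw [hfc t ht]
  · rw [hfc t ht, dvgCoeff_flux hα]
    refine (norm_nonlin_le (L := L) (hw1.mem t ht) k i).trans
      (mul_le_mul_of_nonneg_left ?_ (filterSymbol_pos k).le)
    have := hB t ht
    gcongr

end TimeRegularity

/-! ### The weak form is equivalent to the momentum balance in every mode. -/

section WeakFormulation

variable {L α ν T : ℝ} [hL : Fact (0 < L)] {N : ℕ} {f : ℝ → Coeffs} {w w' : ℝ → VField L}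
  {q : ℝ → L2 L}

/-- The momentum balance at a fixed time. -/
def residual (α ν : ℝ) (N : ℕ) (c : Coeffs) (w w' : VField L) (q : L2 L) (i : Fin 3) : L2 L :=
  w' i + dvg (flux α N w i) - ν • dvg (fun j => pd j (w i)) + pd i q
    - (filterDist α c : VField L) i

/-- The Fourier coefficients of the momentum balance at a fixed time. -/
def residualCoeff (α ν : ℝ) (N : ℕ) (c : Coeffs) (w w' : VField L) (q : L2 L) : Coeffs :=
  fun k i => fc (⇑(w' i)) k + nonlin L α N (coeffs w) k i + (ν * waveSq L k : ℝ) * fc (⇑(w i)) k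
    + Complex.I * (wave L k i : ℂ) * fc (⇑q) k - filterSymbol L α k * c k i

lemma fc_residual (hα : 0 < α) {c : Coeffs} {w w' : VField L} {q : L2 L} (hc : MemH L (-1) c)
    (hw1 : MemH L 1 (coeffs w)) (hw2 : MemH L 2 (coeffs w))
    (hq : Summable fun k => waveSq L k * ‖fc (⇑q) k‖ ^ 2) (k : Mode) (i : Fin 3) :
    fc (⇑(residual α ν N c w w' q i)) k = residualCoeff α ν N c w w' q k i := by
  rw [residual, residualCoeff, fc_sub, fc_add, fc_sub, fc_add, fc_smul, fc_pd hq,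
    fc_filterDist hα hc, fc_dvg (summable_dvgCoeff_flux hα hw1 i), dvgCoeff_flux hα,
    fc_dvg (summable_dvgCoeff_pd hw2 hw1 i), dvgCoeff_pd (hw1.summable_component_one i)]
  push_cast; ring

/-- Integration by parts in the flux and viscous terms collects everything into one pairing with
`v`. -/
lemma sum_inner_residual (hα : 0 < α) {c : Coeffs} {w w' v : VField L} {q : L2 L}
    (hw1 : MemH L 1 (coeffs w)) (hw2 : MemH L 2 (coeffs w))
    (hv : ∀ i, Summable fun k => waveSq L k * ‖fc (⇑(v i)) k‖ ^ 2) :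
    (∑ i, inner ℝ (w' i) (v i)) - (∑ i, ∑ j, inner ℝ (flux α N w i j) (pd j (v i)))
      + ν * (∑ i, ∑ j, inner ℝ (pd j (w i)) (pd j (v i))) + (∑ i, inner ℝ (pd i q) (v i))
      - (∑ i, inner ℝ ((filterDist α c : VField L) i) (v i))
    = ∑ i, inner ℝ (residual α ν N c w w' q i) (v i) := by
  have h1 (i : Fin 3) := sum_inner_pd (summable_dvgCoeff_flux (N := N) hα hw1 i) (hv i)
  have h2 (i : Fin 3) := sum_inner_pd (summable_dvgCoeff_pd hw2 hw1 i) (hv i)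
  simp only [h1, h2, residual, inner_sub_left, inner_add_left, real_inner_smul_left,
    Finset.sum_sub_distrib, Finset.sum_add_distrib, Finset.sum_neg_distrib]
  simp only [← Finset.mul_sum]
  ring

lemma memLp_residual (hα : 0 < α) (hf : MemL2HDist L T (-1) f) (hw2 : MemL2H T 2 w)
    (hw1 : MemCH T 1 w) (hw' : MemL2H T 0 w') (hq : MemL2H1 T q) (i : Fin 3) :
    MemLp (fun t => residual α ν N (f t) (w t) (w' t) (q t) i) 2
      (volume.restrict (Set.Icc 0 T)) :=
  ((((hw'.memLp i).add (memLp_dvg_flux hα hw2 hw1 i)).sub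
    ((hw2.memLp_lap hw1 i).const_smul ν)).add (hq.memLp_pd i)).sub (hf.memLp_filterDist hα i)

lemma integrable_sum_inner {μ : Measure ℝ} {a b : ℝ → VField L}
    (ha : ∀ i, MemLp (fun t => a t i) 2 μ) (hb : ∀ i, MemLp (fun t => b t i) 2 μ) :
    Integrable (fun t => ∑ i, inner ℝ (a t i) (b t i)) μ :=
  integrable_finsetSum _ fun i _ => integrable_inner_of_memLp (ha i) (hb i)

lemma integrable_sum_sum_inner {μ : Measure ℝ} {a b : ℝ → Fin 3 → VField L}
    (ha : ∀ i j, MemLp (fun t => a t i j) 2 μ) (hb : ∀ i j, MemLp (fun t => b t i j) 2 μ) :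
    Integrable (fun t => ∑ i, ∑ j, inner ℝ (a t i j) (b t i j)) μ :=
  integrable_finsetSum _ fun i _ => integrable_finsetSum _ fun j _ =>
    integrable_inner_of_memLp (ha i j) (hb i j)

lemma integral_linear_combination {μ : Measure ℝ} {a b c d e : ℝ → ℝ} (r : ℝ)
    (ha : Integrable a μ) (hb : Integrable b μ) (hc : Integrable c μ) (hd : Integrable d μ)
    (he : Integrable e μ) : ∫ t, (a t - b t + r * c t + d t - e t) ∂μ
      = ∫ t, a t ∂μ - ∫ t, b t ∂μ + r * ∫ t, c t ∂μ + ∫ t, d t ∂μ - ∫ t, e t ∂μ := by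
  have h1 : Integrable (fun t => a t - b t) μ := ha.sub hb
  have h2 : Integrable (fun t => r * c t) μ := hc.const_mul r
  have h3 : Integrable (fun t => a t - b t + r * c t) μ := h1.add h2
  have h4 : Integrable (fun t => a t - b t + r * c t + d t) μ := h3.add hd
  rw [integral_sub h4 he, integral_add h3 hd, integral_add h1 h2, integral_sub ha hb,
    integral_const_mul]

lemma weakForm_iff_integral_residual (hα : 0 < α) (hf : MemL2HDist L T (-1) f)
    (hw2 : MemL2H T 2 w) (hw1 : MemCH T 1 w) (hw' : MemL2H T 0 w') (hq : MemL2H1 T q) :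
    WeakForm α ν T N f w w' q ↔ ∀ v : ℝ → VField L, (∀ i, MemL2H1 T fun t => v t i) →
      ∫ t in Set.Icc 0 T, ∑ i, inner ℝ (residual α ν N (f t) (w t) (w' t) (q t) i) (v t i) = 0 := by
  refine forall_congr' fun v => imp_congr_right fun hv => ?_
  have hflux (t : ℝ) : (∫ x : Torus L, ∑ i, ∑ j,
      filter α (fun y => deconv α N (w t i) y * deconv α N (w t j) y) x * pd j (v t i) x)
      = ∑ i, ∑ j, inner ℝ (flux α N (w t) i j) (pd j (v t i)) :=
    integral_sum_sum_mul (fun i j => flux α N (w t) i j) fun i j => pd j (v t i)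
  have hpd (t : ℝ) : (∫ x : Torus L, ∑ i, ∑ j, pd j (w t i) x * pd j (v t i) x)
      = ∑ i, ∑ j, inner ℝ (pd j (w t i)) (pd j (v t i)) :=
    integral_sum_sum_mul (fun i j => pd j (w t i)) fun i j => pd j (v t i)
  simp only [hflux, hpd, integral_sum_mul]
  have hvL (i : Fin 3) := (hv i).memLp
  have hvP (i j : Fin 3) := (hv i).memLp_pd j
  have i1 := integrable_sum_inner hw'.memLp hvL
  have i2 := integrable_sum_sum_inner (memLp_flux (N := N) hα hw2 hw1) hvP
  have i3 := integrable_sum_sum_inner (hw2.memLp_pd hw1) hvP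
  have i4 := integrable_sum_inner hq.memLp_pd hvL
  have i5 := integrable_sum_inner (hf.memLp_filterDist hα) hvL
  rw [← sub_eq_zero, ← integral_linear_combination ν i1 i2 i3 i4 i5]
  refine Eq.congr_left (integral_congr_ae ?_)
  have hvS : ∀ᵐ t ∂(volume.restrict (Set.Icc 0 T)), ∀ i,
      Summable fun k => waveSq L k * ‖fc (⇑(v t i)) k‖ ^ 2 :=
    ae_all_iff.mpr fun i => (hv i).ae_h1
  filter_upwards [ae_restrict_mem measurableSet_Icc, hw2.mem, hvS] with t ht ht2 htv
  exact sum_inner_residual hα (hw1.mem t ht) ht2 htv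

/-- The weak formulation is the momentum balance of all Fourier coefficients. -/
theorem weakForm_iff (hα : 0 < α) (hf : MemL2HDist L T (-1) f)
    (hw2 : MemL2H T 2 w) (hw1 : MemCH T 1 w) (hw' : MemL2H T 0 w') (hq : MemL2H1 T q) :
    WeakForm α ν T N f w w' q ↔ ∀ᵐ t ∂(volume.restrict (Set.Icc 0 T)), ∀ k i,
      residualCoeff α ν N (f t) (w t) (w' t) (q t) k i = 0 := by
  have hLp := hL.out
  rw [weakForm_iff_integral_residual hα hf hw2 hw1 hw' hq]
  have hfc : ∀ᵐ t ∂(volume.restrict (Set.Icc 0 T)), ∀ k i,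
      fc (⇑(residual α ν N (f t) (w t) (w' t) (q t) i)) k
        = residualCoeff α ν N (f t) (w t) (w' t) (q t) k i := by
    filter_upwards [ae_restrict_mem measurableSet_Icc, hw2.mem, hf.mem, hq.ae_h1] with
      t ht ht2 htf htq k i using fc_residual hα htf (hw1.mem t ht) ht2 htq k i
  have hrL := memLp_residual (ν := ν) (N := N) hα hf hw2 hw1 hw' hq
  set r : ℝ → VField L := fun t i => residual α ν N (f t) (w t) (w' t) (q t) i with hr
  constructor
  · intro h
    -- The residual `r` is only in `L²` and not an admissible test field, but `G r` is in `L²(0,T;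
    -- H¹)`. The pairing of `r` with `G r` is a sum of nonnegative terms with positive weights, so
    -- it vanishes only if `r` does.
    have hfilter (t : ℝ) (i : Fin 3) : HasSum
        (fun k => L ^ 3 * (filterSymbol L α k * ‖fc (⇑(r t i)) k‖ ^ 2))
        (inner ℝ (r t i) (filter α ⇑(r t i))) := by
      refine (hasSum_fc_inner _ _).congr_fun fun k => ?_
      rw [fc_filter hα, mul_left_comm (conj _), ← Complex.normSq_eq_conj_mul_self,
        Complex.re_ofReal_mul,
        Complex.ofReal_re, Complex.normSq_eq_norm_sq]
    have hterm (t : ℝ) (i : Fin 3) (k : Mode) :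
        0 ≤ L ^ 3 * (filterSymbol L α k * ‖fc (⇑(r t i)) k‖ ^ 2) :=
      mul_nonneg (by positivity) (mul_nonneg (filterSymbol_pos k).le (sq_nonneg _))
    have hnn (t : ℝ) (i : Fin 3) : 0 ≤ inner ℝ (r t i) (filter α ⇑(r t i)) :=
      (hfilter t i).nonneg (hterm t i)
    have hmeas (i : Fin 3) (k : Mode) : AEMeasurable (fun t => fc (⇑(filter α ⇑(r t i))) k)
        (volume.restrict (Set.Icc 0 T)) := by
      simp only [fc_filter hα]
      exact (aemeasurable_fc (hrL i).1 k).const_mul _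
    have hrS (i : Fin 3) := (memLp_two_iff_fc (aemeasurable_fc (hrL i).1)).mp (hrL i)
    have hsym (k : Mode) : (1 + waveSq L k) * filterSymbol L α k ^ 2 ≤ 1 + (α ^ 2)⁻¹ := by
      have h1 := filterSymbol_le_one (L := L) (α := α) k
      have h0 := (filterSymbol_pos (L := L) (α := α) k).le
      have h2 : filterSymbol L α k ^ 2 ≤ 1 := pow_le_one₀ h0 h1
      have h3 : waveSq L k * filterSymbol L α k ^ 2 ≤ (α ^ 2)⁻¹ := by
        by_cases hk : k = 0
        · rw [hk, waveSq_zero, zero_mul]; positivity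
        · have h4 := mul_le_mul_of_nonneg_left (filterSymbol_sq_le (L := L) hα hk)
            (waveSq_nonneg (L := L) k)
          refine h4.trans_eq ?_
          rw [mul_left_comm, mul_inv_cancel₀ (waveSq_pos (L := L) hk).ne', mul_one]
      linarith
    have hv (i : Fin 3) : MemL2H1 T fun t => filter α ⇑(r t i) := by
      have hm := aestronglyMeasurable_of_fc (hmeas i)
      refine ⟨hm, (lintegral_h1NormSq_lt_top_iff hm).mpr ⟨fun k => ?_, ?_⟩⟩
      · simp only [fc_filter hα, norm_mul, mul_pow]
        exact (((hrS i).1 k).const_mul _).const_mul _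
      · refine Summable.of_nonneg_of_le (fun k => mul_nonneg
          (add_nonneg zero_le_one (waveSq_nonneg k)) (integral_nonneg fun t => sq_nonneg _))
          (fun k => ?_) ((hrS i).2.mul_left (1 + (α ^ 2)⁻¹))
        simp only [fc_filter hα, norm_mul, mul_pow, Complex.norm_real, Real.norm_eq_abs, sq_abs]
        rw [integral_const_mul, ← mul_assoc]
        exact mul_le_mul_of_nonneg_right (hsym k) (integral_nonneg fun t => sq_nonneg _)
    have h1 := h (fun t i => filter α ⇑(r t i)) hv
    have hint := integrable_sum_inner (b := fun t i => filter α ⇑(r t i)) hrL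
      fun i => (hv i).memLp
    rw [integral_eq_zero_iff_of_nonneg (fun t => Finset.sum_nonneg fun i _ => hnn t i) hint] at h1
    filter_upwards [h1, hfc] with t ht htfc k i
    have h2 := (Finset.sum_eq_zero_iff_of_nonneg fun i _ => hnn t i).mp ht i (Finset.mem_univ i)
    have h3 := hfilter t i
    rw [h2, hasSum_zero_iff_of_nonneg (hterm t i)] at h3
    have h4 := congrFun h3 k
    rw [← htfc]
    have h5 := (filterSymbol_pos (L := L) (α := α) k).ne'
    have h6 : L ^ 3 ≠ 0 := by positivity
    simpa [h5, h6, hLp.ne'] using h4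
  · intro h v _
    refine integral_eq_zero_of_ae ?_
    filter_upwards [h, hfc] with t ht htfc
    refine Finset.sum_eq_zero fun i _ => ?_
    have : residual α ν N (f t) (w t) (w' t) (q t) i = 0 :=
      L2_ext fun k => by rw [fc_zero]; exact (htfc k i).trans (ht k i)
    rw [this, inner_zero_left]

end WeakFormulation

/-! ### Weak time derivatives as primitives of the Fourier coefficients. -/

section WeakDerivative

variable {T : ℝ}

/-- The primitive from `0` vanishes to the left of the support of `g` trivially, and to the right
because `g` has mean zero. -/
lemma exists_testFunction_deriv_eq (hT : 0 < T) {g : ℝ → ℝ} (hg : ContDiff ℝ ∞ g)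
    (hc : HasCompactSupport g) (hs : tsupport g ⊆ Set.Ioo 0 T) (h0 : ∫ t, g t = 0) :
    ∃ φ : ℝ → ℝ, ContDiff ℝ ∞ φ ∧ HasCompactSupport φ ∧ tsupport φ ⊆ Set.Ioo 0 T ∧
      deriv φ = g := by
  obtain ⟨a, b, ha, hb, hab⟩ : ∃ a b : ℝ, 0 < a ∧ b < T ∧ tsupport g ⊆ Set.Icc a b := by
    rcases (tsupport g).eq_empty_or_nonempty with he | hne
    · exact ⟨T / 2, T / 2, by linarith, by linarith, by simp [he]⟩
    · exact ⟨sInf (tsupport g), sSup (tsupport g), (hs (hc.isCompact.sInf_mem hne)).1,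
        (hs (hc.isCompact.sSup_mem hne)).2,
        subset_Icc_csInf_csSup hc.isCompact.bddBelow hc.isCompact.bddAbove⟩
  have hg0 (s : ℝ) (hs : s ∉ Set.Icc a b) : g s = 0 :=
    image_eq_zero_of_notMem_tsupport fun h => hs (hab h)
  set φ : ℝ → ℝ := fun t => ∫ s in (0 : ℝ)..t, g s with hφ
  have hd (t : ℝ) : HasDerivAt φ (g t) t :=
    intervalIntegral.integral_hasDerivAt_right (hg.continuous.intervalIntegrable _ _)
      hg.continuous.stronglyMeasurable.stronglyMeasurableAtFilter hg.continuous.continuousAt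
  have hderiv : deriv φ = g := funext fun t => (hd t).deriv
  have hsupp : Function.support φ ⊆ Set.Icc a b := by
    intro t ht
    by_contra htn
    refine ht ?_
    rcases lt_or_ge t a with hta | hta
    · refine (intervalIntegral.integral_congr (g := fun _ => (0 : ℝ)) fun s hs => ?_).trans
        intervalIntegral.integral_zero
      refine hg0 s fun h => absurd h.1 (not_le.mpr ?_)
      rw [Set.mem_uIcc] at hs
      rcases hs with hs | hs <;> linarith [hs.1, hs.2]
    · have hbt : b < t := by
        by_contra hbt
        exact htn ⟨hta, not_lt.mp hbt⟩
      rw [← h0]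
      refine intervalIntegral.integral_eq_integral_of_support_subset fun s hs => ?_
      have := hab (subset_tsupport g hs)
      exact ⟨ha.trans_le this.1, this.2.trans hbt.le⟩
  have hts : tsupport φ ⊆ Set.Icc a b := closure_minimal hsupp isClosed_Icc
  refine ⟨φ, contDiff_infty_iff_deriv.mpr ⟨fun t => (hd t).differentiableAt, hderiv ▸ hg⟩,
    isCompact_Icc.of_isClosed_subset (isClosed_tsupport φ) hts,
    hts.trans fun t ht => ⟨ha.trans_le ht.1, ht.2.trans_lt hb⟩, hderiv⟩

lemma exists_testFunction_integral_eq_one (hT : 0 < T) : ∃ η : ℝ → ℝ, ContDiff ℝ ∞ η ∧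
    HasCompactSupport η ∧ tsupport η ⊆ Set.Ioo 0 T ∧ ∫ t, η t = 1 := by
  let b : ContDiffBump (T / 2) := ⟨T / 8, T / 4, by positivity, by linarith⟩
  refine ⟨b.normed volume, b.contDiff_normed, b.hasCompactSupport_normed, ?_, b.integral_normed⟩
  rw [b.tsupport_normed_eq, Real.closedBall_eq_Icc]
  intro t ht
  change t ∈ Set.Icc (T / 2 - T / 4) (T / 2 + T / 4) at ht
  exact ⟨by linarith [ht.1], by linarith [ht.2]⟩

lemma setIntegral_Icc_test_smul {φ : ℝ → ℝ} (hs : tsupport φ ⊆ Set.Ioo 0 T) (z : ℝ → ℂ) :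
    ∫ t in Set.Icc 0 T, φ t • z t = ∫ t, φ t • z t := by
  refine setIntegral_eq_integral_of_forall_compl_eq_zero fun t ht => ?_
  rw [image_eq_zero_of_notMem_tsupport fun h => ht (Set.Ioo_subset_Icc_self (hs h)), zero_smul]

/-- The lemma of du Bois-Reymond. -/
lemma eqOn_const_of_integral_deriv_smul_eq_zero (hT : 0 < T) {z : ℝ → ℂ}
    (hz : ContinuousOn z (Set.Icc 0 T))
    (h : ∀ φ : ℝ → ℝ, ContDiff ℝ ∞ φ → HasCompactSupport φ → tsupport φ ⊆ Set.Ioo 0 T →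
      ∫ t in Set.Icc 0 T, deriv φ t • z t = 0) : ∃ c : ℂ, ∀ t ∈ Set.Icc 0 T, z t = c := by
  obtain ⟨η, hη, hηc, hηs, hη1⟩ := exists_testFunction_integral_eq_one hT
  set c : ℂ := ∫ t, η t • z t with hc
  have hint {ψ : ℝ → ℝ} (hψ : ContDiff ℝ ∞ ψ) (hψs : tsupport ψ ⊆ Set.Ioo 0 T) :
      Integrable fun t => ψ t • z t := by
    have h1 : IntegrableOn (fun t => ψ t • z t) (Set.Icc 0 T) :=
      (hψ.continuous.continuousOn.smul hz).integrableOn_Icc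
    refine (integrableOn_iff_integrable_of_support_subset fun t ht => ?_).mp h1
    by_contra hn
    refine ht ?_
    change ψ t • z t = 0
    rw [image_eq_zero_of_notMem_tsupport fun h => hn (Set.Ioo_subset_Icc_self (hψs h)), zero_smul]
  have hae : ∀ᵐ t : ℝ, t ∈ Set.Ioo 0 T → z t - c = 0 := by
    refine isOpen_Ioo.ae_eq_zero_of_integral_contDiff_smul_eq_zero ?_ fun ψ hψ hψc hψs => ?_
    · exact ((hz.mono Set.Ioo_subset_Icc_self).sub continuousOn_const).locallyIntegrableOn
        measurableSet_Ioo
    -- Subtracting `r η` makes the mean zero, so `ψ - r η` is the derivative of a test function and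
    -- the hypothesis applies. It says that `z - c` is orthogonal to `ψ`.
    set r := ∫ t, ψ t with hr
    have hgs : tsupport (fun t => ψ t - r * η t) ⊆ Set.Ioo 0 T := by
      have h1 : tsupport (fun t => ψ t - r * η t) ⊆ tsupport ψ ∪ tsupport η := by
        refine closure_minimal (fun t ht => ?_)
          ((isClosed_tsupport ψ).union (isClosed_tsupport η))
        by_contra hn
        rw [Set.mem_union, not_or] at hn
        refine ht ?_
        change ψ t - r * η t = 0
        rw [image_eq_zero_of_notMem_tsupport hn.1, image_eq_zero_of_notMem_tsupport hn.2]
        ring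
      exact h1.trans (Set.union_subset hψs hηs)
    have hgd : ContDiff ℝ ∞ fun t => ψ t - r * η t := hψ.sub (contDiff_const.mul hη)
    have hψi : Integrable ψ := hψ.continuous.integrable_of_hasCompactSupport hψc
    have hηi : Integrable η := hη.continuous.integrable_of_hasCompactSupport hηc
    have hg0 : ∫ t, (ψ t - r * η t) = 0 := by
      rw [integral_sub hψi (hηi.const_mul r), integral_const_mul, hη1, mul_one, sub_self]
    have hgc : HasCompactSupport fun t => ψ t - r * η t :=
      (isCompact_Icc (a := (0 : ℝ)) (b := T)).of_isClosed_subset (isClosed_tsupport _)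
        (hgs.trans Set.Ioo_subset_Icc_self)
    obtain ⟨φ, hφ, hφc, hφs, hφd⟩ := exists_testFunction_deriv_eq hT hgd hgc hgs hg0
    have h1 := h φ hφ hφc hφs
    rw [hφd, setIntegral_Icc_test_smul hgs] at h1
    have h2 : ∫ t, (ψ t - r * η t) • z t = (∫ t, ψ t • z t) - r • c := by
      have hi : Integrable fun t => r • η t • z t := (hint hη hηs).smul r
      rw [hc, ← integral_smul, ← integral_sub (hint hψ hψs) hi]
      simp only [sub_smul, smul_smul]
    rw [h2] at h1
    have h3 : ∫ t, ψ t • (z t - c) = (∫ t, ψ t • z t) - r • c := by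
      rw [hr, ← integral_smul_const, ← integral_sub (hint hψ hψs) (hψi.smul_const c)]
      simp only [smul_sub]
    rw [h3, h1]
  refine ⟨c, fun t ht => ?_⟩
  refine Measure.eqOn_Icc_of_ae_eq volume hT.ne (g := fun _ => c) ?_ hz continuousOn_const ht
  rw [EventuallyEq, restrict_Ioo_eq_restrict_Icc.symm, ae_restrict_iff' measurableSet_Ioo]
  filter_upwards [hae] with s hs hs'
  exact sub_eq_zero.mp (hs hs')

lemma isPrim_test (hT : 0 ≤ T) {φ : ℝ → ℝ} (hφ : ContDiff ℝ ∞ φ) :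
    IsPrim T (fun t => (φ t : ℂ)) fun t => ((deriv φ t : ℝ) : ℂ) := by
  have h := contDiff_infty_iff_deriv.mp hφ
  refine IsPrim.of_hasDerivAt hT (fun t => (h.1 t).hasDerivAt.ofReal_comp) ?_
  exact Complex.continuous_ofReal.comp h.2.continuous

/-- Integration by parts: the product `φ y` is a primitive that vanishes at both ends. -/
lemma IsPrim.integral_deriv_smul (hT : 0 ≤ T) {y h : ℝ → ℂ} (hy : IsPrim T y h) {φ : ℝ → ℝ}
    (hφ : ContDiff ℝ ∞ φ) (hs : tsupport φ ⊆ Set.Ioo 0 T) :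
    ∫ t in Set.Icc 0 T, deriv φ t • y t = -∫ t in Set.Icc 0 T, φ t • h t := by
  have hP := isPrim_test hT hφ
  have h1 := (hP.mul hT hy).eq T ⟨hT, le_rfl⟩
  have hz (t : ℝ) (ht : t ∉ Set.Ioo 0 T) : φ t = 0 :=
    image_eq_zero_of_notMem_tsupport fun h => ht (hs h)
  rw [hz T (by simp), hz 0 (by simp), Complex.ofReal_zero, zero_mul, zero_mul, zero_add] at h1
  have i1 : IntervalIntegrable (fun t => ((deriv φ t : ℝ) : ℂ) * y t) volume 0 T :=
    hP.integrable.mul_continuousOn (by rw [Set.uIcc_of_le hT]; exact hy.continuousOn hT)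
  have i2 : IntervalIntegrable (fun t => (φ t : ℂ) * h t) volume 0 T :=
    hy.integrable.continuousOn_mul (by rw [Set.uIcc_of_le hT]; exact hP.continuousOn hT)
  rw [intervalIntegral.integral_add i1 i2] at h1
  simp only [Complex.real_smul, integral_Icc_eq_integral_Ioc,
    ← intervalIntegral.integral_of_le hT]
  linear_combination -h1

/-- The difference of `y` and the integral of `h` has weak derivative zero; du Bois-Reymond makes it
constant on all of `[0,T]`. -/
lemma isPrim_of_weak (hT : 0 < T) {y h : ℝ → ℂ} (hy : ContinuousOn y (Set.Icc 0 T))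
    (hh : IntervalIntegrable h volume 0 T)
    (hw : ∀ φ : ℝ → ℝ, ContDiff ℝ ∞ φ → HasCompactSupport φ → tsupport φ ⊆ Set.Ioo 0 T →
      ∫ t in Set.Icc 0 T, deriv φ t • y t = -∫ t in Set.Icc 0 T, φ t • h t) : IsPrim T y h := by
  have hP : IsPrim T (fun t => ∫ s in (0 : ℝ)..t, h s) h := ⟨hh, fun t _ => by simp⟩
  have hPc := hP.continuousOn hT.le
  obtain ⟨c, hc⟩ := eqOn_const_of_integral_deriv_smul_eq_zero hT (hy.sub hPc) fun φ hφ hφc hφs => by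
    have hd : Continuous (deriv φ) := (contDiff_infty_iff_deriv.mp hφ).2.continuous
    have i1 : IntegrableOn (fun t => deriv φ t • y t) (Set.Icc 0 T) :=
      (hd.continuousOn.smul hy).integrableOn_Icc
    have i2 : IntegrableOn (fun t => deriv φ t • ∫ s in (0 : ℝ)..t, h s) (Set.Icc 0 T) :=
      (hd.continuousOn.smul hPc).integrableOn_Icc
    simp only [Pi.sub_apply, smul_sub]
    rw [integral_sub i1 i2, hw φ hφ hφc hφs, hP.integral_deriv_smul hT.le hφ hφs, sub_self]
  refine ⟨hh, fun t ht => ?_⟩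
  have h1 := hc t ht
  have h2 := hc 0 ⟨le_rfl, hT.le⟩
  simp only [Pi.sub_apply, intervalIntegral.integral_same, sub_zero] at h1 h2
  rw [h2, ← h1]; ring

variable {L : ℝ} [hL : Fact (0 < L)]

lemma fc_neg (u : L2 L) (k : Mode) : fc (⇑(-u)) k = -fc (⇑u) k := by
  simp only [← fcL_apply, map_neg]

lemma fc_integral_smul {w : ℝ → VField L}
    (hw : ∀ i, Integrable (fun t => w t i) (volume.restrict (Set.Icc 0 T))) {φ : ℝ → ℝ}
    (hφ : Continuous φ) (k : Mode) (i : Fin 3) :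
    fc (⇑((∫ t in Set.Icc 0 T, φ t • w t) i)) k = ∫ t in Set.Icc 0 T, φ t • fc (⇑(w t i)) k := by
  have hi (i : Fin 3) : Integrable (fun t => φ t • w t i) (volume.restrict (Set.Icc 0 T)) :=
    IntegrableOn.continuousOn_smul (hw i) hφ.continuousOn isCompact_Icc
  have h1 : (∫ t in Set.Icc 0 T, φ t • w t) i = ∫ t in Set.Icc 0 T, φ t • w t i :=
    eval_integral (f := fun t => φ t • w t) hi i
  rw [h1, ← fcL_apply, ← ContinuousLinearMap.integral_comp_comm _ (hi i)]
  simp only [map_smul, fcL_apply]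

/-- Test functions depend on time only, so the vector-valued identity decouples: Bochner integrals
commute with the coefficient functionals, which separate points. -/
lemma isWeakTimeDeriv_iff (hT : 0 < T) {w w' : ℝ → VField L}
    (hw : ∀ i, Integrable (fun t => w t i) (volume.restrict (Set.Icc 0 T)))
    (hw' : ∀ i, Integrable (fun t => w' t i) (volume.restrict (Set.Icc 0 T)))
    (hc : ∀ k i, ContinuousOn (fun t => fc (⇑(w t i)) k) (Set.Icc 0 T)) :
    IsWeakTimeDeriv T w w' ↔
      ∀ k i, IsPrim T (fun t => fc (⇑(w t i)) k) fun t => fc (⇑(w' t i)) k := by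
  constructor
  · intro h k i
    have hint : IntervalIntegrable (fun t => fc (⇑(w' t i)) k) volume 0 T := by
      rw [intervalIntegrable_iff_integrableOn_Icc_of_le hT.le]
      simp only [← fcL_apply]
      exact (fcL L k).integrable_comp (hw' i)
    refine isPrim_of_weak hT (hc k i) hint fun φ hφ hφc hφs => ?_
    have h1 := congrArg (fun V : VField L => fc (⇑(V i)) k) (h φ hφ hφc hφs)
    simp only [Pi.neg_apply] at h1
    rw [fc_neg,
      fc_integral_smul hw (contDiff_infty_iff_deriv.mp hφ).2.continuous,
      fc_integral_smul hw' hφ.continuous] at h1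
    exact h1
  · intro h φ hφ hφc hφs
    funext i
    refine L2_ext fun k => ?_
    rw [Pi.neg_apply, fc_neg,
      fc_integral_smul hw (contDiff_infty_iff_deriv.mp hφ).2.continuous,
      fc_integral_smul hw' hφ.continuous]
    exact (h k i).integral_deriv_smul hT.le hφ hφs

end WeakDerivative

/-! ### Recovery of the pressure. -/

section Pressure

variable {L α ν T : ℝ} [hL : Fact (0 < L)] {N : ℕ}

/-- The Fourier coefficients of the pressure that balances the gradient part of `n`. -/
def pressureCoeff (L : ℝ) (n : Coeffs) (k : Mode) : ℂ :=
  Complex.I * (∑ j, (wave L k j : ℂ) * n k j) / (waveSq L k : ℂ)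

/-- Helmholtz decomposition: the pressure gradient removes exactly the gradient part of `n`. -/
lemma add_grad_pressureCoeff (n : Coeffs) (k : Mode) (i : Fin 3) :
    n k i + Complex.I * (wave L k i : ℂ) * pressureCoeff L n k = leray L n k i := by
  rw [pressureCoeff, leray]
  linear_combination (wave L k i : ℂ) * (∑ j, (wave L k j : ℂ) * n k j) / (waveSq L k : ℂ)
    * Complex.I_mul_I

lemma pressureCoeff_zero_mode (n : Coeffs) : pressureCoeff L n 0 = 0 := by
  simp [pressureCoeff, waveSq_zero]

lemma waveSq_mul_pressureCoeff_le (n : Coeffs) (k : Mode) :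
    waveSq L k * ‖pressureCoeff L n k‖ ^ 2 ≤ ∑ j, ‖n k j‖ ^ 2 := by
  by_cases hk : k = 0
  · rw [hk, waveSq_zero, zero_mul]; exact Finset.sum_nonneg fun _ _ => sq_nonneg _
  have h0 := waveSq_pos (L := L) hk
  have h1 : ‖∑ j, (wave L k j : ℂ) * n k j‖ ^ 2 ≤ waveSq L k * ∑ j, ‖n k j‖ ^ 2 := by
    have h2 : ‖∑ j, (wave L k j : ℂ) * n k j‖ ≤ ∑ j, |wave L k j| * ‖n k j‖ :=
      norm_sum_le_of_le _ fun j _ => by rw [norm_mul, Complex.norm_real, Real.norm_eq_abs]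
    refine (pow_le_pow_left₀ (norm_nonneg _) h2 2).trans ?_
    refine (Finset.sum_mul_sq_le_sq_mul_sq _ _ _).trans_eq ?_
    simp only [sq_abs, waveSq]
  rw [pressureCoeff, norm_div, norm_mul, Complex.norm_I, one_mul, div_pow, Complex.norm_real,
    Real.norm_of_nonneg h0.le, ← mul_div_assoc, div_le_iff₀ (by positivity)]
  calc _ ≤ waveSq L k * (waveSq L k * ∑ j, ‖n k j‖ ^ 2) := mul_le_mul_of_nonneg_left h1 h0.le
    _ = _ := by ring

lemma h1_pressureCoeff_le (n : Coeffs) (k : Mode) :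
    (1 + waveSq L k) * ‖pressureCoeff L n k‖ ^ 2 ≤ (1 + poincare L) * ∑ j, ‖n k j‖ ^ 2 := by
  by_cases hk : k = 0
  · rw [hk, pressureCoeff_zero_mode]
    have := poincare_nonneg (L := L)
    have h0 : 0 ≤ ∑ j, ‖n 0 j‖ ^ 2 := Finset.sum_nonneg fun _ _ => sq_nonneg _
    simpa using mul_nonneg (by positivity) h0
  have h1 := mul_le_mul_of_nonneg_right (one_le_poincare_mul (L := L) hk)
    (sq_nonneg ‖pressureCoeff L n k‖)
  have h2 := waveSq_mul_pressureCoeff_le (L := L) n k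
  have h3 := mul_le_mul_of_nonneg_left h2 (poincare_nonneg (L := L))
  linarith

lemma eq_pressureCoeff {k : Mode} (hk : k ≠ 0) {n : Coeffs} {z : ℂ}
    (h : (∑ j, (wave L k j : ℂ) * n k j) + Complex.I * (waveSq L k : ℂ) * z = 0) :
    z = pressureCoeff L n k := by
  have h0 : (waveSq L k : ℂ) ≠ 0 := by exact_mod_cast (waveSq_pos (L := L) hk).ne'
  rw [pressureCoeff, eq_div_iff h0]
  linear_combination -Complex.I * h + z * (waveSq L k : ℂ) * Complex.I_mul_I

lemma sum_wave_mul_wave (k : Mode) (z : ℂ) :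
    ∑ i, (wave L k i : ℂ) * (Complex.I * (wave L k i : ℂ) * z)
      = Complex.I * (waveSq L k : ℂ) * z := by
  rw [waveSq]
  push_cast
  rw [Finset.mul_sum, Finset.sum_mul]
  exact Finset.sum_congr rfl fun i _ => by ring

/-- The momentum balance of divergence free fields determines the pressure. -/
lemma pressure_eq_of_residualCoeff {c : Coeffs} {w w' : VField L} {q : L2 L}
    (hc : MemH L (-1) c) (hw : MemH L 1 (coeffs w)) (hw' : MemH L 0 (coeffs w'))
    (hq : ∫ x, q x = 0) (h : ∀ k i, residualCoeff α ν N c w w' q k i = 0) (k : Mode) :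
    fc (⇑q) k = pressureCoeff L (nonlin L α N (coeffs w)) k := by
  by_cases hk : k = 0
  · rw [hk, pressureCoeff_zero_mode, fc_zero_mode, hq]; simp
  refine eq_pressureCoeff hk ?_
  -- The divergence of the balance annihilates time derivative, viscosity and forcing, which leaves
  -- a Poisson equation for the pressure.
  have h1 : ∑ i, (wave L k i : ℂ) * residualCoeff α ν N c w w' q k i = 0 :=
    Finset.sum_eq_zero fun i _ => by rw [h k i, mul_zero]
  have e (i : Fin 3) : (wave L k i : ℂ) * residualCoeff α ν N c w w' q k i
      = (wave L k i : ℂ) * coeffs w' k i + (wave L k i : ℂ) * nonlin L α N (coeffs w) k i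
        + (ν * waveSq L k : ℝ) * ((wave L k i : ℂ) * coeffs w k i)
        + (wave L k i : ℂ) * (Complex.I * (wave L k i : ℂ) * fc (⇑q) k)
        - filterSymbol L α k * ((wave L k i : ℂ) * c k i) := by
    rw [residualCoeff, coeffs, coeffs]; ring
  simp only [e, Finset.sum_sub_distrib, Finset.sum_add_distrib, ← Finset.mul_sum, hc.divFree,
    hw.divFree, hw'.divFree, sum_wave_mul_wave] at h1
  linear_combination h1

/-- With the pressure inserted, the balance is the Leray projected mode equation. Both existence and
uniqueness pass through this equivalence. -/
lemma deriv_eq_of_residualCoeff {c : Coeffs} {w w' : VField L} {q : L2 L} {k : Mode}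
    {i : Fin 3} (hq : fc (⇑q) k = pressureCoeff L (nonlin L α N (coeffs w)) k) :
    residualCoeff α ν N c w w' q k i = 0 ↔ fc (⇑(w' i)) k
      = -((ν * waveSq L k : ℝ) : ℂ) * coeffs w k i
        + (filterSymbol L α k * c k i - leray L (nonlin L α N (coeffs w)) k i) := by
  rw [residualCoeff, hq, ← add_grad_pressureCoeff, coeffs]
  constructor <;> intro h <;> linear_combination h

end Pressure

/-! ### Regular weak solutions solve the mode equations; uniqueness. -/

section Uniqueness

variable {L α ν T : ℝ} [hL : Fact (0 < L)] {N : ℕ} {u₀ : VField L} {f : ℝ → Coeffs}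

lemma weight_zero_mode {c : Coeffs}
    (hc : Summable fun p : Mode × Fin 3 => waveSq L p.1 * ‖c p.1 p.2‖ ^ 2) (i : Fin 3) :
    weight L c (0, i) = 0 := by
  rw [weight_apply hc]; simp [waveAbs_zero]

lemma continuousOn_unweight {u : ℝ → XSeq} {s : Set ℝ} (hu : ContinuousOn u s) (k : Mode)
    (i : Fin 3) : ContinuousOn (fun t => unweight L (u t) k i) s := by
  refine ContinuousOn.div_const ?_ _
  intro t ht
  refine tendsto_iff_norm_sub_tendsto_zero.mpr (squeeze_zero (fun _ => norm_nonneg _) (fun τ => ?_)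
    (tendsto_iff_norm_sub_tendsto_zero.mp (hu t ht)))
  rw [← Pi.sub_apply (u τ : Mode × Fin 3 → ℂ), ← lp.coeFn_sub]
  exact lp.norm_apply_le_norm two_ne_zero _ _

lemma MemCH.unweight_weight {w : ℝ → VField L} (hw : MemCH T 1 w) {t : ℝ}
    (ht : t ∈ Set.Icc 0 T) : unweight L (weight L (coeffs (w t))) = coeffs (w t) :=
  ADM.unweight_weight (hw.mem t ht).summable_one (hw.mem t ht).zeroMean

lemma MemCH.continuousOn_fc {w : ℝ → VField L} (hw : MemCH T 1 w) (k : Mode) (i : Fin 3) :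
    ContinuousOn (fun t => fc (⇑(w t i)) k) (Set.Icc 0 T) := by
  refine (continuousOn_unweight (L := L) hw.continuousOn_weight k i).congr fun t ht => ?_
  exact (congrFun (congrFun (hw.unweight_weight ht) k) i).symm

lemma MemCH.integrable {w : ℝ → VField L} (hw : MemCH T 1 w)
    (hm : AEStronglyMeasurable w (volume.restrict (Set.Icc 0 T))) (i : Fin 3) :
    Integrable (fun t => w t i) (volume.restrict (Set.Icc 0 T)) := by
  obtain ⟨B, _, hB⟩ := hw.exists_norm_bound
  refine (integrable_const B).mono' ((continuous_apply i).comp_aestronglyMeasurable hm) ?_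
  filter_upwards [ae_restrict_mem measurableSet_Icc] with t ht using hB t ht i

/-- The right limit at `0` in `H₁` is computed both from continuity and from the initial condition;
limits are unique. -/
lemma coeffs_initial_eq (hα : 0 < α) (hT : 0 < T) (hu₀ : MemH L 0 (coeffs u₀))
    {w : ℝ → VField L} (hw : MemCH T 1 w)
    (hi : Tendsto (fun t => hNormSq L 1 (coeffs (w t - fun i => filter α ⇑(u₀ i))))
      (𝓝[>] 0) (𝓝 0)) : coeffs (w 0) = initialCoeffs α u₀ := by
  have hI := isInitial_initialCoeffs hα hu₀
  have hsub : Set.Icc 0 T ∈ 𝓝[>] (0 : ℝ) := Icc_mem_nhdsGT hT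
  have h0 : (0 : ℝ) ∈ Set.Icc 0 T := ⟨le_rfl, hT.le⟩
  have h1 : Tendsto (fun t => weight L (coeffs (w t))) (𝓝[>] 0)
      (𝓝 (weight L (coeffs (w 0)))) :=
    (hw.continuousOn_weight 0 h0).mono_left (nhdsWithin_le_of_mem hsub)
  have h2 : Tendsto (fun τ => ENNReal.ofReal
      (‖weight L (coeffs (w τ)) - weight L (initialCoeffs α u₀)‖ ^ 2)) (𝓝[>] 0) (𝓝 0) := by
    refine hi.congr' ?_
    filter_upwards [hsub] with τ hτ
    rw [coeffs_sub, ← hNormSq_one_sub (hw.mem τ hτ).summable_one hI.summable, initialCoeffs]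
  have h3 := (ENNReal.tendsto_toReal ENNReal.zero_ne_top).comp h2
  simp only [Function.comp_def, ENNReal.toReal_ofReal (sq_nonneg _), ENNReal.toReal_zero] at h3
  have h4 := h3.sqrt
  simp only [Real.sqrt_sq (norm_nonneg _), Real.sqrt_zero] at h4
  have h5 := tendsto_nhds_unique h1 (tendsto_iff_norm_sub_tendsto_zero.mpr h4)
  rw [← hw.unweight_weight h0, h5, ADM.unweight_weight hI.summable hI.zeroMean]

lemma IsRegularWeakSolution.isCoeffSolution (hα : 0 < α) (hT : 0 < T)
    (hu₀ : MemH L 0 (coeffs u₀)) (hf : MemL2HDist L T (-1) f) {w : ℝ → VField L} {q : ℝ → L2 L}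
    (h : IsRegularWeakSolution α ν T N u₀ f w q) :
    IsCoeffSolution L α ν T N (initialCoeffs α u₀) f (fun t => weight L (coeffs (w t))) ∧
      ∀ᵐ t ∂(volume.restrict (Set.Icc 0 T)), ∀ k,
        fc (⇑(q t)) k = pressureCoeff L (nonlin L α N (coeffs (w t))) k := by
  obtain ⟨w', hw', hd, hweak⟩ := h.equation
  have hw := h.memCH1
  rw [weakForm_iff hα hf h.memL2H2 hw hw' h.pressure] at hweak
  rw [isWeakTimeDeriv_iff hT (hw.integrable h.memL2H2.measurable)
    (fun i => (hw'.memLp i).integrable one_le_two) hw.continuousOn_fc] at hd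
  have hq : ∀ᵐ t ∂(volume.restrict (Set.Icc 0 T)), ∀ k,
      fc (⇑(q t)) k = pressureCoeff L (nonlin L α N (coeffs (w t))) k := by
    filter_upwards [hweak, hf.mem, hw'.mem, h.pressure_zeroMean,
      ae_restrict_mem measurableSet_Icc] with t ht htf htw htq htI k
    exact pressure_eq_of_residualCoeff htf (hw.mem t htI) htw htq ht k
  refine ⟨⟨hw.continuousOn_weight, fun t ht => weight_zero_mode (hw.mem t ht).summable_one,
    fun k i => ?_, fun k i => ?_⟩, hq⟩
  · rw [hw.unweight_weight ⟨le_rfl, hT.le⟩, coeffs_initial_eq hα hT hu₀ hw h.initial]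
  · refine ((hd k i).congr_left hT.le fun t ht => ?_).congr_right hT.le ?_
    · rw [hw.unweight_weight ht, coeffs]
    · filter_upwards [hweak, hq, ae_restrict_mem measurableSet_Icc] with t ht htq htI
      rw [hw.unweight_weight htI]
      exact (deriv_eq_of_residualCoeff (htq k)).mp (ht k i)

theorem IsRegularWeakSolution.unique (hα : 0 < α) (hν : 0 < ν) (hT : 0 < T)
    (hu₀ : MemH L 0 (coeffs u₀)) (hf : MemL2HDist L T (-1) f) {w₁ w₂ : ℝ → VField L}
    {q₁ q₂ : ℝ → L2 L} (h₁ : IsRegularWeakSolution α ν T N u₀ f w₁ q₁)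
    (h₂ : IsRegularWeakSolution α ν T N u₀ f w₂ q₂) :
    (∀ t ∈ Set.Icc 0 T, w₁ t = w₂ t) ∧
      ∀ᵐ t ∂(volume.restrict (Set.Icc 0 T)), q₁ t = q₂ t := by
  obtain ⟨hs₁, hq₁⟩ := h₁.isCoeffSolution hα hT hu₀ hf
  obtain ⟨hs₂, hq₂⟩ := h₂.isCoeffSolution hα hT hu₀ hf
  have hw : ∀ t ∈ Set.Icc 0 T, w₁ t = w₂ t := fun t ht => by
    have h0 : weight L (coeffs (w₁ t)) = weight L (coeffs (w₂ t)) :=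
      IsCoeffSolution.unique hα hν hT.le (isInitial_initialCoeffs hα hu₀)
        (isForcing_of_memL2HDist hT.le hf) hs₁ hs₂ ht
    have h1 : unweight L (weight L (coeffs (w₁ t))) = unweight L (weight L (coeffs (w₂ t))) := by
      rw [h0]
    rw [h₁.memCH1.unweight_weight ht, h₂.memCH1.unweight_weight ht] at h1
    funext i
    exact L2_ext fun k => congrFun (congrFun h1 k) i
  refine ⟨hw, ?_⟩
  filter_upwards [hq₁, hq₂, ae_restrict_mem measurableSet_Icc] with t h1 h2 ht
  exact L2_ext fun k => by rw [h1, h2, hw t ht]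

end Uniqueness

/-! ### Construction of a regular weak solution from the mode equations. -/

section Existence

variable {L α ν T : ℝ} [hL : Fact (0 < L)] {N : ℕ} {u₀ : VField L} {f : ℝ → Coeffs}
  {w w' : ℝ → VField L} {q : ℝ → L2 L}

lemma weight_unweight {a : XSeq} (ha : ∀ i, a (0, i) = 0)
    (hs : Summable fun p : Mode × Fin 3 => waveSq L p.1 * ‖unweight L a p.1 p.2‖ ^ 2) :
    weight L (unweight L a) = a := by
  ext p
  rw [weight_apply hs, waveAbs_mul_unweight ha]

/-- The vector field with given Fourier coefficients. -/
def ofCoeffs (c : Coeffs) : VField L := fun i => ofCoeff fun k => c k i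

lemma coeffs_ofCoeffs {c : Coeffs} (h : Summable fun p : Mode × Fin 3 => ‖c p.1 p.2‖ ^ 2)
    (hr : ∀ k i, c (-k) i = conj (c k i)) : coeffs (ofCoeffs c : VField L) = c := by
  ext k i
  exact fc_ofCoeff (Summable.fiber (g := fun p : Mode × Fin 3 => ‖c p.1 p.2‖ ^ 2) h i)
    (fun k => hr k i) k

lemma aestronglyMeasurable_vField {μ : Measure ℝ} {w : ℝ → VField L}
    (hw : ∀ k i, AEMeasurable (fun t => fc (⇑(w t i)) k) μ) : AEStronglyMeasurable w μ := by
  have h (i : Fin 3) : AEStronglyMeasurable (fun t => w t i) μ :=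
    aestronglyMeasurable_of_fc fun k => hw k i
  have h2 : AEStronglyMeasurable (fun t =>
      ∑ i, ContinuousLinearMap.single ℝ (fun _ : Fin 3 => L2 L) i (w t i)) μ :=
    Finset.aestronglyMeasurable_fun_sum _ fun i _ =>
      (ContinuousLinearMap.continuous _).comp_aestronglyMeasurable (h i)
  refine h2.congr (Eventually.of_forall fun t => ?_)
  simp only [ContinuousLinearMap.single_apply]
  exact Finset.univ_sum_single (w t)

/-- Continuity in `H₁` of a field with prescribed Fourier coefficients. -/
lemma memCH_of_coeffs {u : ℝ → XSeq} (huc : Continuous u)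
    (hu0 : ∀ t ∈ Set.Icc 0 T, ∀ i, u t (0, i) = 0)
    (hr : ∀ t ∈ Set.Icc 0 T, ∀ k i, unweight L (u t) (-k) i = conj (unweight L (u t) k i))
    (hd : ∀ t ∈ Set.Icc 0 T, ∀ k, ∑ i, (wave L k i : ℂ) * unweight L (u t) k i = 0)
    (hw : ∀ t ∈ Set.Icc 0 T, coeffs (w t) = unweight L (u t)) : MemCH T 1 w := by
  have hs : ∀ t ∈ Set.Icc 0 T, Summable fun p : Mode × Fin 3 =>
      waveSq L p.1 * ‖unweight L (u t) p.1 p.2‖ ^ 2 := fun t ht =>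
    (hasSum_norm_sq (u t)).summable.congr fun p => sq_norm_eq_waveSq_mul (hu0 t ht) p
  refine ⟨fun t ht => ?_, fun t ht => ?_⟩
  · rw [hw t ht]
    refine ⟨hr t ht, hd t ht, unweight_zero_mode _, (hNormSq_lt_top_iff 1 _).mpr ?_⟩
    simpa only [Real.rpow_one] using hs t ht
  · have h1 : Tendsto (fun τ => ENNReal.ofReal (‖u τ - u t‖ ^ 2)) (𝓝[Set.Icc 0 T] t) (𝓝 0) := by
      have h2 : Continuous fun τ => ENNReal.ofReal (‖u τ - u t‖ ^ 2) :=
        ENNReal.continuous_ofReal.comp ((huc.sub continuous_const).norm.pow 2)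
      have h3 := (h2.tendsto t).mono_left (nhdsWithin_le_nhds (s := Set.Icc 0 T))
      simpa using h3
    refine h1.congr' ?_
    filter_upwards [self_mem_nhdsWithin] with τ hτ
    rw [coeffs_sub, hw τ hτ, hw t ht, hNormSq_one_sub (hs τ hτ) (hs t ht),
      weight_unweight (hu0 τ hτ) (hs τ hτ), weight_unweight (hu0 t ht) (hs t ht)]

lemma memL2H_two_of_coeffs (hT : 0 ≤ T) {u : ℝ → XSeq}
    (hw1 : MemCH T 1 w) (hw : ∀ t ∈ Set.Icc 0 T, coeffs (w t) = unweight L (u t))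
    (hs : Summable fun p : Mode × Fin 3 =>
      ∫ s in (0 : ℝ)..T, (waveSq L p.1 * ‖unweight L (u s) p.1 p.2‖) ^ 2) : MemL2H T 2 w := by
  have hc (k : Mode) (i : Fin 3) := hw1.continuousOn_fc k i
  have hm (k : Mode) (i : Fin 3) : AEMeasurable (fun t => fc (⇑(w t i)) k)
      (volume.restrict (Set.Icc 0 T)) := (hc k i).aemeasurable measurableSet_Icc
  have hi (p : Mode × Fin 3) : Integrable
      (fun t => waveSq L p.1 ^ (2 : ℝ) * ‖coeffs (w t) p.1 p.2‖ ^ 2)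
      (volume.restrict (Set.Icc 0 T)) :=
    (continuousOn_const.mul ((hc p.1 p.2).norm.pow 2)).integrableOn_Icc
  have hsum : Summable fun p : Mode × Fin 3 =>
      ∫ t in Set.Icc 0 T, waveSq L p.1 ^ (2 : ℝ) * ‖coeffs (w t) p.1 p.2‖ ^ 2 := by
    refine hs.congr fun p => ?_
    rw [intervalIntegral.integral_of_le hT, ← integral_Icc_eq_integral_Ioc]
    refine setIntegral_congr_fun measurableSet_Icc fun t ht => ?_
    rw [hw t ht, mul_pow, Real.rpow_two]
  refine ⟨aestronglyMeasurable_vField hm, ?_, ?_⟩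
  · filter_upwards [ae_summable_of_summable_integral (fun p t => sobolev_term_nonneg 2 _ p) hi
      hsum, ae_restrict_mem measurableSet_Icc] with t ht htI
    exact ⟨(hw1.mem t htI).isReal, (hw1.mem t htI).divFree, (hw1.mem t htI).zeroMean,
      (hNormSq_lt_top_iff 2 _).mpr ht⟩
  · refine (lintegral_hNormSq_lt_top_iff 2 hm).mpr ⟨hi, ?_⟩
    simp only [integral_const_mul] at hsum
    exact hsum

lemma aemeasurable_nonlin (hα : 0 < α) (hw : MemL2H T 2 w) (k : Mode) (i : Fin 3) :
    AEMeasurable (fun t => nonlin L α N (coeffs (w t)) k i) (volume.restrict (Set.Icc 0 T)) := by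
  simp only [← dvgCoeff_flux hα]
  refine Finset.aemeasurable_fun_sum _ fun j _ => ?_
  exact (aemeasurable_fc_flux hα hw.aestronglyMeasurable_apply i j k).const_mul _

lemma nonlin_neg_mode (hα : 0 < α) (v : VField L) (k : Mode) (i : Fin 3) :
    nonlin L α N (coeffs v) (-k) i = conj (nonlin L α N (coeffs v) k i) := by
  rw [← dvgCoeff_flux hα, ← dvgCoeff_flux hα, dvgCoeff_neg_mode]

lemma pressureCoeff_neg_mode {n : Coeffs} (hn : ∀ k i, n (-k) i = conj (n k i)) (k : Mode) :
    pressureCoeff L n (-k) = conj (pressureCoeff L n k) := by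
  simp only [pressureCoeff, hn, wave_neg, waveSq_neg, map_div₀, map_mul, map_sum,
    Complex.conj_I, Complex.conj_ofReal]
  push_cast
  simp only [neg_mul, Finset.sum_neg_distrib, mul_neg]

lemma fc_ofCoeff_pressureCoeff (hα : 0 < α) {v : VField L} (hv : MemH L 1 (coeffs v)) (k : Mode) :
    fc (⇑(ofCoeff (pressureCoeff L (nonlin L α N (coeffs v))) : L2 L)) k
      = pressureCoeff L (nonlin L α N (coeffs v)) k := by
  refine fc_ofCoeff ?_ (pressureCoeff_neg_mode fun k i => nonlin_neg_mode hα v k i) k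
  have hs : Summable fun k => ∑ j, ‖nonlin L α N (coeffs v) k j‖ ^ 2 := by
    refine summable_sum fun j _ => (summable_dvgCoeff_flux (N := N) hα hv j).congr fun k => ?_
    rw [dvgCoeff_flux hα]
  refine Summable.of_nonneg_of_le (fun k => sq_nonneg _) (fun k => ?_)
    (hs.mul_left (1 + poincare L))
  refine le_trans ?_ (h1_pressureCoeff_le _ k)
  exact le_mul_of_one_le_left (sq_nonneg _) (by linarith [waveSq_nonneg (L := L) k])

/-- The pressure inherits the decay of the nonlinear term: its `H¹` density in mode `k` is at most a
constant times `G(k)²`, uniformly in time. -/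
lemma memL2H1_pressure (hα : 0 < α) (hw : MemL2H T 2 w) (hw1 : MemCH T 1 w)
    (hq : ∀ t ∈ Set.Icc 0 T, ∀ k, fc (⇑(q t)) k = pressureCoeff L (nonlin L α N (coeffs (w t))) k) :
    MemL2H1 T q := by
  have hP := poincare_nonneg (L := L)
  have hm (k : Mode) : AEMeasurable (fun t => fc (⇑(q t)) k) (volume.restrict (Set.Icc 0 T)) := by
    have h1 : AEMeasurable (fun t => pressureCoeff L (nonlin L α N (coeffs (w t))) k)
        (volume.restrict (Set.Icc 0 T)) :=
      ((Finset.aemeasurable_fun_sum _ fun j _ =>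
        (aemeasurable_nonlin hα hw k j).const_mul _).const_mul _).div_const _
    refine h1.congr ?_
    filter_upwards [ae_restrict_mem measurableSet_Icc] with t ht using (hq t ht k).symm
  have hms := aestronglyMeasurable_of_fc hm
  obtain ⟨B, hB⟩ := hw1.exists_bound
  set C : ℝ := (1 + poincare L) * (3 * (3 * convConst L N * B ^ 2) ^ 2) with hC
  have hle (k : Mode) : ∀ᵐ t ∂(volume.restrict (Set.Icc 0 T)),
      (1 + waveSq L k) * ‖fc (⇑(q t)) k‖ ^ 2 ≤ C * filterSymbol L α k ^ 2 := by
    filter_upwards [ae_restrict_mem measurableSet_Icc] with t ht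
    rw [hq t ht]
    refine (h1_pressureCoeff_le _ k).trans ?_
    rw [hC, mul_assoc]
    refine mul_le_mul_of_nonneg_left ?_ (by positivity)
    have h2 : ∑ j, ‖nonlin L α N (coeffs (w t)) k j‖ ^ 2
        ≤ ∑ _j : Fin 3, (filterSymbol L α k * (3 * convConst L N * B ^ 2)) ^ 2 := by
      refine Finset.sum_le_sum fun j _ => pow_le_pow_left₀ (norm_nonneg _) ?_ 2
      refine (norm_nonlin_le (L := L) (hw1.mem t ht) k j).trans
        (mul_le_mul_of_nonneg_left ?_ (filterSymbol_pos k).le)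
      have h3 := convConst_nonneg (L := L) (N := N)
      have := hB t ht
      gcongr
    refine h2.trans_eq ?_
    rw [Finset.sum_const, Finset.card_univ, Fintype.card_fin, nsmul_eq_mul]
    push_cast; ring
  have hn (k : Mode) : 0 ≤ 1 + waveSq L k := add_nonneg zero_le_one (waveSq_nonneg k)
  have hi (k : Mode) : Integrable (fun t => (1 + waveSq L k) * ‖fc (⇑(q t)) k‖ ^ 2)
      (volume.restrict (Set.Icc 0 T)) := by
    refine (integrable_const (C * filterSymbol L α k ^ 2)).mono'
      (((hm k).norm.pow_const 2).const_mul _).aestronglyMeasurable ?_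
    filter_upwards [hle k] with t ht
    rwa [Real.norm_of_nonneg (mul_nonneg (hn k) (sq_nonneg _))]
  refine ⟨hms, (lintegral_h1NormSq_lt_top_iff hms).mpr ⟨hi, ?_⟩⟩
  simp only [← integral_const_mul]
  refine Summable.of_nonneg_of_le
    (fun k => integral_nonneg fun t => mul_nonneg (hn k) (sq_nonneg _))
    (fun k => integral_mono_ae (hi k) (integrable_const _) (hle k)) ?_
  simp only [integral_const, smul_eq_mul]
  exact ((summable_filterSymbol_sq hα).mul_left _).mul_left _

lemma memL2H_zero : MemL2H T 0 fun _ => (0 : VField L) := by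
  have h : coeffs (0 : VField L) = 0 := by
    ext k i; exact fc_zero k
  refine ⟨aestronglyMeasurable_const, Eventually.of_forall fun t => ⟨?_, ?_, ?_, ?_⟩, ?_⟩ <;>
  simp [h, hNormSq]

lemma summable_coeffs (v : VField L) :
    Summable fun p : Mode × Fin 3 => ‖coeffs v p.1 p.2‖ ^ 2 :=
  summable_mode_fin (g := fun p => ‖coeffs v p.1 p.2‖ ^ 2) (fun _ => sq_nonneg _)
    fun i => summable_fc_norm_sq (v i)

/-- The time derivative determined by the momentum balance. -/
def timeDeriv (α ν : ℝ) (N : ℕ) (c : Coeffs) (w : VField L) (q : L2 L) : VField L :=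
  fun i => -residual α ν N c w 0 q i

/-- The balance is affine in the time derivative with unit coefficient, so the negated residual at
zero time derivative solves it. -/
lemma residualCoeff_timeDeriv (hα : 0 < α) {c : Coeffs} {v : VField L} {p : L2 L}
    (hc : MemH L (-1) c) (hv1 : MemH L 1 (coeffs v)) (hv2 : MemH L 2 (coeffs v))
    (hp : Summable fun k => waveSq L k * ‖fc (⇑p) k‖ ^ 2) (k : Mode) (i : Fin 3) :
    residualCoeff α ν N c v (timeDeriv α ν N c v p) p k i = 0 := by
  rw [residualCoeff, timeDeriv, fc_neg, fc_residual hα hc hv1 hv2 hp, residualCoeff,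
    Pi.zero_apply, fc_zero]
  ring

/-- With the right pressure the time derivative equals the projected right-hand side, every term of
which is divergence-free with zero mean. -/
lemma memH_timeDeriv (hα : 0 < α) {c : Coeffs} {v : VField L} {p : L2 L}
    (hc : MemH L (-1) c) (hv1 : MemH L 1 (coeffs v)) (hv2 : MemH L 2 (coeffs v))
    (hp : Summable fun k => waveSq L k * ‖fc (⇑p) k‖ ^ 2)
    (hpc : ∀ k, fc (⇑p) k = pressureCoeff L (nonlin L α N (coeffs v)) k) :
    MemH L 0 (coeffs (timeDeriv α ν N c v p)) := by
  have h (k : Mode) (i : Fin 3) := (deriv_eq_of_residualCoeff (hpc k)).mp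
    (residualCoeff_timeDeriv (ν := ν) (N := N) hα hc hv1 hv2 hp k i)
  refine ⟨fun k i => fc_neg_mode _ _, fun k => ?_, fun i => ?_, ?_⟩
  · have e (i : Fin 3) : (wave L k i : ℂ) * coeffs (timeDeriv α ν N c v p) k i
        = -((ν * waveSq L k : ℝ) : ℂ) * ((wave L k i : ℂ) * coeffs v k i)
          + filterSymbol L α k * ((wave L k i : ℂ) * c k i)
          - (wave L k i : ℂ) * leray L (nonlin L α N (coeffs v)) k i := by
      rw [coeffs, h]; ring
    simp only [e, Finset.sum_sub_distrib, Finset.sum_add_distrib, ← Finset.mul_sum,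
      hv1.divFree, hc.divFree, sum_wave_mul_leray]
    ring
  · rw [coeffs, h, hv1.zeroMean, hc.zeroMean, leray_zero_mode, nonlin_zero_mode]
    ring
  · rw [hNormSq_lt_top_iff]
    simp only [Real.rpow_zero, one_mul]
    exact summable_coeffs _

lemma memL2H_timeDeriv (hα : 0 < α) (hf : MemL2HDist L T (-1) f) (hw : MemL2H T 2 w)
    (hw1 : MemCH T 1 w) (hq : MemL2H1 T q)
    (hpc : ∀ t ∈ Set.Icc 0 T, ∀ k,
      fc (⇑(q t)) k = pressureCoeff L (nonlin L α N (coeffs (w t))) k) :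
    MemL2H T 0 fun t => timeDeriv α ν N (f t) (w t) (q t) := by
  have hm (i : Fin 3) : MemLp (fun t => timeDeriv α ν N (f t) (w t) (q t) i) 2
      (volume.restrict (Set.Icc 0 T)) :=
    (memLp_residual (ν := ν) (N := N) hα hf hw hw1 memL2H_zero hq i).neg
  have hfc (k : Mode) (i : Fin 3) := aemeasurable_fc (hm i).1 k
  have h2 (i : Fin 3) := (memLp_two_iff_fc fun k => hfc k i).mp (hm i)
  refine ⟨aestronglyMeasurable_vField hfc, ?_, ?_⟩
  · filter_upwards [hf.mem, hw.mem, hq.ae_h1, ae_restrict_mem measurableSet_Icc] with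
      t htf htw htq ht
    exact memH_timeDeriv hα htf (hw1.mem t ht) htw htq (hpc t ht)
  · refine (lintegral_hNormSq_lt_top_iff 0
      (c := fun t => coeffs (timeDeriv α ν N (f t) (w t) (q t))) hfc).mpr ⟨fun p => ?_, ?_⟩
    · simp only [Real.rpow_zero, one_mul]
      exact (h2 p.2).1 p.1
    · simp only [Real.rpow_zero, one_mul]
      exact summable_mode_fin (g := fun p => ∫ t in Set.Icc 0 T,
        ‖fc (⇑(timeDeriv α ν N (f t) (w t) (q t) p.2)) p.1‖ ^ 2)
        (fun p => integral_nonneg fun t => sq_nonneg _) fun i => (h2 i).2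

theorem exists_isRegularWeakSolution (hα : 0 < α) (hν : 0 < ν) (hT : 0 < T)
    (hu₀ : MemH L 0 (coeffs u₀)) (hf : MemL2HDist L T (-1) f) :
    ∃ (w : ℝ → VField L) (q : ℝ → L2 L), IsRegularWeakSolution α ν T N u₀ f w q := by
  have hI := isInitial_initialCoeffs hα hu₀
  obtain ⟨u, huc, hu, hr, hd, hs⟩ := exists_coeffSolution (N := N) hα hν hT.le hI
    (isForcing_of_memL2HDist hT.le hf)
  -- Reality of the coefficients is known only for `t` in `[0,T]`, so the synthesis is guaranteed
  -- there; other times carry whatever `ofCoeff` returns and play no role.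
  set w : ℝ → VField L := fun t => ofCoeffs (unweight L (u t)) with hw
  set q : ℝ → L2 L := fun t => ofCoeff (pressureCoeff L (nonlin L α N (coeffs (w t)))) with hq
  have hwc : ∀ t ∈ Set.Icc 0 T, coeffs (w t) = unweight L (u t) := fun t ht => by
    refine coeffs_ofCoeffs ?_ (hr t ht)
    refine Summable.of_nonneg_of_le (fun p => sq_nonneg _) (fun p => ?_)
      ((hasSum_norm_sq (u t)).summable.mul_left (poincare L))
    rw [sq_norm_eq_waveSq_mul (L := L) (hu.zeroMean t ht), ← mul_assoc]
    by_cases hp : p.1 = 0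
    · rw [hp, unweight_zero_mode]; simp
    · exact le_mul_of_one_le_left (sq_nonneg _) (one_le_poincare_mul hp)
  have hw1 := memCH_of_coeffs huc hu.zeroMean hr hd hwc
  have hw2 := memL2H_two_of_coeffs hT.le hw1 hwc hs
  have hqc : ∀ t ∈ Set.Icc 0 T, ∀ k,
      fc (⇑(q t)) k = pressureCoeff L (nonlin L α N (coeffs (w t))) k := fun t ht k =>
    fc_ofCoeff_pressureCoeff hα (hw1.mem t ht) k
  have hq1 := memL2H1_pressure hα hw2 hw1 hqc
  have hw' := memL2H_timeDeriv (ν := ν) hα hf hw2 hw1 hq1 hqc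
  have hres : ∀ᵐ t ∂(volume.restrict (Set.Icc 0 T)), ∀ k i,
      residualCoeff α ν N (f t) (w t) (timeDeriv α ν N (f t) (w t) (q t)) (q t) k i = 0 := by
    filter_upwards [hf.mem, hw2.mem, hq1.ae_h1, ae_restrict_mem measurableSet_Icc] with
      t htf htw htq ht k i
    exact residualCoeff_timeDeriv hα htf (hw1.mem t ht) htw htq k i
  have h0 : (0 : ℝ) ∈ Set.Icc 0 T := ⟨le_rfl, hT.le⟩
  refine ⟨w, q, hw2, hw1, hq1, ?_, ?_, _, hw', ?_,
    (weakForm_iff hα hf hw2 hw1 hw' hq1).mpr hres⟩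
  · filter_upwards [ae_restrict_mem measurableSet_Icc] with t ht
    have h1 := hqc t ht 0
    have hL0 : (L : ℂ) ≠ 0 := by exact_mod_cast hL.out.ne'
    rw [pressureCoeff_zero_mode, fc_zero_mode] at h1
    simpa [hL0] using h1
  · have hw0 : w 0 = fun i => filter α ⇑(u₀ i) := by
      funext i
      refine L2_ext fun k => ?_
      have h1 : coeffs (w 0) k i = initialCoeffs α u₀ k i := by rw [hwc 0 h0, hu.initial]
      exact h1
    rw [← hw0]
    exact (hw1.continuous 0 h0).mono_left (nhdsWithin_le_of_mem (Icc_mem_nhdsGT hT))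
  · rw [isWeakTimeDeriv_iff hT (hw1.integrable hw2.measurable)
      (fun i => (hw'.memLp i).integrable one_le_two) hw1.continuousOn_fc]
    intro k i
    refine ((hu.equation k i).congr_left hT.le fun t ht => ?_).congr_right hT.le ?_
    · rw [← hwc t ht, coeffs]
    · filter_upwards [hres, ae_restrict_mem measurableSet_Icc] with t ht htI
      rw [(deriv_eq_of_residualCoeff (hqc t htI k)).mp (ht k i), ← hwc t htI]

end Existence

end ADM

end

theorem theorem2 (L : ℝ) [Fact (0 < L)] (α ν T : ℝ) (hα : 0 < α) (hν : 0 < ν) (hT : 0 < T)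
    (N : ℕ) (u₀ : ADM.VField L) (hu₀ : ADM.MemH L 0 (ADM.coeffs u₀))
    (f : ℝ → ADM.Coeffs) (hf : ADM.MemL2HDist L T (-1) f) :
    (∃ (w : ℝ → ADM.VField L) (q : ℝ → ADM.L2 L),
      ADM.IsRegularWeakSolution α ν T N u₀ f w q) ∧
    (∀ (w₁ w₂ : ℝ → ADM.VField L) (q₁ q₂ : ℝ → ADM.L2 L),
      ADM.IsRegularWeakSolution α ν T N u₀ f w₁ q₁ →
      ADM.IsRegularWeakSolution α ν T N u₀ f w₂ q₂ →
      (∀ t ∈ Set.Icc 0 T, w₁ t = w₂ t) ∧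
      (∀ᵐ t ∂(MeasureTheory.volume.restrict (Set.Icc 0 T)), q₁ t = q₂ t)) := by
  exact ⟨ADM.exists_isRegularWeakSolution hα hν hT hu₀ hf,
    fun _ _ _ _ h₁ h₂ => h₁.unique hα hν hT hu₀ hf h₂⟩
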